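/- Let $\mathbb F$ be an algebraically closed field of prime characteristic $p$, let $T\ge 1$ be an integer prime to $p$, let $\eta\in\mathbb F$ be a primitive $T$-th root of unity, and let $W=W_{\bar0}\oplus W_{\bar1}$ be a $\mathbb Z_2$-graded vector space over $\mathbb F$. Let $$\mathcal E_T(W)=\{a(x)\in(\operatorname{End}W)[[x^{1/T},x^{-1/T}]] : a(x)w\in W((x^{1/T}))\ \text{for all } w\in W\},$$ graded by the parity of $\operatorname{End}W$ and by $\mathcal E_T(W)^r=\{a(x) : (ga)(x^{1/T})=\eta^r a(x^{1/T})\}$, $r\in\mathbb Z_T$, where $(ga)(x^{1/T})=a(\eta^{-1}x^{1/T})$. Call $a(x)$ homogeneous if it is homogeneous for both gradings. Homogeneous $a(x),b(x)$ are mutually local if $(x_1-x_2)^k a(x_1)b(x_2)=(-1)^{|a||b|}(x_1-x_2)^k b(x_2)a(x_1)$ for some $k\in\mathbb N$. A subspace of $\mathcal E_T(W)$ is local if it is spanned by homogeneous elements and any two homogeneous elements of it are mutually local. For mutually local homogeneous $a(x)\in\mathcal E_T(W)^r$ and $b(x)$, and for $n\in\mathbb Z$, put $$a(x)_nb(x)=\operatorname{Res}_{x_1}\operatorname{Res}_{x_0}x_0^n\Bigl(\tfrac{x_1-x_0}{x}\Bigr)^{r/T}\Bigl(x_0^{-1}\delta\bigl(\tfrac{x_1-x}{x_0}\bigr)a(x_1)b(x)-(-1)^{|a||b|}x_0^{-1}\delta\bigl(\tfrac{x-x_1}{-x_0}\bigr)b(x)a(x_1)\Bigr),$$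 where binomials are expanded in nonnegative powers of their second term and binomial coefficients of rational numbers with denominator prime to $p$ are reduced to $\mathbb F$. Theorem. Let $S\subset\mathcal E_T(W)$ be a local subspace, and let $\langle S\rangle$ be the smallest subspace that contains $S$ and $1_W$ and is closed under all products $a(x)_nb(x)$, $n\in\mathbb Z$, of mutually local homogeneous elements. Then: (1) $\langle S\rangle$ is a local subspace, and with the parity of $\mathcal E_T(W)$, the vacuum vector $1_W$ and the bilinear operations determined by $Y(a(x),x_0)b(x)=\sum_{n\in\mathbb Z}a(x)_nb(x)\,x_0^{-n-1}$ for homogeneous $a(x),b(x)\in\langle S\rangle$, it is a vertex superalgebra. (2) $g$ restricts to an automorphism of the vertex superalgebra $\langle S\rangle$ with $g^T=1$, and for $m\ge 0$ one has $g^m=1$ on $\langle S\rangle$ if and only if $g^m$ fixes every element of $S$; so $g$ has the same order on $\langle S\rangle$ as on $S$, and this order is $T$ as soon as $T$ is its order on $S$. (3) $W$ is a faithful $g$-twisted super $\langle S\rangle$-module with $Y_W(a(x),z)=a(z)$ for $a(x)\in\langle S\rangle$. That is, $Y_W$ is injective; $Y_W(u,z)$ has coefficients of parity $|u|$, satisfies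 $Y_W(u,z)w\in W((z^{1/T}))$ for $w\in W$, and involves only the powers $z^{-r/T+k}$, $k\in\mathbb Z$, if $gu=\eta^ru$; $Y_W(\mathbf 1,z)=1_W$; and for all $0\le r<T$ and parity-homogeneous $u,v\in\langle S\rangle$ with $gu=\eta^ru$ $$x_0^{-1}\delta\bigl(\tfrac{x_1-x_2}{x_0}\bigr)Y_W(u,x_1)Y_W(v,x_2)-(-1)^{|u||v|}x_0^{-1}\delta\bigl(\tfrac{x_2-x_1}{-x_0}\bigr)Y_W(v,x_2)Y_W(u,x_1)=x_2^{-1}\delta\bigl(\tfrac{x_1-x_0}{x_2}\bigr)\bigl(\tfrac{x_1-x_0}{x_2}\bigr)^{-r/T}Y_W(Y(u,x_0)v,x_2).$$ -/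

import Mathlib

/-!
Conventions. A formal series `a(x) = ∑ a_{n/T} x^{-n/T-1}`, `n ∈ ℤ`, in `(End W)[[x^{1/T}, x^{-1/T}]]`
is stored as the function `a : ℤ → Module.End F W` of its modes: `a n` is `a_{n/T}`, the coefficient
of `x^{-n/T-1}`. For `T = 1` this is the usual mode notation `a(x) = ∑ a_n x^{-n-1}`.
-/

namespace TwistedVertex

noncomputable section

/-- The binomial coefficient `α(α-1)⋯(α-i+1)/i!` of a rational number `α`, as an element of `F`.
If the denominator of `α` is prime to the characteristic of `F`, then so is that of
`Ring.choose α i`, and the cast is the reduction map. -/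
def binom (F : Type*) [Field F] (α : ℚ) (i : ℕ) : F := ((Ring.choose α i : ℚ) : F)

/-- The sign `(-1)^{αβ}` for parities `α, β ∈ ℤ/2`. -/
def superSign (F : Type*) [Field F] (α β : ZMod 2) : F := (-1) ^ (α.val * β.val)

section Series

variable {F W : Type*} [Field F] [AddCommGroup W] [Module F W]

open Classical in
/-- The sum of a family of operators such that only finitely many of them are nonzero on any given
vector (and `0` for other families). -/
def locSum (f : ℕ → Module.End F W) : Module.End F W :=
  if h : ∀ w, (Function.support fun i => f i w).Finite then
    { toFun := fun w => ∑ᶠ i, f i w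
      map_add' := fun v w => by
        simp only [map_add]
        exact finsum_add_distrib (h v) (h w)
      map_smul' := fun c w => by
        simp only [map_smul, RingHom.id_apply]
        exact (smul_finsum' c (h w)).symm }
  else 0

/-- For truncated series `a(x)`, `b(x)`: the coefficient of `x₀^{-l-1} x₁^{-m/T-1} x₂^{-n/T-1}` in
`x₀⁻¹ δ((x₁-x₂)/x₀) a(x₁) b(x₂) - s x₀⁻¹ δ((x₂-x₁)/(-x₀)) b(x₂) a(x₁)`, that is, the coefficient of
`x₁^{-m/T-1} x₂^{-n/T-1}` in `(x₁-x₂)^l a(x₁) b(x₂) - s (-x₂+x₁)^l b(x₂) a(x₁)`, where each binomial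
is expanded in nonnegative powers of its second term. -/
def bracket (T : ℕ) (s : F) (l m n : ℤ) (a b : ℤ → Module.End F W) : Module.End F W :=
  locSum (fun i : ℕ => ((-1) ^ i * binom F (l : ℚ) i) • (a (m + T * (l - i)) * b (n + T * i)))
    - (s * (-1) ^ l) •
      locSum (fun i : ℕ => ((-1) ^ i * binom F (l : ℚ) i) • (b (n + T * (l - i)) * a (m + T * i)))

/-- `W((x^{1/T}))`-truncation: the space of the `a(x) ∈ (End W)[[x^{1/T}, x^{-1/T}]]` with
`a(x) w ∈ W((x^{1/T}))` for all `w ∈ W`. -/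
def fieldSpace (F W : Type*) [Field F] [AddCommGroup W] [Module F W] :
    Submodule F (ℤ → Module.End F W) where
  carrier := {a | ∀ w, ∃ N : ℤ, ∀ n, N ≤ n → a n w = 0}
  zero_mem' := fun w => ⟨0, fun n _ => by simp⟩
  add_mem' := by
    intro a b ha hb w
    obtain ⟨M, hM⟩ := ha w
    obtain ⟨N, hN⟩ := hb w
    refine ⟨max M N, fun n hn => ?_⟩
    simp [hM n (le_trans (le_max_left _ _) hn), hN n (le_trans (le_max_right _ _) hn)]
  smul_mem' := by
    intro c a ha w
    obtain ⟨M, hM⟩ := ha w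
    exact ⟨M, fun n hn => by simp [hM n hn]⟩

/-- The map `a(x^{1/T}) ↦ a(η⁻¹ x^{1/T})` for `η` with `η^T = 1`; it multiplies the coefficient of
`x^{-n/T-1}` by `η^{n+T} = η^n`. -/
def twist (η : F) : (ℤ → Module.End F W) →ₗ[F] (ℤ → Module.End F W) where
  toFun a := fun n => η ^ n • a n
  map_add' a b := by funext n; simp
  map_smul' c a := by funext n; simp [smul_comm c]

/-- The constant series `1_W`, i.e. the coefficient of `x^0` is the identity. -/
def idField (T : ℕ) : ℤ → Module.End F W := fun n => if n = -(T : ℤ) then 1 else 0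

/-- `(End W)_α`, for a `ℤ/2`-graded space `W`. -/
def endParity (𝒲 : ZMod 2 → Submodule F W) (α : ZMod 2) : Submodule F (Module.End F W) where
  carrier := {f | ∀ β, ∀ w ∈ 𝒲 β, f w ∈ 𝒲 (α + β)}
  zero_mem' := fun β w _ => by simp
  add_mem' := fun hf hg β w hw => add_mem (hf β w hw) (hg β w hw)
  smul_mem' := fun c _ hf β w hw => Submodule.smul_mem _ c (hf β w hw)

/-- The homogeneous elements `a(x)` of parity `α` of the space of twisted fields with
`a(η⁻¹ x^{1/T}) = η^r a(x^{1/T})`. -/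
def IsHomogeneous (η : F) (𝒲 : ZMod 2 → Submodule F W) (r : ℤ) (α : ZMod 2)
    (a : ℤ → Module.End F W) : Prop :=
  a ∈ fieldSpace F W ∧ twist η a = η ^ r • a ∧ ∀ n, a n ∈ endParity 𝒲 α

/-- `(x₁-x₂)^k a(x₁) b(x₂) = s (x₁-x₂)^k b(x₂) a(x₁)` for some `k ∈ ℕ`. -/
def MutuallyLocal (T : ℕ) (s : F) (a b : ℤ → Module.End F W) : Prop :=
  ∃ k : ℕ, ∀ m n : ℤ,
    ∑ i ∈ Finset.range (k + 1), ((-1) ^ i * (k.choose i : F)) •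
        (a (m + T * ((k : ℤ) - i)) * b (n + T * i)) =
      s • ∑ i ∈ Finset.range (k + 1), ((-1) ^ i * (k.choose i : F)) •
        (b (n + T * i) * a (m + T * ((k : ℤ) - i)))

/-- A local subspace: it is spanned by homogeneous elements, and any two homogeneous elements of it
are mutually local. -/
structure IsLocalSubspace (T : ℕ) (η : F) (𝒲 : ZMod 2 → Submodule F W)
    (S : Submodule F (ℤ → Module.End F W)) : Prop where
  le_fieldSpace : S ≤ fieldSpace F W
  span_homogeneous : Submodule.span F {a | a ∈ S ∧ ∃ r α, IsHomogeneous η 𝒲 r α a} = S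
  mutuallyLocal : ∀ a ∈ S, ∀ b ∈ S, ∀ r r' α β, IsHomogeneous η 𝒲 r α a →
    IsHomogeneous η 𝒲 r' β b → MutuallyLocal T (superSign F α β) a b

/-- The product `a(x)_n b(x)`, where `a(η⁻¹ x^{1/T}) = η^r a(x^{1/T})` and `a`, `b` are mutually
local with sign `s = (-1)^{|a||b|}`, that is,
`Res_{x₁} Res_{x₀} x₀^n ((x₁-x₀)/x)^{r/T} ( x₀⁻¹ δ((x₁-x)/x₀) a(x₁) b(x)
  - s x₀⁻¹ δ((x-x₁)/(-x₀)) b(x) a(x₁) )`.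
Its mode `q/T` is the coefficient of `x^{-q/T-1}`; the summation index `j` is the exponent of `x₀`
in the expansion of `(x₁-x₀)^{r/T}`. The sum is finite by locality. -/
def nthProduct (T : ℕ) (s : F) (r n : ℤ) (a b : ℤ → Module.End F W) : ℤ → Module.End F W :=
  fun q => ∑ᶠ j : ℕ, ((-1) ^ j * binom F ((r : ℚ) / T) j) •
    bracket T s (n + j) (r - T * j) (q - r) a b

/-- A subspace that contains `1_W` and is closed under all products `a(x)_n b(x)` of homogeneous,
mutually local elements. -/
structure IsClosedSubspace (T : ℕ) (η : F) (𝒲 : ZMod 2 → Submodule F W)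
    (A : Submodule F (ℤ → Module.End F W)) : Prop where
  idField_mem : idField T ∈ A
  nthProduct_mem : ∀ a ∈ A, ∀ b ∈ A, ∀ r r' α β, IsHomogeneous η 𝒲 r α a →
    IsHomogeneous η 𝒲 r' β b → MutuallyLocal T (superSign F α β) a b →
    ∀ n, nthProduct T (superSign F α β) r n a b ∈ A

/-- `⟨S⟩`, the smallest closed subspace that contains `S`. -/
def generated (T : ℕ) (η : F) (𝒲 : ZMod 2 → Submodule F W)
    (S : Submodule F (ℤ → Module.End F W)) : Submodule F (ℤ → Module.End F W) :=
  sInf {A | S ≤ A ∧ IsClosedSubspace T η 𝒲 A}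

end Series

/-- A vertex superalgebra over `F` with underlying vector space `V`; `Y u n v` is `u_n v`, where
`Y(u, x) = ∑ u_n x^{-n-1}`. The Jacobi identity
`x₀⁻¹ δ((x₁-x₂)/x₀) Y(u,x₁) Y(v,x₂) - (-1)^{|u||v|} x₀⁻¹ δ((x₂-x₁)/(-x₀)) Y(v,x₂) Y(u,x₁)
  = x₂⁻¹ δ((x₁-x₀)/x₂) Y(Y(u,x₀)v,x₂)`
is stated through its coefficients at `x₀^{-l-1} x₁^{-m-1} x₂^{-n-1}`; that of the right-hand side
is `∑ᵢ (-1)^i C(i-m-1, i) (u_{l+i} v)_{m+n-i}`, and `(-1)^i C(i-m-1, i) = C(m, i)`. -/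
structure VertexSuperalgebra (F V : Type*) [Field F] [AddCommGroup V] [Module F V] where
  parity : ZMod 2 → Submodule F V
  parity_isInternal : DirectSum.IsInternal parity
  vacuum : V
  vacuum_mem : vacuum ∈ parity 0
  Y : V →ₗ[F] ℤ → Module.End F V
  parity_mode : ∀ α β, ∀ u ∈ parity α, ∀ v ∈ parity β, ∀ n, Y u n v ∈ parity (α + β)
  truncation : ∀ u v, ∃ N : ℤ, ∀ n, N ≤ n → Y u n v = 0
  vacuum_mode : ∀ n, Y vacuum n = if n = -1 then 1 else 0
  creation_regular : ∀ v n, 0 ≤ n → Y v n vacuum = 0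
  creation : ∀ v, Y v (-1) vacuum = v
  jacobi : ∀ α β, ∀ u ∈ parity α, ∀ v ∈ parity β, ∀ l m n : ℤ,
    bracket 1 (superSign F α β) l m n (Y u) (Y v) =
      ∑ᶠ i : ℕ, binom F (m : ℚ) i • Y (Y u (l + i) v) (m + n - i)

namespace VertexSuperalgebra

variable {F V : Type*} [Field F] [AddCommGroup V] [Module F V]

/-- Automorphisms of a vertex superalgebra. -/
structure IsAutomorphism (𝒱 : VertexSuperalgebra F V) (g : V ≃ₗ[F] V) : Prop where
  map_vacuum : g 𝒱.vacuum = 𝒱.vacuum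
  map_Y : ∀ u n v, g (𝒱.Y u n v) = 𝒱.Y (g u) n (g v)
  map_parity : ∀ α, ∀ u ∈ 𝒱.parity α, g u ∈ 𝒱.parity α

variable {W : Type*} [AddCommGroup W] [Module F W]

/-- `(W, Y_W)` is a `g`-twisted `V`-module, where `g` is an automorphism of `V` with `g^T = 1` and
`η` is a primitive `T`-th root of unity; `YW u n` is `u_{n/T}`, where
`Y_W(u, x) = ∑ u_{n/T} x^{-n/T-1}`. For `u` with `g u = η^r u`, the twisted Jacobi identity
`x₀⁻¹ δ((x₁-x₂)/x₀) Y_W(u,x₁) Y_W(v,x₂) - (-1)^{|u||v|} x₀⁻¹ δ((x₂-x₁)/(-x₀)) Y_W(v,x₂) Y_W(u,x₁)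
  = x₂⁻¹ δ((x₁-x₀)/x₂) ((x₁-x₀)/x₂)^{-r/T} Y_W(Y(u,x₀)v,x₂)`
is stated through its coefficients at `x₀^{-l-1} x₁^{-m/T-1} x₂^{-n/T-1}`, `m ∈ r + Tℤ` (both sides
have no other powers of `x₁`). -/
structure IsTwistedModule (𝒱 : VertexSuperalgebra F V) (g : V ≃ₗ[F] V) (T : ℕ) (η : F)
    (YW : V →ₗ[F] ℤ → Module.End F W) : Prop where
  support : ∀ r : ℕ, r < T → ∀ u, g u = η ^ r • u → ∀ n : ℤ, ¬ n ≡ r [ZMOD T] → YW u n = 0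
  truncation : ∀ u w, ∃ N : ℤ, ∀ n, N ≤ n → YW u n w = 0
  vacuum_mode : YW 𝒱.vacuum = idField T
  jacobi : ∀ r : ℕ, r < T → ∀ α β, ∀ u ∈ 𝒱.parity α, g u = η ^ r • u → ∀ v ∈ 𝒱.parity β,
    ∀ l m n : ℤ, m ≡ r [ZMOD T] →
      bracket T (superSign F α β) l m n (YW u) (YW v) =
        ∑ᶠ i : ℕ, binom F ((m : ℚ) / T) i • YW (𝒱.Y u (l + i) v) (m + n - T * i)

/-- A `g`-twisted module on a `ℤ/2`-graded space `W` is a twisted super module if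
`u_n W_β ⊆ W_{α+β}` for `u` of parity `α`. -/
structure IsTwistedSuperModule (𝒱 : VertexSuperalgebra F V) (g : V ≃ₗ[F] V) (T : ℕ) (η : F)
    (𝒲 : ZMod 2 → Submodule F W) (YW : V →ₗ[F] ℤ → Module.End F W) : Prop
    extends IsTwistedModule 𝒱 g T η YW where
  parity_mode : ∀ α, ∀ u ∈ 𝒱.parity α, ∀ n, YW u n ∈ endParity 𝒲 α

end VertexSuperalgebra

end

end TwistedVertex

open TwistedVertex

/-!
The bracket of two fields `a`, `b` is the array `D l m n` of coefficients of
`(x₁-x₂)^l a(x₁) b(x₂) - s (-x₂+x₁)^l b(x₂) a(x₁)`. Multiplication by `x₁ - x₂` raises `l`, and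
locality says that `D` vanishes for large `l`; these two properties are `IsJacobiArray`. They alone
imply that `D` is determined by the residues that define the products `a_n b`, and that it is given
by the right-hand side of the twisted Jacobi identity (`IsJacobiArray.eq_expansion`). So the twisted
Jacobi identity on `W` is immediate once `⟨S⟩` is known to be local; the identities between binomial
coefficients of `m/T` that are used hold in `ℚ`, and reduce to `F` because `T` is prime to `p`.

Locality of `⟨S⟩` follows from Dong's lemma (`MutuallyLocal.bracket_left`), by which the fields that
are local with a given set form a closed subspace. Hence `⟨S⟩` is contained in the commutant of `S`,
so `S` in the commutant of `⟨S⟩`, so `⟨S⟩` in its own commutant (`isLocalSubspace_generated`).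

For the Jacobi identity on `V = ⟨S⟩`, the vertex operators `Y(a, x₀)` are themselves shown to be
mutually local. Up to a truncation, `Y(a, x₀)` is the difference of an operator that multiplies by
`a` from the left and one that multiplies from the right. Left multiplications commute with right
multiplications, so the supercommutator of `Y(a)` and `Y(b)` only involves the supercommutator of
`a` and `b`, and the order of the pole of `a`, `b` also works for `Y(a)`, `Y(b)`
(`shift_pow_truncProduct`, `mutuallyLocal_vertexOp`).

The case `T = 1` of `IsJacobiArray.eq_expansion`, applied on `V`, then expresses the bracket of
`Y(a)` and `Y(b)` through its residues, and it remains to see that these are the fields `Y(a_l b)`.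
Both are local with all `Y(c)`, the residues by Dong's lemma on `V`, so by Goddard's uniqueness
theorem (`eq_zero_of_mutuallyLocal`) it suffices to compare them on the vacuum. There
`Y(a, x)1_W = ∑ x^N ∂^N a/N!` (`nthProduct_idField_right`), and the comparison amounts to
`∂^N(a_l b) = ∑ᵢ (-1)^i C(l,i) a_{l-i} ∂^{N-i} b` in divided powers of `∂`. This is the Leibniz rule
`hasseDeriv_nthProduct` combined with `nthProduct_hasseDeriv_left`.

The automorphism `g` acts on homogeneous elements by powers of `η`, and these multiply under the
products; in particular the fixed points of `g^m` form a closed subspace, which contains `⟨S⟩` as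
soon as it contains `S`.
-/

namespace TwistedVertex

noncomputable section

open Finset.HasAntidiagonal (antidiagonal)
open Filter

/-! ### Binomial coefficients of rational numbers in `F` -/

section Binomial

/-- The rational numbers whose denominator does not vanish in `F`. -/
def integralRat (F : Type*) [Field F] : Subring ℚ where
  carrier := {q | ((q.den : ℕ) : F) ≠ 0}
  mul_mem' {a b} ha hb := by
    obtain ⟨c, hc⟩ := Rat.mul_den_dvd a b
    intro h
    have : ((a.den * b.den : ℕ) : F) = 0 := by rw [hc]; push_cast; rw [h, zero_mul]
    push_cast at this
    exact (mul_ne_zero ha hb) this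
  one_mem' := by simp
  add_mem' {a b} ha hb := by
    obtain ⟨c, hc⟩ := Rat.add_den_dvd a b
    intro h
    have : ((a.den * b.den : ℕ) : F) = 0 := by rw [hc]; push_cast; rw [h, zero_mul]
    push_cast at this
    exact (mul_ne_zero ha hb) this
  zero_mem' := by simp
  neg_mem' {a} ha := by simpa using ha

/-- The reduction map on the rational numbers whose denominator does not vanish in `F`. -/
def reduceRat (F : Type*) [Field F] : integralRat F →+* F where
  toFun q := ((q : ℚ) : F)
  map_one' := by simp
  map_zero' := by simp
  map_mul' a b := Rat.cast_mul_of_ne_zero a.2 b.2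
  map_add' a b := Rat.cast_add_of_ne_zero a.2 b.2

variable {F : Type*} [Field F]

theorem intCast_div_mem_integralRat {T : ℕ} (hT : (T : F) ≠ 0) (m : ℤ) :
    (m : ℚ) / T ∈ integralRat F := by
  have hd : ((m : ℚ) / T).den ∣ T := by
    have := Rat.den_dvd m (T : ℤ)
    exact_mod_cast this
  obtain ⟨c, hc⟩ := hd
  intro h
  apply hT
  rw [hc]; push_cast; rw [h, zero_mul]

/-- The binomial coefficients of a `p`-integral rational number are `p`-integral, because they are
the binomial coefficients of the same number in the binomial ring `ℤ_[p]`. -/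
theorem choose_mem_integralRat (p : ℕ) [Fact p.Prime] [CharP F p] {q : ℚ}
    (hq : q ∈ integralRat F) (i : ℕ) : Ring.choose q i ∈ integralRat F := by
  have key : ∀ x : ℚ, x ∈ integralRat F ↔ ‖(x : ℚ_[p])‖ ≤ 1 := by
    intro x
    rw [Padic.norm_rat_le_one_iff_padicValuation_le_one, Rat.padicValuation_le_one_iff,
      ← CharP.cast_eq_zero_iff F p]
    exact Iff.rfl
  rw [key] at hq ⊢
  have h1 : ((Ring.choose (⟨(q : ℚ_[p]), hq⟩ : ℤ_[p]) i : ℤ_[p]) : ℚ_[p])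
      = Ring.choose (q : ℚ_[p]) i := Ring.map_choose PadicInt.Coe.ringHom _ i
  have h2 : ((Ring.choose q i : ℚ) : ℚ_[p]) = Ring.choose (q : ℚ_[p]) i :=
    Ring.map_choose (Rat.castHom ℚ_[p]) q i
  rw [h2, ← h1]
  exact PadicInt.norm_le_one _

/-- All binomial coefficients of the numbers `m / T` can be reduced to `F`. This is what makes the
identities between rational binomial coefficients available in `F`. -/
structure HasBinomials (F : Type*) [Field F] (T : ℕ) : Prop where
  ne_zero : T ≠ 0
  choose_mem : ∀ (m : ℤ) (i : ℕ), Ring.choose ((m : ℚ) / T) i ∈ integralRat F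

/-- This is where the hypothesis that `T` is prime to the characteristic enters. -/
theorem hasBinomials_of_coprime (p : ℕ) [Fact p.Prime] [CharP F p] {T : ℕ} (hT : T.Coprime p) :
    HasBinomials F T where
  ne_zero := by
    rintro rfl
    exact (Fact.out : p.Prime).one_lt.ne' (by simpa using hT)
  choose_mem m i := by
    refine choose_mem_integralRat p (intCast_div_mem_integralRat ?_ m) i
    rw [Ne, CharP.cast_eq_zero_iff F p]
    exact fun h => (Fact.out : p.Prime).one_lt.ne' (Nat.eq_one_of_dvd_coprimes hT h dvd_rfl)

/-- The binomial coefficient of `m / T` in `F`. -/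
def fbinom (F : Type*) [Field F] (T : ℕ) (m : ℤ) (i : ℕ) : F := binom F ((m : ℚ) / T) i

@[simp] theorem fbinom_zero_right (T : ℕ) (m : ℤ) : fbinom F T m 0 = 1 := by
  simp [fbinom, binom]

theorem fbinom_zero_left (T : ℕ) (i : ℕ) : fbinom F T 0 i = if i = 0 then 1 else 0 := by
  simp only [fbinom, binom, Int.cast_zero, zero_div, Ring.choose_zero_ite]
  split <;> simp

theorem binom_intCast (m : ℤ) (i : ℕ) : binom F (m : ℚ) i = fbinom F 1 m i := by
  simp [fbinom]

theorem fbinom_natCast (n i : ℕ) : fbinom F 1 (n : ℤ) i = (n.choose i : F) := by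
  simp [fbinom, binom, Ring.choose_natCast]

namespace HasBinomials

variable {T : ℕ}

theorem one (hB : HasBinomials F T) : HasBinomials F 1 where
  ne_zero := one_ne_zero
  choose_mem m i := by
    have := hB.choose_mem (T * m) i
    have hT : (T : ℚ) ≠ 0 := by exact_mod_cast hB.ne_zero
    simpa [mul_div_cancel_left₀ _ hT] using this

theorem reduceRat_choose (hB : HasBinomials F T) (m : ℤ) (i : ℕ) :
    reduceRat F ⟨Ring.choose ((m : ℚ) / T) i, hB.choose_mem m i⟩ = fbinom F T m i := rfl

/-- Vandermonde's identity. -/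
theorem fbinom_add (hB : HasBinomials F T) (m n : ℤ) (N : ℕ) :
    fbinom F T (m + n) N =
      ∑ ij ∈ antidiagonal N, fbinom F T m ij.1 * fbinom F T n ij.2 := by
  simp only [← hB.reduceRat_choose, ← map_mul, ← map_sum]
  congr 1
  apply Subtype.ext
  push_cast
  rw [add_div, Ring.add_choose_eq _ (Commute.all _ _)]

/-- Pascal's rule. -/
theorem fbinom_succ (hB : HasBinomials F T) (m : ℤ) (i : ℕ) :
    fbinom F T (m + T) (i + 1) = fbinom F T m (i + 1) + fbinom F T m i := by
  simp only [← hB.reduceRat_choose, ← map_add]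
  congr 1
  apply Subtype.ext
  have hT : (T : ℚ) ≠ 0 := by exact_mod_cast hB.ne_zero
  push_cast
  rw [add_div, div_self hT, Ring.choose_succ_succ, add_comm]

/-- Trinomial revision. -/
theorem fbinom_mul_fbinom (hB : HasBinomials F T) (m : ℤ) (i j : ℕ) :
    fbinom F T m i * fbinom F T (m - T * i) j = ((i + j).choose i : F) * fbinom F T m (i + j) := by
  have : (((i + j).choose i : ℕ) : F) = reduceRat F ((i + j).choose i : ℕ) := by simp
  rw [this]
  simp only [← hB.reduceRat_choose, ← map_mul]
  congr 1
  apply Subtype.ext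
  have hT : (T : ℚ) ≠ 0 := by exact_mod_cast hB.ne_zero
  have h := Ring.choose_smul_choose ((m : ℚ) / T) (Nat.le_add_right i j)
  rw [nsmul_eq_mul, Nat.add_sub_cancel_left] at h
  push_cast
  rw [h, sub_div, mul_div_cancel_left₀ _ hT]

end HasBinomials

end Binomial

/-! ### Translations of modes, locality and the bracket -/

section Shift

variable {F A M : Type*} [Field F] [AddCommGroup A] [AddCommGroup M] [Module F M]

/-- Translation of the argument of a function by `v`. In terms of modes, translating an index by `T`
is multiplication by the corresponding formal variable. -/
def shift (v : A) : Module.End F (A → M) := LinearMap.funLeft F M (· + v)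

@[simp] theorem shift_apply (v : A) (f : A → M) (x : A) : shift (F := F) v f x = f (x + v) := rfl

theorem shift_commute (v w : A) : Commute (shift v : Module.End F (A → M)) (shift w) := by
  refine LinearMap.ext fun f => funext fun x => ?_
  simp [Module.End.mul_apply, add_right_comm]

theorem shift_sub_commute (v w v' w' : A) :
    Commute (shift v - shift w : Module.End F (A → M)) (shift v' - shift w') :=
  ((shift_commute v v').sub_left (shift_commute w v')).sub_right
    ((shift_commute v w').sub_left (shift_commute w w'))

theorem shift_pow (v : A) (k : ℕ) : (shift v : Module.End F (A → M)) ^ k = shift (k • v) := by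
  induction k with
  | zero => ext f x; simp
  | succ k ih =>
    rw [pow_succ, ih]
    refine LinearMap.ext fun f => funext fun x => ?_
    simp [Module.End.mul_apply, succ_nsmul, add_assoc]

theorem shift_sub_pow_apply (v w : A) (k : ℕ) (f : A → M) (x : A) :
    ((shift v - shift w : Module.End F (A → M)) ^ k) f x =
      ∑ i ∈ Finset.range (k + 1), ((-1) ^ i * (k.choose i : F)) • f (x + (k - i) • v + i • w) := by
  have h : Commute (-shift w : Module.End F (A → M)) (shift v) :=
    (shift_commute (F := F) (M := M) w v).neg_left
  rw [sub_eq_neg_add, h.add_pow]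
  simp only [LinearMap.sum_apply, Finset.sum_apply]
  refine Finset.sum_congr rfl fun i _ => ?_
  have h1 : (-shift w : Module.End F (A → M)) ^ i = ((-1 : F) ^ i) • shift (i • w) := by
    rw [← neg_one_smul F, smul_pow, shift_pow]
  have h2 : ((k.choose i : ℕ) : Module.End F (A → M)) = ((k.choose i : ℕ) : F) • 1 := by
    rw [Nat.cast_smul_eq_nsmul, nsmul_one]
  rw [h1, h2, shift_pow]
  simp only [Module.End.mul_apply, LinearMap.smul_apply, Module.End.one_apply, Pi.smul_apply,
    shift_apply, smul_smul, mul_comm, map_smul]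
  rw [add_right_comm]

/-- Commuting operators that agree on `f` have powers that agree on `f`. -/
theorem pow_apply_eq_of_commute {P Q : Module.End F M} (h : Commute P Q) {f : M} (hf : P f = Q f)
    (k : ℕ) : (P ^ k) f = (Q ^ k) f := by
  induction k with
  | zero => rfl
  | succ k ih =>
    rw [pow_succ, Module.End.mul_apply, hf, ← Module.End.mul_apply, (h.pow_left k).eq,
      Module.End.mul_apply, ih, ← Module.End.mul_apply, ← pow_succ']

theorem pow_apply_eq_zero_of_le {P : Module.End F M} {f : M} {k l : ℕ} (hf : (P ^ k) f = 0)
    (hkl : k ≤ l) : (P ^ l) f = 0 := by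
  obtain ⟨d, rfl⟩ := Nat.exists_eq_add_of_le' hkl
  rw [pow_add, Module.End.mul_apply, hf, map_zero]

end Shift

section Modes

variable {F W : Type*} [Field F] [AddCommGroup W] [Module F W]

theorem locSum_apply {f : ℕ → Module.End F W}
    (h : ∀ w, (Function.support fun i => f i w).Finite) (w : W) {I : ℕ}
    (hI : ∀ i, I ≤ i → f i w = 0) : locSum f w = ∑ i ∈ Finset.range I, f i w := by
  rw [locSum, dif_pos h]
  change ∑ᶠ i, f i w = _
  refine finsum_eq_sum_of_support_subset _ fun i hi => ?_
  by_contra hc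
  exact hi (hI i (by simpa using hc))

theorem mem_fieldSpace_iff {a : ℤ → Module.End F W} :
    a ∈ fieldSpace F W ↔ ∀ w, ∀ᶠ n in atTop, a n w = 0 := by
  refine forall_congr' fun w => ?_
  rw [eventually_atTop]

/-- The first half of the bracket: the coefficient of `x₁^{-m/T-1} x₂^{-n/T-1}` in
`(x₁-x₂)^l a(x₁) b(x₂)`, expanded in nonnegative powers of `x₂`. -/
def modeProd (T : ℕ) (l m n : ℤ) (a b : ℤ → Module.End F W) : Module.End F W :=
  locSum fun i : ℕ => ((-1) ^ i * fbinom F 1 l i) • (a (m + T * (l - i)) * b (n + T * i))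

theorem bracket_eq (T : ℕ) (s : F) (l m n : ℤ) (a b : ℤ → Module.End F W) :
    bracket T s l m n a b =
      modeProd T l m n a b - (s * (-1) ^ l) • modeProd T l n m b a := by
  simp only [bracket, modeProd, binom_intCast]

variable {T : ℕ}

theorem mutuallyLocal_iff_shift {s : F} {a b : ℤ → Module.End F W} :
    MutuallyLocal T s a b ↔ ∃ k : ℕ,
      ((shift ((T : ℤ), (0 : ℤ)) - shift (0, (T : ℤ)) : Module.End F (ℤ × ℤ → Module.End F W)) ^ k)
        (fun x => a x.1 * b x.2 - s • (b x.2 * a x.1)) = 0 := by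
  refine exists_congr fun k => ?_
  rw [funext_iff, Prod.forall]
  refine forall₂_congr fun m n => ?_
  rw [shift_sub_pow_apply, Pi.zero_apply, ← sub_eq_zero (b := s • _), Finset.smul_sum,
    ← Finset.sum_sub_distrib]
  refine Eq.congr (Finset.sum_congr rfl fun i hi => ?_) rfl
  have : ((k - i : ℕ) : ℤ) = k - i := by
    rw [Nat.cast_sub (by simp at hi; omega)]
  simp [smul_sub, this, mul_comm, smul_comm s]

theorem mutuallyLocal_zero_left (s : F) (b : ℤ → Module.End F W) : MutuallyLocal T s 0 b :=
  ⟨0, fun m n => by simp⟩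

theorem MutuallyLocal.add_left {s : F} {a a' b : ℤ → Module.End F W} (h : MutuallyLocal T s a b)
    (h' : MutuallyLocal T s a' b) : MutuallyLocal T s (a + a') b := by
  obtain ⟨k, hk⟩ := mutuallyLocal_iff_shift.mp h
  obtain ⟨k', hk'⟩ := mutuallyLocal_iff_shift.mp h'
  refine mutuallyLocal_iff_shift.mpr ⟨max k k', ?_⟩
  have := congrArg₂ (· + ·) (pow_apply_eq_zero_of_le hk (le_max_left k k'))
    (pow_apply_eq_zero_of_le hk' (le_max_right k k'))
  simp only [← map_add, add_zero] at this
  rw [← this]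
  congr 1
  funext x
  simp only [Pi.add_apply, add_mul, mul_add]
  module

theorem MutuallyLocal.smul_left {s : F} {a b : ℤ → Module.End F W} (h : MutuallyLocal T s a b)
    (c : F) : MutuallyLocal T s (c • a) b := by
  obtain ⟨k, hk⟩ := mutuallyLocal_iff_shift.mp h
  refine mutuallyLocal_iff_shift.mpr ⟨k, ?_⟩
  have := congrArg (c • ·) hk
  simp only [← map_smul, smul_zero] at this
  rw [← this]
  congr 1
  funext x
  simp only [Pi.smul_apply, smul_mul_assoc, mul_smul_comm, smul_sub, smul_comm s]

theorem MutuallyLocal.sum_left {ι : Type*} {s : F} {t : Finset ι} {a : ι → ℤ → Module.End F W}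
    {b : ℤ → Module.End F W} (h : ∀ i ∈ t, MutuallyLocal T s (a i) b) :
    MutuallyLocal T s (∑ i ∈ t, a i) b :=
  Finset.sum_induction _ (fun a => MutuallyLocal T s a b) (fun _ _ => .add_left)
    (mutuallyLocal_zero_left s b) h

/-- Locality is not affected by a translation of the modes. -/
theorem MutuallyLocal.translate_left {s : F} {a b : ℤ → Module.End F W}
    (h : MutuallyLocal T s a b) (d : ℤ) : MutuallyLocal T s (fun n => a (n + d)) b := by
  obtain ⟨k, hk⟩ := h
  refine ⟨k, fun m n => ?_⟩
  have := hk (m + d) n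
  simpa only [add_right_comm] using this

variable [NeZero T]

theorem exists_forall_mode_eq_zero {b : ℤ → Module.End F W} (hb : b ∈ fieldSpace F W) (n : ℤ)
    (w : W) : ∃ I : ℕ, ∀ i, I ≤ i → b (n + T * i) w = 0 := by
  obtain ⟨N, hN⟩ := hb w
  refine ⟨(N - n).toNat, fun i hi => hN _ ?_⟩
  have h1 : N - n ≤ i := by omega
  have h2 : (1 : ℤ) ≤ T := by exact_mod_cast NeZero.one_le
  nlinarith [Int.natCast_nonneg i]

theorem modeProd_apply (l m : ℤ) {n : ℤ} (a : ℤ → Module.End F W) {b : ℤ → Module.End F W}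
    (hb : b ∈ fieldSpace F W) {w : W} {I : ℕ} (hI : ∀ i, I ≤ i → b (n + T * i) w = 0) :
    modeProd T l m n a b w = ∑ i ∈ Finset.range I,
      ((-1) ^ i * fbinom F 1 l i) • a (m + T * (l - i)) (b (n + T * i) w) := by
  refine locSum_apply (fun w => ?_) w fun i hi => ?_
  · obtain ⟨J, hJ⟩ := exists_forall_mode_eq_zero (T := T) hb n w
    refine (Finset.range J).finite_toSet.subset fun i hi => ?_
    by_contra hc
    exact hi (by simp [hJ i (by simpa using hc)])
  · simp [hI i hi]

variable (T) in
/-- `modeProd` as a bilinear map. -/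
def modeProdHom (l m n : ℤ) : fieldSpace F W →ₗ[F] fieldSpace F W →ₗ[F] Module.End F W :=
  LinearMap.mk₂ F (fun a b => modeProd T l m n a.1 b.1)
    (fun a a' b => by
      ext w
      obtain ⟨I, hI⟩ := exists_forall_mode_eq_zero (T := T) b.2 n w
      simp [modeProd_apply l m _ b.2 hI, Finset.sum_add_distrib])
    (fun c a b => by
      ext w
      obtain ⟨I, hI⟩ := exists_forall_mode_eq_zero (T := T) b.2 n w
      simp [modeProd_apply l m _ b.2 hI, Finset.smul_sum, smul_comm c])
    (fun a b b' => by
      ext w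
      obtain ⟨I, hI⟩ := exists_forall_mode_eq_zero (T := T) b.2 n w
      obtain ⟨J, hJ⟩ := exists_forall_mode_eq_zero (T := T) b'.2 n w
      have hI' : ∀ i, max I J ≤ i → b.1 (n + T * i) w = 0 := fun i hi => hI i (by omega)
      have hJ' : ∀ i, max I J ≤ i → b'.1 (n + T * i) w = 0 := fun i hi => hJ i (by omega)
      have hS : ∀ i, max I J ≤ i → (b + b').1 (n + T * i) w = 0 := fun i hi => by
        simp [hI' i hi, hJ' i hi]
      rw [LinearMap.add_apply, modeProd_apply l m _ b.2 hI', modeProd_apply l m _ b'.2 hJ',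
        modeProd_apply l m _ (b + b').2 hS]
      simp [Finset.sum_add_distrib])
    (fun c a b => by
      ext w
      obtain ⟨I, hI⟩ := exists_forall_mode_eq_zero (T := T) b.2 n w
      have hI' : ∀ i, I ≤ i → (c • b).1 (n + T * i) w = 0 := fun i hi => by simp [hI i hi]
      rw [LinearMap.smul_apply, modeProd_apply l m _ b.2 hI, modeProd_apply l m _ (c • b).2 hI']
      simp [Finset.smul_sum, smul_comm c])

theorem modeProdHom_apply (l m n : ℤ) (a b : fieldSpace F W) :
    modeProdHom T l m n a b = modeProd T l m n a.1 b.1 := rfl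

variable (T) in
/-- `bracket` as a bilinear map. -/
def bracketHom (s : F) (l m n : ℤ) :
    fieldSpace F W →ₗ[F] fieldSpace F W →ₗ[F] Module.End F W :=
  modeProdHom T l m n - (s * (-1) ^ l) • (modeProdHom T l n m).flip

theorem bracketHom_apply (s : F) (l m n : ℤ) (a b : fieldSpace F W) :
    bracketHom T s l m n a b = bracket T s l m n a.1 b.1 := by
  rw [bracket_eq]; rfl

theorem modeProd_zero (m n : ℤ) (a : ℤ → Module.End F W) {b : ℤ → Module.End F W}
    (hb : b ∈ fieldSpace F W) : modeProd T 0 m n a b = a m * b n := by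
  ext w
  obtain ⟨I, hI⟩ := exists_forall_mode_eq_zero (T := T) hb n w
  rw [modeProd_apply 0 m a hb (I := I + 1) fun i hi => hI i (by omega), Finset.sum_range_succ']
  simp [fbinom_zero_left]

/-- Pascal's rule: multiplication by `x₁ - x₂`. -/
theorem modeProd_succ (hB : HasBinomials F T) (l m n : ℤ) (a : ℤ → Module.End F W)
    {b : ℤ → Module.End F W} (hb : b ∈ fieldSpace F W) :
    modeProd T (l + 1) m n a b = modeProd T l (m + T) n a b - modeProd T l m (n + T) a b := by
  ext w
  obtain ⟨I, hI⟩ := exists_forall_mode_eq_zero (T := T) hb n w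
  have hI1 : ∀ i, I + 1 ≤ i → b (n + T * i) w = 0 := fun i hi => hI i (by omega)
  have hI2 : ∀ i, I ≤ i → b (n + T + T * i) w = 0 := fun i hi => by
    have := hI (i + 1) (by omega)
    push_cast at this
    rwa [mul_add, mul_one, add_comm (_ * _), ← add_assoc] at this
  rw [LinearMap.sub_apply, modeProd_apply _ _ _ hb hI1, modeProd_apply _ _ _ hb hI1,
    modeProd_apply _ _ _ hb hI2, Finset.sum_range_succ', Finset.sum_range_succ',
    add_sub_right_comm (Finset.sum _ _), ← Finset.sum_sub_distrib]
  congr 1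
  · refine Finset.sum_congr rfl fun i _ => ?_
    have e1 : m + T * (l + 1 - ((i + 1 : ℕ) : ℤ)) = m + T * (l - i) := by push_cast; ring
    have e2 : m + T + T * (l - ((i + 1 : ℕ) : ℤ)) = m + T * (l - i) := by push_cast; ring
    have e3 : n + T + T * (i : ℤ) = n + T * ((i + 1 : ℕ) : ℤ) := by push_cast; ring
    have := hB.one.fbinom_succ l i
    rw [Nat.cast_one] at this
    rw [e1, e2, e3, this, ← sub_smul]
    congr 1
    ring
  · simp only [fbinom_zero_right, Nat.cast_zero, sub_zero]
    congr 3
    ring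

theorem bracket_succ (hB : HasBinomials F T) (s : F) (l m n : ℤ) {a b : ℤ → Module.End F W}
    (ha : a ∈ fieldSpace F W) (hb : b ∈ fieldSpace F W) :
    bracket T s (l + 1) m n a b = bracket T s l (m + T) n a b - bracket T s l m (n + T) a b := by
  simp only [bracket_eq, modeProd_succ hB l _ _ _ ha, modeProd_succ hB l _ _ _ hb]
  rw [zpow_add_one₀ (neg_ne_zero.mpr one_ne_zero)]
  module

theorem bracket_zero (s : F) (m n : ℤ) {a b : ℤ → Module.End F W}
    (ha : a ∈ fieldSpace F W) (hb : b ∈ fieldSpace F W) :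
    bracket T s 0 m n a b = a m * b n - s • (b n * a m) := by
  simp [bracket_eq, modeProd_zero _ _ _ ha, modeProd_zero _ _ _ hb]

/-- Multiplying a bracket by `(x₁-x₂)^k` raises the exponent of `x₁-x₂` by `k`. -/
theorem shift_sub_pow_bracket (hB : HasBinomials F T) (s : F) (l : ℤ) {a b : ℤ → Module.End F W}
    (ha : a ∈ fieldSpace F W) (hb : b ∈ fieldSpace F W) (k : ℕ) :
    ((shift ((T : ℤ), (0 : ℤ)) - shift (0, (T : ℤ)) : Module.End F (ℤ × ℤ → Module.End F W)) ^ k)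
        (fun x => bracket T s l x.1 x.2 a b) = fun x => bracket T s (l + k) x.1 x.2 a b := by
  induction k with
  | zero => simp
  | succ k ih =>
    rw [pow_succ', Module.End.mul_apply, ih]
    funext x
    simp only [LinearMap.sub_apply, Pi.sub_apply, shift_apply, Prod.fst_add, Prod.snd_add, add_zero]
    rw [← bracket_succ hB _ _ _ _ ha hb]
    push_cast
    rw [add_assoc]

/-- Locality in terms of the bracket. -/
theorem mutuallyLocal_iff_bracket (hB : HasBinomials F T) {s : F} {a b : ℤ → Module.End F W}
    (ha : a ∈ fieldSpace F W) (hb : b ∈ fieldSpace F W) :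
    MutuallyLocal T s a b ↔ ∃ k : ℕ, ∀ m n, bracket T s k m n a b = 0 := by
  rw [mutuallyLocal_iff_shift]
  refine exists_congr fun k => ?_
  have := shift_sub_pow_bracket hB s 0 ha hb k
  simp only [bracket_zero s _ _ ha hb] at this
  rw [this]
  simp [funext_iff]

theorem MutuallyLocal.exists_bracket_eq_zero (hB : HasBinomials F T) {s : F}
    {a b : ℤ → Module.End F W} (ha : a ∈ fieldSpace F W) (hb : b ∈ fieldSpace F W)
    (h : MutuallyLocal T s a b) :
    ∃ k : ℕ, ∀ l : ℤ, k ≤ l → ∀ m n, bracket T s l m n a b = 0 := by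
  obtain ⟨k, hk⟩ := (mutuallyLocal_iff_bracket hB ha hb).mp h
  refine ⟨k, fun l hl => ?_⟩
  induction l, hl using Int.leInduction with
  | base => exact hk
  | succ l _ ih => intro m n; rw [bracket_succ hB _ _ _ _ ha hb, ih, ih, sub_zero]

theorem MutuallyLocal.symm (hB : HasBinomials F T) {s : F} (hs : s * s = 1)
    {a b : ℤ → Module.End F W} (ha : a ∈ fieldSpace F W) (hb : b ∈ fieldSpace F W)
    (h : MutuallyLocal T s a b) : MutuallyLocal T s b a := by
  rw [mutuallyLocal_iff_bracket hB ha hb] at h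
  rw [mutuallyLocal_iff_bracket hB hb ha]
  obtain ⟨k, hk⟩ := h
  refine ⟨k, fun m n => ?_⟩
  have h1 := congrArg (fun f => (-(s * (-1) ^ (k : ℤ)) : F) • f) (hk n m)
  have h2 : ((-1 : F) ^ (k : ℤ)) * (-1) ^ (k : ℤ) = 1 := by
    rw [← mul_zpow]; simp
  simp only [bracket_eq, smul_sub, smul_smul, smul_zero] at h1 ⊢
  rw [← h1, show -(s * (-1 : F) ^ (k : ℤ)) * (s * (-1) ^ (k : ℤ)) = -1 by
    linear_combination (-((-1 : F) ^ (k : ℤ)) * (-1) ^ (k : ℤ)) * hs - h2]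
  module

theorem modeProd_apply_eq_zero (l m : ℤ) (a : ℤ → Module.End F W) {b : ℤ → Module.End F W}
    (hb : b ∈ fieldSpace F W) {w : W} {N n : ℤ} (hN : ∀ n, N ≤ n → b n w = 0) (hn : N ≤ n) :
    modeProd T l m n a b w = 0 := by
  have h : ∀ i : ℕ, 0 ≤ i → b (n + T * i) w = 0 := fun i _ => hN _ (hn.trans (by simp; positivity))
  rw [modeProd_apply l m a hb h, Finset.sum_range_zero]

theorem modeProd_mem_fieldSpace_right (l m : ℤ) (a : ℤ → Module.End F W)
    {b : ℤ → Module.End F W} (hb : b ∈ fieldSpace F W) :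
    (fun n => modeProd T l m n a b) ∈ fieldSpace F W := by
  intro w
  obtain ⟨N, hN⟩ := hb w
  exact ⟨N, fun n hn => modeProd_apply_eq_zero l m a hb hN hn⟩

theorem modeProd_mem_fieldSpace_left (l n : ℤ) {a b : ℤ → Module.End F W}
    (ha : a ∈ fieldSpace F W) (hb : b ∈ fieldSpace F W) :
    (fun m => modeProd T l m n a b) ∈ fieldSpace F W := by
  rw [mem_fieldSpace_iff] at ha ⊢
  intro w
  obtain ⟨I, hI⟩ := exists_forall_mode_eq_zero (T := T) hb n w
  have h : ∀ᶠ m in atTop, ∀ i ∈ Finset.range I, a (m + T * (l - i)) (b (n + T * i) w) = 0 := by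
    rw [Filter.eventually_all_finset]
    exact fun i _ => (tendsto_atTop_add_const_right _ _ tendsto_id).eventually (ha _)
  filter_upwards [h] with m hm
  rw [modeProd_apply l m a hb hI]
  exact Finset.sum_eq_zero fun i hi => by rw [hm i hi, smul_zero]

theorem bracket_mem_fieldSpace (s : F) (l m : ℤ) {a b : ℤ → Module.End F W}
    (ha : a ∈ fieldSpace F W) (hb : b ∈ fieldSpace F W) :
    (fun n => bracket T s l m n a b) ∈ fieldSpace F W := by
  simp only [bracket_eq]
  exact sub_mem (modeProd_mem_fieldSpace_right l m a hb)
    (Submodule.smul_mem _ _ (modeProd_mem_fieldSpace_left l m hb ha))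

end Modes

/-! ### The twisted Jacobi identity for residues -/

section Residue

variable {F M : Type*} [Field F] [AddCommGroup M] [Module F M] {T : ℕ}

/-- The formal properties of the coefficients `D l m n` of a bracket, at
`x₀^{-l-1} x₁^{-m/T-1} x₂^{-n/T-1}`: multiplication by `x₁ - x₂` is multiplication by `x₀`, and the
pole in `x₀` has order at most `k`. -/
structure IsJacobiArray (T : ℕ) (k : ℤ) (D : ℤ → ℤ → ℤ → M) : Prop where
  succ : ∀ l m n, D (l + 1) m n = D l (m + T) n - D l m (n + T)
  eq_zero : ∀ l, k ≤ l → ∀ m n, D l m n = 0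

namespace IsJacobiArray

variable {k : ℤ} {D D' : ℤ → ℤ → ℤ → M}

theorem mono (h : IsJacobiArray T k D) {k' : ℤ} (hk : k ≤ k') : IsJacobiArray T k' D :=
  ⟨h.succ, fun l hl => h.eq_zero l (hk.trans hl)⟩

theorem sub (h : IsJacobiArray T k D) (h' : IsJacobiArray T k D') :
    IsJacobiArray T k (D - D') where
  succ l m n := by simp only [Pi.sub_apply, h.succ, h'.succ]; abel
  eq_zero l hl m n := by simp [h.eq_zero l hl, h'.eq_zero l hl]

theorem sum {ι : Type*} {t : Finset ι} {D : ι → ℤ → ℤ → ℤ → M}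
    (h : ∀ i ∈ t, IsJacobiArray T k (D i)) :
    IsJacobiArray T k (fun l m n => ∑ i ∈ t, D i l m n) where
  succ l m n := by
    rw [← Finset.sum_sub_distrib]
    exact Finset.sum_congr rfl fun i hi => (h i hi).succ l m n
  eq_zero l hl m n := Finset.sum_eq_zero fun i hi => (h i hi).eq_zero l hl m n

/-- A Jacobi array vanishes if it vanishes at one point of each line `m + n = q`: modulo the part
with a higher power of `x₀`, it only depends on `m + n`. -/
theorem eq_zero_of_diagonal (h : IsJacobiArray T k D) (r : ℤ)
    (hd : ∀ l, (∀ l', l < l' → ∀ m n, m ≡ r [ZMOD T] → D l' m n = 0) →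
      ∀ q, ∃ m, m ≡ r [ZMOD T] ∧ D l m (q - m) = 0) (l m n : ℤ) (hm : m ≡ r [ZMOD T]) :
    D l m n = 0 := by
  have key : ∀ d : ℕ, ∀ l, k ≤ l + d → ∀ m n, m ≡ r [ZMOD T] → D l m n = 0 := by
    intro d
    induction d with
    | zero => intro l hl m n _; exact h.eq_zero l (by simpa using hl) m n
    | succ d ih =>
      intro l hl m n hm
      have hup : ∀ l', l < l' → ∀ m n, m ≡ r [ZMOD T] → D l' m n = 0 := fun l' hl' =>
        ih l' (by push_cast at hl; omega)
      have hstep : ∀ m n, m ≡ r [ZMOD T] → ∀ j : ℕ, D l (m + T * j) n = D l m (n + T * j) := by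
        intro m n hm j
        induction j generalizing n with
        | zero => simp
        | succ j ihj =>
          have h1 := h.succ l (m + T * j) n
          rw [hup (l + 1) (by omega) _ _
            ((Int.modEq_iff_dvd.mpr ⟨-j, by ring⟩ : m + T * j ≡ m [ZMOD T]).trans hm)] at h1
          have e1 : m + T * ((j + 1 : ℕ) : ℤ) = m + T * j + T := by push_cast; ring
          have e2 : n + T * ((j + 1 : ℕ) : ℤ) = n + T + T * j := by push_cast; ring
          rw [e1, e2, ← ihj, eq_comm, ← sub_eq_zero, ← neg_eq_zero, neg_sub, ← h1]
      obtain ⟨m₀, hm₀, hz⟩ := hd l hup (m + n)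
      obtain ⟨j, hj⟩ := (hm₀.trans hm.symm).dvd
      rcases Int.eq_nat_or_neg j with ⟨i, rfl | rfl⟩
      · have := hstep m₀ n hm₀ i
        rw [← hj, add_sub_cancel, show n + (m - m₀) = m + n - m₀ by ring, hz] at this
        exact this
      · have := hstep m (m + n - m₀) hm i
        rw [show m + T * (i : ℤ) = m₀ by linarith, hz, show m + n - m₀ + T * (i : ℤ) = n by
          linarith] at this
        exact this.symm
  exact key (k - l).toNat l (by omega) m n hm

end IsJacobiArray

variable (F T) in
/-- `Res_{x₁} ((x₁-x₀)/x₂)^{r/T} D`, as a family of series indexed by the power of `x₀`. -/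
def residue (r : ℤ) (D : ℤ → ℤ → ℤ → M) (n q : ℤ) : M :=
  ∑ᶠ j : ℕ, ((-1) ^ j * fbinom F T r j) • D (n + j) (r - T * j) (q - r)

variable (F T) in
/-- The coefficients of `x₂⁻¹ δ((x₁-x₀)/x₂) ((x₁-x₀)/x₂)^{-r/T} ∑ₗ c_l(x₂) x₀^{-l-1}`. -/
def expansion (c : ℤ → ℤ → M) (l m n : ℤ) : M :=
  ∑ᶠ i : ℕ, fbinom F T m i • c (l + i) (m + n - T * i)

theorem finsum_eq_sum_range {f : ℕ → M} {J : ℕ} (hJ : ∀ i, J ≤ i → f i = 0) :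
    ∑ᶠ i, f i = ∑ i ∈ Finset.range J, f i := by
  refine finsum_eq_sum_of_support_subset _ fun i hi => ?_
  by_contra hc
  exact hi (hJ i (by simpa using hc))

theorem residue_eq_sum {k : ℤ} {D : ℤ → ℤ → ℤ → M} (hD : ∀ l, k ≤ l → ∀ m n, D l m n = 0)
    (r n q : ℤ) {J : ℕ} (hJ : k ≤ n + J) :
    residue F T r D n q =
      ∑ j ∈ Finset.range J, ((-1) ^ j * fbinom F T r j) • D (n + j) (r - T * j) (q - r) :=
  finsum_eq_sum_range fun j hj => by rw [hD _ (by omega), smul_zero]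

theorem expansion_eq_sum {k : ℤ} {c : ℤ → ℤ → M} (hc : ∀ l, k ≤ l → c l = 0) (l m n : ℤ) {J : ℕ}
    (hJ : k ≤ l + J) :
    expansion F T c l m n = ∑ i ∈ Finset.range J, fbinom F T m i • c (l + i) (m + n - T * i) :=
  finsum_eq_sum_range fun j hj => by rw [hc _ (by omega), Pi.zero_apply, smul_zero]

theorem residue_eq_zero {k : ℤ} {D : ℤ → ℤ → ℤ → M} (hD : ∀ l, k ≤ l → ∀ m n, D l m n = 0)
    (r : ℤ) (l : ℤ) (hl : k ≤ l) : residue F T r D l = 0 := by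
  funext q
  rw [residue_eq_sum hD r l q (J := 0) (by simpa using hl)]
  simp

theorem isJacobiArray_expansion (hB : HasBinomials F T) {k : ℤ} {c : ℤ → ℤ → M}
    (hc : ∀ l, k ≤ l → c l = 0) : IsJacobiArray T k (expansion F T c) where
  succ l m n := by
    obtain ⟨J, hJ⟩ : ∃ J : ℕ, k ≤ l + 1 + J := ⟨(k - (l + 1)).toNat, by omega⟩
    rw [expansion_eq_sum hc (l + 1) m n hJ, expansion_eq_sum hc l (m + T) n (J := J + 1)
      (by push_cast; omega), expansion_eq_sum hc l m (n + T) (J := J + 1) (by push_cast; omega),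
      Finset.sum_range_succ', Finset.sum_range_succ']
    simp only [fbinom_zero_right, Nat.cast_zero, mul_zero, sub_zero, add_zero, one_smul]
    rw [add_right_comm m, add_assoc m, add_sub_add_right_eq_sub, ← Finset.sum_sub_distrib]
    refine Finset.sum_congr rfl fun i _ => ?_
    have e1 : m + (n + T) - T * ((i + 1 : ℕ) : ℤ) = m + n - T * i := by push_cast; ring
    have e2 : l + ((i + 1 : ℕ) : ℤ) = l + 1 + i := by push_cast; ring
    rw [hB.fbinom_succ, e1, e2, ← sub_smul, add_sub_cancel_left]
  eq_zero l hl m n := by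
    rw [expansion_eq_sum hc l m n (J := 0) (by simpa using hl)]
    simp

theorem sum_range_alternating_choose_succ (N : ℕ) :
    ∑ j ∈ Finset.range (N + 1), ((-1 : F) ^ (j + 1) * ((N + 1).choose (j + 1) : F)) = -1 := by
  have h := Int.alternating_sum_range_choose (n := N + 1)
  rw [Finset.sum_range_succ', if_neg (Nat.succ_ne_zero N)] at h
  have h' := congrArg (Int.cast : ℤ → F) h
  push_cast at h'
  simp only [Nat.choose_zero_right, Nat.cast_one, mul_one] at h'
  linear_combination h'

/-- **Twisted Jacobi identity**: a Jacobi array is the expansion of its residues. -/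
theorem IsJacobiArray.eq_expansion (hB : HasBinomials F T) {k : ℤ} {D : ℤ → ℤ → ℤ → M}
    (hD : IsJacobiArray T k D) (r : ℤ) {l m n : ℤ} (hm : m ≡ r [ZMOD T]) :
    D l m n = expansion F T (residue F T r D) l m n := by
  set c := residue F T r D with hc
  have hc0 : ∀ l, k ≤ l → c l = 0 := residue_eq_zero hD.eq_zero r
  have hΔ := hD.sub (isJacobiArray_expansion hB hc0)
  refine sub_eq_zero.mp (hΔ.eq_zero_of_diagonal r (fun l hup q => ⟨r, rfl, ?_⟩) l m n hm)
  obtain ⟨J, hJ⟩ : ∃ J : ℕ, k ≤ l + (J + 1 : ℕ) := ⟨(k - (l + 1)).toNat, by omega⟩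
  -- the terms of the residue with `j ≥ 1` are known by the identity for larger `l`
  have h1 : c l q = D l r (q - r) + ∑ j ∈ Finset.range J, ∑ i ∈ Finset.range (J - j),
      ((-1) ^ (j + 1) * ((i + j + 1).choose (j + 1) : F) * fbinom F T r (i + j + 1)) •
        c (l + (i + j + 1 : ℕ)) (q - T * (i + j + 1 : ℕ)) := by
    rw [hc, residue_eq_sum hD.eq_zero r l q hJ, Finset.sum_range_succ', add_comm]
    simp only [pow_zero, fbinom_zero_right, mul_one, one_smul, Nat.cast_zero, mul_zero, add_zero,
      sub_zero]
    congr 1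
    refine Finset.sum_congr rfl fun j hj => ?_
    have hj' : j < J := by simpa using hj
    have hm' : r - T * ((j + 1 : ℕ) : ℤ) ≡ r [ZMOD T] :=
      (Int.modEq_iff_dvd.mpr ⟨(j + 1 : ℕ), by ring⟩)
    have h2 := sub_eq_zero.mp (hup (l + (j + 1 : ℕ)) (by push_cast; omega)
      (r - T * ((j + 1 : ℕ) : ℤ)) (q - r) hm')
    rw [h2, expansion_eq_sum hc0 _ _ _ (J := J - j) (by push_cast at hJ ⊢; omega), Finset.smul_sum]
    refine Finset.sum_congr rfl fun i _ => ?_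
    have h3 := hB.fbinom_mul_fbinom r (j + 1) i
    rw [smul_smul, mul_assoc, h3, ← mul_assoc]
    congr 2
    · rw [show j + 1 + i = i + j + 1 by omega]
    · rw [show j + 1 + i = i + j + 1 by omega]
    · push_cast; ring
    · push_cast; ring
  have h4 : ∑ j ∈ Finset.range J, ∑ i ∈ Finset.range (J - j),
      ((-1) ^ (j + 1) * ((i + j + 1).choose (j + 1) : F) * fbinom F T r (i + j + 1)) •
        c (l + (i + j + 1 : ℕ)) (q - T * (i + j + 1 : ℕ)) =
      - ∑ N ∈ Finset.range J, fbinom F T r (N + 1) • c (l + (N + 1 : ℕ)) (q - T * (N + 1 : ℕ)) := by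
    rw [← Finset.sum_range_diag_flip J fun j i =>
      ((-1) ^ (j + 1) * ((i + j + 1).choose (j + 1) : F) * fbinom F T r (i + j + 1)) •
        c (l + (i + j + 1 : ℕ)) (q - T * (i + j + 1 : ℕ)), ← Finset.sum_neg_distrib]
    refine Finset.sum_congr rfl fun N _ => ?_
    have h5 : ∀ j ∈ Finset.range (N + 1),
        ((-1) ^ (j + 1) * ((N - j + j + 1).choose (j + 1) : F) * fbinom F T r (N - j + j + 1)) •
          c (l + (N - j + j + 1 : ℕ)) (q - T * (N - j + j + 1 : ℕ)) =
        ((-1) ^ (j + 1) * ((N + 1).choose (j + 1) : F)) •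
          (fbinom F T r (N + 1) • c (l + (N + 1 : ℕ)) (q - T * (N + 1 : ℕ))) := by
      intro j hj
      rw [Nat.sub_add_cancel (by simp at hj; omega), smul_smul]
    rw [Finset.sum_congr rfl h5, ← Finset.sum_smul, sum_range_alternating_choose_succ, neg_one_smul]
  rw [Pi.sub_apply, Pi.sub_apply, Pi.sub_apply, sub_eq_zero, expansion_eq_sum hc0 l r (q - r) hJ,
    Finset.sum_range_succ', add_sub_cancel]
  simp only [fbinom_zero_right, one_smul, Nat.cast_zero, add_zero, mul_zero, sub_zero]
  rw [h1, h4]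
  abel

/-- An expansion determines the series that are expanded. -/
theorem residue_eq_of_eq_expansion (hB : HasBinomials F T) {k : ℤ} {D : ℤ → ℤ → ℤ → M}
    (hD : IsJacobiArray T k D) (r : ℤ) {c : ℤ → ℤ → M} (hc : ∀ l, k ≤ l → c l = 0)
    (h : ∀ l m n, m ≡ r [ZMOD T] → D l m n = expansion F T c l m n) : residue F T r D = c := by
  have hc0 : ∀ l, k ≤ l → residue F T r D l = 0 := residue_eq_zero hD.eq_zero r
  have key : ∀ d : ℕ, ∀ l, k ≤ l + d → residue F T r D l = c l := by
    intro d
    induction d with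
    | zero => intro l hl; rw [hc0 l (by simpa using hl), hc l (by simpa using hl)]
    | succ d ih =>
      intro l hl
      funext q
      have h1 := (hD.eq_expansion hB r (l := l) (n := q - r) (Int.ModEq.refl r)).symm.trans
        (h l r (q - r) rfl)
      rw [expansion_eq_sum hc0 l r _ hl, expansion_eq_sum hc l r _ hl, Finset.sum_range_succ',
        Finset.sum_range_succ'] at h1
      have h2 : ∀ i ∈ Finset.range d,
          fbinom F T r (i + 1) • residue F T r D (l + (i + 1 : ℕ)) (r + (q - r) - T * (i + 1 : ℕ)) =
          fbinom F T r (i + 1) • c (l + (i + 1 : ℕ)) (r + (q - r) - T * (i + 1 : ℕ)) := by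
        intro i _
        rw [ih _ (by push_cast at hl ⊢; omega)]
      rw [Finset.sum_congr rfl h2] at h1
      simpa using h1
  funext l
  exact key (k - l).toNat l (by omega)

theorem residue_congr (hB : HasBinomials F T) {k : ℤ} {D : ℤ → ℤ → ℤ → M}
    (hD : IsJacobiArray T k D) {r r' : ℤ} (h : r ≡ r' [ZMOD T]) :
    residue F T r D = residue F T r' D :=
  residue_eq_of_eq_expansion hB hD r (residue_eq_zero hD.eq_zero r') fun _ _ _ hm =>
    hD.eq_expansion hB r' (hm.trans h)

end Residue

/-! ### Dong's lemma -/

section ShiftComp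

variable {F A B M M' : Type*} [Field F] [AddCommGroup A] [AddCommGroup B] [AddCommGroup M]
  [Module F M] [AddCommGroup M'] [Module F M']

theorem shift_sub_pow_comp (e : A → B) {v w : A} {v' w' : B} (hv : ∀ x, e (x + v) = e x + v')
    (hw : ∀ x, e (x + w) = e x + w') (k : ℕ) (f : B → M) :
    ((shift v - shift w : Module.End F (A → M)) ^ k) (fun x => f (e x)) =
      fun x => ((shift v' - shift w' : Module.End F (B → M)) ^ k) f (e x) := by
  induction k with
  | zero => rfl
  | succ k ih =>
    rw [pow_succ', Module.End.mul_apply, ih, pow_succ', Module.End.mul_apply]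
    funext x
    simp [hv, hw]

theorem shift_sub_pow_map (φ : A → M →ₗ[F] M') {v w : A} (hv : ∀ x, φ (x + v) = φ x)
    (hw : ∀ x, φ (x + w) = φ x) (k : ℕ) (f : A → M) :
    ((shift v - shift w : Module.End F (A → M')) ^ k) (fun x => φ x (f x)) =
      fun x => φ x (((shift v - shift w : Module.End F (A → M)) ^ k) f x) := by
  induction k with
  | zero => rfl
  | succ k ih =>
    rw [pow_succ', Module.End.mul_apply, ih, pow_succ', Module.End.mul_apply]
    funext x
    simp [hv, hw]

theorem pow_apply_pow_apply_comm {P Q : Module.End F M} (h : Commute P Q) (i j : ℕ) (f : M) :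
    (P ^ i) ((Q ^ j) f) = (Q ^ j) ((P ^ i) f) := by
  rw [← Module.End.mul_apply, (h.pow_pow i j).eq, Module.End.mul_apply]

/-- A property of functions that is stable under differences of translates is stable under powers
of a difference of two translations. -/
theorem shift_sub_pow_induction (p : (A → M) → Prop) {v w : A}
    (h : ∀ f, p f → p (fun x => f (x + v) - f (x + w))) (k : ℕ) {f : A → M} (hf : p f) :
    p (((shift v - shift w : Module.End F (A → M)) ^ k) f) := by
  induction k with
  | zero => exact hf
  | succ k ih => rw [pow_succ', Module.End.mul_apply]; exact h _ ih

end ShiftComp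

section Dong

variable {F W : Type*} [Field F] [AddCommGroup W] [Module F W] {T : ℕ} [NeZero T]

/-- A family that satisfies the recurrence of multiplication by `x₁ - x₂` and is truncated in `x₂`
is determined by its part without powers of `x₁ - x₂`, because `x₁ - x₂` is invertible on such
families. -/
theorem eq_zero_of_succ_of_truncated {M : Type*} [AddCommGroup M] {Λ : ℤ → ℤ → ℤ → M}
    (hs : ∀ l m n, Λ (l + 1) m n = Λ l (m + T) n - Λ l m (n + T)) (h0 : ∀ m n, Λ 0 m n = 0)
    {N : ℤ} (hN : ∀ l m n, N ≤ n → Λ l m n = 0) (l m n : ℤ) : Λ l m n = 0 := by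
  have hT : (1 : ℤ) ≤ T := by exact_mod_cast NeZero.one_le
  have hdown : ∀ l, (∀ m n, Λ (l + 1) m n = 0) → ∀ m n, Λ l m n = 0 := by
    intro l hl
    have key : ∀ d : ℕ, ∀ m n, N ≤ n + d → Λ l m n = 0 := by
      intro d
      induction d with
      | zero => exact fun m n hn => hN l m n (by simpa using hn)
      | succ d ih =>
        intro m n hn
        have h1 := hs l (m - T) n
        rw [hl, ih (m - T) (n + T) (by push_cast at hn; omega), sub_zero, sub_add_cancel] at h1
        exact h1.symm
    exact fun m n => key (N - n).toNat m n (by omega)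
  induction l using Int.induction_on generalizing m n with
  | zero => exact h0 m n
  | succ l ih => rw [hs, ih, ih, sub_zero]
  | pred l ih => exact hdown _ (by simpa using ih) m n

/-- `(x₁-x₃)^k (x₂-x₃)^k` annihilates the supercommutator of `(x₁-x₂)^l a(x₁) b(x₂)` with `c(x₃)`.
For `l = 0`, move `c` past `b` and then past `a`; the general case follows, because families that
are truncated in `x₂` are determined by their part with `l = 0`. -/
theorem shift_pow_modeProd_commutator (hB : HasBinomials F T) {a b c : ℤ → Module.End F W}
    (hb : b ∈ fieldSpace F W) {s₁ s₂ : F} {k : ℕ}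
    (hac : ((shift ((T : ℤ), (0 : ℤ)) - shift (0, (T : ℤ)) :
        Module.End F (ℤ × ℤ → Module.End F W)) ^ k)
      (fun x => a x.1 * c x.2 - s₁ • (c x.2 * a x.1)) = 0)
    (hbc : ((shift ((T : ℤ), (0 : ℤ)) - shift (0, (T : ℤ)) :
        Module.End F (ℤ × ℤ → Module.End F W)) ^ k)
      (fun x => b x.1 * c x.2 - s₂ • (c x.2 * b x.1)) = 0) :
    ((shift ((0 : ℤ), (T : ℤ), (0 : ℤ), (0 : ℤ)) - shift (0, 0, 0, (T : ℤ)) :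
        Module.End F (ℤ × ℤ × ℤ × ℤ → Module.End F W)) ^ k)
      (((shift ((0 : ℤ), (0 : ℤ), (T : ℤ), (0 : ℤ)) - shift (0, 0, 0, (T : ℤ)) :
        Module.End F (ℤ × ℤ × ℤ × ℤ → Module.End F W)) ^ k)
        (fun x => modeProd T x.1 x.2.1 x.2.2.1 a b * c x.2.2.2 -
          (s₁ * s₂) • (c x.2.2.2 * modeProd T x.1 x.2.1 x.2.2.1 a b))) = 0 := by
  set Ψ : ℤ × ℤ × ℤ × ℤ → Module.End F W := fun x =>
    modeProd T x.1 x.2.1 x.2.2.1 a b * c x.2.2.2 -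
      (s₁ * s₂) • (c x.2.2.2 * modeProd T x.1 x.2.1 x.2.2.1 a b) with hΨ
  -- the three properties used by `eq_zero_of_succ_of_truncated`
  have hsucc : ∀ l m n q, Ψ (l + 1, m, n, q) = Ψ (l, m + T, n, q) - Ψ (l, m, n + T, q) := by
    intro l m n q
    simp only [hΨ, modeProd_succ hB _ _ _ a hb, sub_mul, mul_sub]
    module
  have htrunc : ∀ w q, ∃ N : ℤ, ∀ l m n, N ≤ n → Ψ (l, m, n, q) w = 0 := by
    intro w q
    obtain ⟨N, hN⟩ := hb w
    obtain ⟨N', hN'⟩ := hb (c q w)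
    refine ⟨max N N', fun l m n hn => ?_⟩
    simp [hΨ, modeProd_apply_eq_zero l m a hb hN ((le_max_left _ _).trans hn),
      modeProd_apply_eq_zero l m a hb hN' ((le_max_right _ _).trans hn)]
  have hzero : ((shift ((T : ℤ), (0 : ℤ), (0 : ℤ)) - shift (0, 0, (T : ℤ)) :
        Module.End F (ℤ × ℤ × ℤ → Module.End F W)) ^ k)
      (((shift ((0 : ℤ), (T : ℤ), (0 : ℤ)) - shift (0, 0, (T : ℤ)) :
        Module.End F (ℤ × ℤ × ℤ → Module.End F W)) ^ k) (fun x => Ψ (0, x))) = 0 := by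
    have hsplit : (fun x => Ψ (0, x)) =
        (fun x : ℤ × ℤ × ℤ => a x.1 * (b x.2.1 * c x.2.2 - s₂ • (c x.2.2 * b x.2.1))) +
        (fun x : ℤ × ℤ × ℤ => s₂ • ((a x.1 * c x.2.2 - s₁ • (c x.2.2 * a x.1)) * b x.2.1)) := by
      funext x
      simp only [hΨ, modeProd_zero _ _ a hb, Pi.add_apply, mul_sub, sub_mul, mul_smul_comm,
        smul_mul_assoc, mul_assoc]
      module
    have e1 := shift_sub_pow_map (F := F) (A := ℤ × ℤ × ℤ) (v := ((0 : ℤ), (T : ℤ), (0 : ℤ)))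
      (w := (0, 0, (T : ℤ))) (fun x => LinearMap.mulLeft F (a x.1)) (by simp) (by simp) k
      (fun x => b x.2.1 * c x.2.2 - s₂ • (c x.2.2 * b x.2.1))
    rw [shift_sub_pow_comp (F := F) (fun x : ℤ × ℤ × ℤ => (x.2.1, x.2.2))
      (v' := ((T : ℤ), (0 : ℤ))) (w' := (0, (T : ℤ))) (by simp) (by simp) k
      (fun x => b x.1 * c x.2 - s₂ • (c x.2 * b x.1)), hbc] at e1
    have e2 := shift_sub_pow_map (F := F) (A := ℤ × ℤ × ℤ) (v := ((T : ℤ), (0 : ℤ), (0 : ℤ)))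
      (w := (0, 0, (T : ℤ))) (fun x => s₂ • LinearMap.mulRight F (b x.2.1)) (by simp) (by simp) k
      (fun x => a x.1 * c x.2.2 - s₁ • (c x.2.2 * a x.1))
    rw [shift_sub_pow_comp (F := F) (fun x : ℤ × ℤ × ℤ => (x.1, x.2.2))
      (v' := ((T : ℤ), (0 : ℤ))) (w' := (0, (T : ℤ))) (by simp) (by simp) k
      (fun x => a x.1 * c x.2 - s₁ • (c x.2 * a x.1)), hac] at e2
    simp only [LinearMap.mulLeft_apply, LinearMap.mulRight_apply, LinearMap.smul_apply,
      Pi.zero_apply, mul_zero, zero_mul, smul_zero, ← Pi.zero_def] at e1 e2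
    rw [hsplit, map_add, map_add, e1, pow_apply_pow_apply_comm (shift_sub_commute _ _ _ _), e2,
      map_zero, map_zero, add_zero]
  -- these properties are inherited by the multiples of `Ψ`
  set p : (ℤ × ℤ × ℤ × ℤ → Module.End F W) → Prop := fun f =>
    (∀ l m n q, f (l + 1, m, n, q) = f (l, m + T, n, q) - f (l, m, n + T, q)) ∧
      ∀ w q, ∃ N : ℤ, ∀ l m n, N ≤ n → f (l, m, n, q) w = 0 with hp
  have hpM : ∀ f, p f → p (fun x => f (x + ((0 : ℤ), (T : ℤ), (0 : ℤ), (0 : ℤ))) -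
      f (x + (0, 0, 0, (T : ℤ)))) := by
    rintro f ⟨h1, h2⟩
    refine ⟨fun l m n q => ?_, fun w q => ?_⟩
    · simp only [Prod.mk_add_mk, add_zero, h1]
      abel
    · obtain ⟨N, hN⟩ := h2 w q
      obtain ⟨N', hN'⟩ := h2 w (q + T)
      refine ⟨max N N', fun l m n hn => ?_⟩
      simp [hN _ _ _ ((le_max_left _ _).trans hn), hN' _ _ _ ((le_max_right _ _).trans hn)]
  have hpN : ∀ f, p f → p (fun x => f (x + ((0 : ℤ), (0 : ℤ), (T : ℤ), (0 : ℤ))) -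
      f (x + (0, 0, 0, (T : ℤ)))) := by
    rintro f ⟨h1, h2⟩
    refine ⟨fun l m n q => ?_, fun w q => ?_⟩
    · simp only [Prod.mk_add_mk, add_zero, h1]
      abel
    · obtain ⟨N, hN⟩ := h2 w q
      obtain ⟨N', hN'⟩ := h2 w (q + T)
      refine ⟨max N N', fun l m n hn => ?_⟩
      simp [hN l m (n + T) (by have := (le_max_left N N').trans hn; omega),
        hN' _ _ _ ((le_max_right _ _).trans hn)]
  obtain ⟨hΘ1, hΘ2⟩ := shift_sub_pow_induction (F := F) p hpM k
    (shift_sub_pow_induction (F := F) p hpN k (⟨hsucc, htrunc⟩ : p Ψ))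
  have hdrop : (fun x : ℤ × ℤ × ℤ => (((shift ((0 : ℤ), (T : ℤ), (0 : ℤ), (0 : ℤ)) -
      shift (0, 0, 0, (T : ℤ)) : Module.End F (ℤ × ℤ × ℤ × ℤ → Module.End F W)) ^ k)
      (((shift ((0 : ℤ), (0 : ℤ), (T : ℤ), (0 : ℤ)) - shift (0, 0, 0, (T : ℤ)) :
        Module.End F (ℤ × ℤ × ℤ × ℤ → Module.End F W)) ^ k) Ψ)) (0, x)) = 0 := by
    rw [← hzero, shift_sub_pow_comp (F := F) (fun x : ℤ × ℤ × ℤ => ((0 : ℤ), x))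
      (v' := ((0 : ℤ), (0 : ℤ), (T : ℤ), (0 : ℤ))) (w' := (0, 0, 0, (T : ℤ))) (by simp) (by simp),
      shift_sub_pow_comp (F := F) (fun x : ℤ × ℤ × ℤ => ((0 : ℤ), x))
      (v' := ((0 : ℤ), (T : ℤ), (0 : ℤ), (0 : ℤ))) (w' := (0, 0, 0, (T : ℤ))) (by simp) (by simp)]
  funext ⟨l, m, n, q⟩
  ext w
  obtain ⟨N, hN⟩ := hΘ2 w q
  refine eq_zero_of_succ_of_truncated (T := T)
    (Λ := fun l m n => (((shift ((0 : ℤ), (T : ℤ), (0 : ℤ), (0 : ℤ)) -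
      shift (0, 0, 0, (T : ℤ)) : Module.End F (ℤ × ℤ × ℤ × ℤ → Module.End F W)) ^ k)
      (((shift ((0 : ℤ), (0 : ℤ), (T : ℤ), (0 : ℤ)) - shift (0, 0, 0, (T : ℤ)) :
        Module.End F (ℤ × ℤ × ℤ × ℤ → Module.End F W)) ^ k) Ψ)) (l, m, n, q) w)
    (fun l m n => ?_) (fun m n => ?_) hN l m n
  · simp only [hΘ1, LinearMap.sub_apply]
  · have := congrFun hdrop (m, n, q)
    simp only [Pi.zero_apply] at this
    simp only [this, LinearMap.zero_apply]

/-- **Dong's lemma**: if `a(x)`, `b(x)`, `c(x)` are pairwise mutually local, then every coefficient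
of the bracket of `a(x₁)` and `b(x)`, as a series in `x`, is mutually local with `c(x)`. In a high
power of `x₂ - x₃ = (x₁ - x₃) - x₀`, each term contains a power of `x₀` that exceeds the order of
the pole, or a power of `x₁ - x₃` that cancels the supercommutator. -/
theorem MutuallyLocal.bracket_left (hB : HasBinomials F T) {a b c : ℤ → Module.End F W}
    (ha : a ∈ fieldSpace F W) (hb : b ∈ fieldSpace F W) {s s₁ s₂ : F}
    (hab : MutuallyLocal T s a b) (hac : MutuallyLocal T s₁ a c) (hbc : MutuallyLocal T s₂ b c)
    (l m : ℤ) : MutuallyLocal T (s₁ * s₂) (fun n => bracket T s l m n a b) c := by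
  obtain ⟨k₀, hk₀⟩ := hab.exists_bracket_eq_zero hB ha hb
  obtain ⟨k₁, hk₁⟩ := mutuallyLocal_iff_shift.mp hac
  obtain ⟨k₂, hk₂⟩ := mutuallyLocal_iff_shift.mp hbc
  obtain ⟨k, h0k, hk₁', hk₂'⟩ : ∃ k : ℕ, k₀ ≤ k ∧ k₁ ≤ k ∧ k₂ ≤ k :=
    ⟨max k₀ (max k₁ k₂), by omega, by omega, by omega⟩
  have hA := shift_pow_modeProd_commutator hB (a := a) hb (pow_apply_eq_zero_of_le hk₁ hk₁')
    (pow_apply_eq_zero_of_le hk₂ hk₂')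
  have hB' := shift_pow_modeProd_commutator hB (a := b) ha (pow_apply_eq_zero_of_le hk₂ hk₂')
    (pow_apply_eq_zero_of_le hk₁ hk₁')
  -- `P`, `U`, `V` are multiplication by `x₀`, `x₁ - x₃` and `x₂ - x₃`
  set P : Module.End F (ℤ × ℤ × ℤ × ℤ → Module.End F W) := shift (1, 0, 0, 0) with hP
  set U : Module.End F (ℤ × ℤ × ℤ × ℤ → Module.End F W) :=
    shift (0, (T : ℤ), 0, 0) - shift (0, 0, 0, (T : ℤ)) with hU
  set V : Module.End F (ℤ × ℤ × ℤ × ℤ → Module.End F W) :=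
    shift (0, 0, (T : ℤ), 0) - shift (0, 0, 0, (T : ℤ)) with hV
  set Φ : ℤ × ℤ × ℤ × ℤ → Module.End F W := fun x =>
    bracket T s x.1 x.2.1 x.2.2.1 a b * c x.2.2.2 -
      (s₁ * s₂) • (c x.2.2.2 * bracket T s x.1 x.2.1 x.2.2.1 a b) with hΦ
  have hUV : (U ^ k) ((V ^ k) Φ) = 0 := by
    set Ψ : ℤ × ℤ × ℤ × ℤ → Module.End F W := fun x =>
      modeProd T x.1 x.2.1 x.2.2.1 b a * c x.2.2.2 -
        (s₂ * s₁) • (c x.2.2.2 * modeProd T x.1 x.2.1 x.2.2.1 b a) with hΨ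
    set φ : ℤ × ℤ × ℤ × ℤ → Module.End F W →ₗ[F] Module.End F W := fun x =>
      (s * (-1) ^ x.1) • LinearMap.id with hφ
    have hsplit : Φ = (fun x => modeProd T x.1 x.2.1 x.2.2.1 a b * c x.2.2.2 -
          (s₁ * s₂) • (c x.2.2.2 * modeProd T x.1 x.2.1 x.2.2.1 a b)) -
        fun x => φ x (Ψ (x.1, x.2.2.1, x.2.1, x.2.2.2)) := by
      funext x
      simp only [hΦ, hΨ, hφ, bracket_eq, Pi.sub_apply, sub_mul, mul_sub, LinearMap.smul_apply,
        LinearMap.id_apply, smul_mul_assoc, mul_smul_comm]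
      module
    rw [hsplit, map_sub, map_sub, hA, zero_sub, neg_eq_zero]
    have e1 := shift_sub_pow_map φ (v := ((0 : ℤ), (0 : ℤ), (T : ℤ), (0 : ℤ)))
      (w := (0, 0, 0, (T : ℤ))) (by simp [hφ]) (by simp [hφ]) k
      (fun x => Ψ (x.1, x.2.2.1, x.2.1, x.2.2.2))
    rw [shift_sub_pow_comp (F := F) (fun x : ℤ × ℤ × ℤ × ℤ => (x.1, x.2.2.1, x.2.1, x.2.2.2))
      (v' := ((0 : ℤ), (T : ℤ), (0 : ℤ), (0 : ℤ))) (w' := (0, 0, 0, (T : ℤ))) (by simp)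
      (by simp)] at e1
    have e2 := shift_sub_pow_map φ (v := ((0 : ℤ), (T : ℤ), (0 : ℤ), (0 : ℤ)))
      (w := (0, 0, 0, (T : ℤ))) (by simp [hφ]) (by simp [hφ]) k
      (fun x => (U ^ k) Ψ (x.1, x.2.2.1, x.2.1, x.2.2.2))
    rw [shift_sub_pow_comp (F := F) (fun x : ℤ × ℤ × ℤ × ℤ => (x.1, x.2.2.1, x.2.1, x.2.2.2))
      (v' := ((0 : ℤ), (0 : ℤ), (T : ℤ), (0 : ℤ))) (w' := (0, 0, 0, (T : ℤ))) (by simp)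
      (by simp)] at e2
    rw [hV, e1, ← hU, hU, e2, ← hV,
      pow_apply_pow_apply_comm (shift_sub_commute _ _ _ _ : Commute V U), hB']
    funext x
    simp
  have hPΦ : V Φ = (U - P) Φ := by
    funext x
    simp only [hU, hV, hP, hΦ, LinearMap.sub_apply, Pi.sub_apply, shift_apply, Prod.fst_add,
      Prod.snd_add, add_zero, bracket_succ hB _ _ _ _ ha hb, sub_mul, mul_sub]
    module
  have hPU : Commute P U := (shift_commute _ _).sub_right (shift_commute _ _)
  have hPV : Commute P V := (shift_commute _ _).sub_right (shift_commute _ _)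
  have hVU : Commute V U := shift_sub_commute _ _ _ _
  -- `x₀^e` raises the exponent `l` beyond the order of the pole, where the bracket vanishes
  obtain ⟨e, he⟩ : ∃ e : ℕ, (k : ℤ) ≤ l + e := ⟨(k - l).toNat, by omega⟩
  have hlarge : ∀ i j : ℕ, e ≤ i → ∀ y, (P ^ i) ((U ^ j) ((V ^ k) Φ)) (l, y) = 0 := by
    intro i j hi y
    set p : (ℤ × ℤ × ℤ × ℤ → Module.End F W) → Prop := fun f => ∀ x, (k : ℤ) ≤ x.1 → f x = 0
    have hp : p ((U ^ j) ((V ^ k) Φ)) := by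
      refine shift_sub_pow_induction p ?_ j (shift_sub_pow_induction p ?_ k ?_)
      · intro f hf x hx
        simp [hf (x + (0, (T : ℤ), 0, 0)) (by simpa using hx),
          hf (x + (0, 0, 0, (T : ℤ))) (by simpa using hx)]
      · intro f hf x hx
        simp [hf (x + (0, 0, (T : ℤ), 0)) (by simpa using hx),
          hf (x + (0, 0, 0, (T : ℤ))) (by simpa using hx)]
      · intro x hx
        simp [hΦ, hk₀ x.1 (by omega)]
    rw [hP, shift_pow, shift_apply]
    exact hp _ (by simp; omega)
  rw [mutuallyLocal_iff_shift]
  refine ⟨k + (k + e), ?_⟩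
  have hcomp := shift_sub_pow_comp (F := F) (fun x : ℤ × ℤ => (l, m, x))
    (v := ((T : ℤ), (0 : ℤ))) (w := (0, (T : ℤ)))
    (v' := ((0 : ℤ), (0 : ℤ), (T : ℤ), (0 : ℤ))) (w' := (0, 0, 0, (T : ℤ))) (by simp) (by simp)
    (k + (k + e)) Φ
  refine hcomp.trans (funext fun x => ?_)
  change (V ^ (k + (k + e))) Φ (l, m, x) = 0
  rw [pow_add, Module.End.mul_apply, pow_apply_eq_of_commute (hVU.sub_right hPV.symm) hPΦ,
    pow_apply_pow_apply_comm (hVU.sub_right hPV.symm), sub_eq_neg_add, (hPU.neg_left).add_pow]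
  simp only [LinearMap.sum_apply, Finset.sum_apply]
  refine Finset.sum_eq_zero fun i _ => ?_
  have h1 : ((k + e).choose i : Module.End F (ℤ × ℤ × ℤ × ℤ → Module.End F W)) =
      (((k + e).choose i : ℕ) : F) • 1 := by
    rw [Nat.cast_smul_eq_nsmul, nsmul_one]
  rw [h1, ← neg_one_smul F P, smul_pow]
  simp only [Module.End.mul_apply, LinearMap.smul_apply, Module.End.one_apply, map_smul,
    Pi.smul_apply]
  -- a term has a factor `x₀^e`, or a factor `(x₁-x₃)^k` that annihilates `(x₂-x₃)^k Φ`
  rcases le_or_gt e i with hi | hi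
  · rw [hlarge i _ hi, smul_zero, smul_zero]
  · rw [show k + e - i = (e - i) + k by omega, pow_add, Module.End.mul_apply, hUV, map_zero,
      map_zero, Pi.zero_apply, smul_zero, smul_zero]

end Dong

/-! ### Products of homogeneous fields -/

section Sign

variable {F : Type*} [Field F]

theorem superSign_mul_self (α β : ZMod 2) : superSign F α β * superSign F α β = 1 := by
  rw [superSign, ← mul_pow]; simp

theorem superSign_comm (α β : ZMod 2) : superSign F α β = superSign F β α := by
  rw [superSign, superSign, mul_comm]

theorem superSign_zero_left (β : ZMod 2) : superSign F 0 β = 1 := by simp [superSign]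

theorem superSign_zero_right (α : ZMod 2) : superSign F α 0 = 1 := by simp [superSign]

theorem superSign_add_left (α β γ : ZMod 2) :
    superSign F (α + β) γ = superSign F α γ * superSign F β γ := by
  have key : ∀ α β γ : ZMod 2,
      Even (α.val * γ.val + β.val * γ.val + (α + β).val * γ.val) := by decide
  rw [superSign, superSign, superSign, ← pow_add]
  obtain ⟨c, hc⟩ := key α β γ
  have h : ((-1 : F) ^ (α.val * γ.val + β.val * γ.val)) * (-1) ^ ((α + β).val * γ.val) = 1 := by
    rw [← pow_add, hc, ← two_mul, pow_mul]; simp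
  have h' : ((-1 : F) ^ ((α + β).val * γ.val)) * (-1) ^ ((α + β).val * γ.val) = 1 := by
    rw [← mul_pow]; simp
  linear_combination ((-1 : F) ^ (α.val * γ.val + β.val * γ.val)) * h' -
    ((-1 : F) ^ ((α + β).val * γ.val)) * h

theorem superSign_add_right (α β γ : ZMod 2) :
    superSign F α (β + γ) = superSign F α β * superSign F α γ := by
  rw [superSign_comm, superSign_add_left, superSign_comm β, superSign_comm γ]

end Sign

section Product

variable {F W : Type*} [Field F] [AddCommGroup W] [Module F W] {T : ℕ}

/-- An `n`-th product is a finite combination of translates of coefficients of the bracket. -/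
theorem nthProduct_eq_sum {k : ℕ} {s : F} {a b : ℤ → Module.End F W}
    (h : ∀ l : ℤ, k ≤ l → ∀ m n, bracket T s l m n a b = 0) (r n : ℤ) {J : ℕ}
    (hJ : k ≤ n + J) :
    nthProduct T s r n a b = ∑ j ∈ Finset.range J,
      (((-1) ^ j * fbinom F T r j) • fun q => bracket T s (n + j) (r - T * j) (q - r) a b) := by
  funext q
  refine (residue_eq_sum (D := fun l m n => bracket T s l m n a b) h r n q hJ).trans ?_
  simp

theorem mutuallyLocal_idField (b : ℤ → Module.End F W) : MutuallyLocal T (1 : F) (idField T) b := by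
  refine ⟨0, fun m n => ?_⟩
  simp only [zero_add, Finset.range_one, Finset.sum_singleton, idField]
  split_ifs <;> simp

variable [NeZero T]

theorem isJacobiArray_bracket (hB : HasBinomials F T) {s : F} {a b : ℤ → Module.End F W}
    (ha : a ∈ fieldSpace F W) (hb : b ∈ fieldSpace F W) (h : MutuallyLocal T s a b) :
    ∃ k : ℕ, IsJacobiArray T k (fun l m n => bracket T s l m n a b) := by
  obtain ⟨k, hk⟩ := h.exists_bracket_eq_zero hB ha hb
  exact ⟨k, fun l m n => bracket_succ hB s l m n ha hb, hk⟩

theorem nthProduct_congr (hB : HasBinomials F T) {s : F} {a b : ℤ → Module.End F W}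
    (ha : a ∈ fieldSpace F W) (hb : b ∈ fieldSpace F W) (h : MutuallyLocal T s a b) {r r' : ℤ}
    (hr : r ≡ r' [ZMOD T]) (n : ℤ) : nthProduct T s r n a b = nthProduct T s r' n a b := by
  obtain ⟨k, hk⟩ := isJacobiArray_bracket hB ha hb h
  exact congrFun (residue_congr hB hk hr) n

theorem exists_nthProduct_eq_zero (hB : HasBinomials F T) {s : F} {a b : ℤ → Module.End F W}
    (ha : a ∈ fieldSpace F W) (hb : b ∈ fieldSpace F W) (h : MutuallyLocal T s a b) (r : ℤ) :
    ∃ N : ℤ, ∀ n, N ≤ n → nthProduct T s r n a b = 0 := by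
  obtain ⟨k, hk⟩ := isJacobiArray_bracket hB ha hb h
  exact ⟨k, fun n hn => residue_eq_zero hk.eq_zero r n hn⟩

theorem comp_sub_mem_fieldSpace {a : ℤ → Module.End F W} (ha : a ∈ fieldSpace F W) (d : ℤ) :
    (fun n => a (n - d)) ∈ fieldSpace F W := by
  intro w
  obtain ⟨N, hN⟩ := ha w
  exact ⟨N + d, fun n hn => hN _ (by omega)⟩

theorem nthProduct_mem_fieldSpace (hB : HasBinomials F T) {s : F} {a b : ℤ → Module.End F W}
    (ha : a ∈ fieldSpace F W) (hb : b ∈ fieldSpace F W) (h : MutuallyLocal T s a b) (r n : ℤ) :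
    nthProduct T s r n a b ∈ fieldSpace F W := by
  obtain ⟨k, hk⟩ := h.exists_bracket_eq_zero hB ha hb
  obtain ⟨J, hJ⟩ : ∃ J : ℕ, (k : ℤ) ≤ n + J := ⟨(k - n).toNat, by omega⟩
  rw [nthProduct_eq_sum hk r n hJ]
  exact sum_mem fun j _ => Submodule.smul_mem _ _
    (comp_sub_mem_fieldSpace (bracket_mem_fieldSpace s _ _ ha hb) r)

theorem MutuallyLocal.nthProduct_left (hB : HasBinomials F T) {a b c : ℤ → Module.End F W}
    (ha : a ∈ fieldSpace F W) (hb : b ∈ fieldSpace F W) {s s₁ s₂ : F}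
    (hab : MutuallyLocal T s a b) (hac : MutuallyLocal T s₁ a c) (hbc : MutuallyLocal T s₂ b c)
    (r n : ℤ) : MutuallyLocal T (s₁ * s₂) (nthProduct T s r n a b) c := by
  obtain ⟨k, hk⟩ := hab.exists_bracket_eq_zero hB ha hb
  obtain ⟨J, hJ⟩ : ∃ J : ℕ, (k : ℤ) ≤ n + J := ⟨(k - n).toNat, by omega⟩
  rw [nthProduct_eq_sum hk r n hJ]
  refine MutuallyLocal.sum_left fun j _ => MutuallyLocal.smul_left ?_ _
  simpa only [sub_eq_add_neg] using
    (hab.bracket_left hB ha hb hac hbc (n + j) (r - T * j)).translate_left (-r)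

theorem nthProduct_add_left (hB : HasBinomials F T) {s : F} {a a' b : ℤ → Module.End F W}
    (ha : a ∈ fieldSpace F W) (ha' : a' ∈ fieldSpace F W) (hb : b ∈ fieldSpace F W)
    (h : MutuallyLocal T s a b) (h' : MutuallyLocal T s a' b) (r n : ℤ) :
    nthProduct T s r n (a + a') b = nthProduct T s r n a b + nthProduct T s r n a' b := by
  obtain ⟨k, hk⟩ := h.exists_bracket_eq_zero hB ha hb
  obtain ⟨k', hk'⟩ := h'.exists_bracket_eq_zero hB ha' hb
  have e : ∀ l m n, bracket T s l m n (a + a') b =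
      bracket T s l m n a b + bracket T s l m n a' b := fun l m n => by
    have := congrArg (· ⟨b, hb⟩) ((bracketHom T s l m n).map_add ⟨a, ha⟩ ⟨a', ha'⟩)
    simpa [bracketHom_apply] using this
  obtain ⟨J, hJ⟩ : ∃ J : ℕ, ((max k k' : ℕ) : ℤ) ≤ n + J := ⟨((max k k' : ℕ) - n).toNat, by omega⟩
  rw [nthProduct_eq_sum (k := max k k') (fun l hl m n => by
      rw [e, hk l (by omega), hk' l (by omega), add_zero]) r n hJ,
    nthProduct_eq_sum hk r n (J := J) (by omega),
    nthProduct_eq_sum hk' r n (J := J) (by omega),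
    ← Finset.sum_add_distrib]
  refine Finset.sum_congr rfl fun j _ => ?_
  rw [← smul_add]
  congr 1
  funext q
  exact e _ _ _

theorem nthProduct_add_right (hB : HasBinomials F T) {s : F} {a b b' : ℤ → Module.End F W}
    (ha : a ∈ fieldSpace F W) (hb : b ∈ fieldSpace F W) (hb' : b' ∈ fieldSpace F W)
    (h : MutuallyLocal T s a b) (h' : MutuallyLocal T s a b') (r n : ℤ) :
    nthProduct T s r n a (b + b') = nthProduct T s r n a b + nthProduct T s r n a b' := by
  obtain ⟨k, hk⟩ := h.exists_bracket_eq_zero hB ha hb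
  obtain ⟨k', hk'⟩ := h'.exists_bracket_eq_zero hB ha hb'
  have e : ∀ l m n, bracket T s l m n a (b + b') =
      bracket T s l m n a b + bracket T s l m n a b' := fun l m n => by
    have := (bracketHom T s l m n ⟨a, ha⟩).map_add ⟨b, hb⟩ ⟨b', hb'⟩
    simpa [bracketHom_apply] using this
  obtain ⟨J, hJ⟩ : ∃ J : ℕ, ((max k k' : ℕ) : ℤ) ≤ n + J := ⟨((max k k' : ℕ) - n).toNat, by omega⟩
  rw [nthProduct_eq_sum (k := max k k') (fun l hl m n => by
      rw [e, hk l (by omega), hk' l (by omega), add_zero]) r n hJ,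
    nthProduct_eq_sum hk r n (J := J) (by omega),
    nthProduct_eq_sum hk' r n (J := J) (by omega),
    ← Finset.sum_add_distrib]
  refine Finset.sum_congr rfl fun j _ => ?_
  rw [← smul_add]
  congr 1
  funext q
  exact e _ _ _

theorem nthProduct_smul_left {s : F} {a b : ℤ → Module.End F W}
    (ha : a ∈ fieldSpace F W) (hb : b ∈ fieldSpace F W) (c : F) (r n : ℤ) :
    nthProduct T s r n (c • a) b = c • nthProduct T s r n a b := by
  funext q
  simp only [nthProduct, Pi.smul_apply, smul_finsum]
  refine finsum_congr fun j => ?_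
  have := congrArg (· ⟨b, hb⟩)
    ((bracketHom T s (n + j) (r - T * j) (q - r)).map_smul c ⟨a, ha⟩)
  simp only [bracketHom_apply, LinearMap.smul_apply] at this
  rw [smul_comm c, ← this]
  rfl

theorem nthProduct_smul_right {s : F} {a b : ℤ → Module.End F W}
    (ha : a ∈ fieldSpace F W) (hb : b ∈ fieldSpace F W) (c : F) (r n : ℤ) :
    nthProduct T s r n a (c • b) = c • nthProduct T s r n a b := by
  funext q
  simp only [nthProduct, Pi.smul_apply, smul_finsum]
  refine finsum_congr fun j => ?_
  have := (bracketHom T s (n + j) (r - T * j) (q - r) ⟨a, ha⟩).map_smul c ⟨b, hb⟩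
  simp only [bracketHom_apply] at this
  rw [smul_comm c, ← this]
  rfl

end Product

section Homogeneous

variable {F W : Type*} [Field F] [AddCommGroup W] [Module F W] {T : ℕ} [NeZero T]
  {𝒲 : ZMod 2 → Submodule F W}

theorem zpow_eq_zpow_iff_modEq {η : F} (hη : IsPrimitiveRoot η T) (n r : ℤ) :
    η ^ n = η ^ r ↔ n ≡ r [ZMOD T] := by
  have h0 : η ≠ 0 := hη.ne_zero (NeZero.ne T)
  rw [Int.modEq_comm, Int.modEq_iff_dvd, ← hη.zpow_eq_one_iff_dvd, zpow_sub₀ h0,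
    div_eq_one_iff_eq (zpow_ne_zero _ h0)]

/-- Since `η` is primitive, an eigenvector of the twist is a series whose modes are supported in one
residue class modulo `T`. -/
theorem twist_eq_smul_iff {η : F} (hη : IsPrimitiveRoot η T) (r : ℤ)
    (a : ℤ → Module.End F W) :
    twist η a = η ^ r • a ↔ ∀ n, ¬ n ≡ r [ZMOD T] → a n = 0 := by
  rw [funext_iff]
  refine forall_congr' fun n => ?_
  change η ^ n • a n = η ^ r • a n ↔ _
  rw [← sub_eq_zero, ← sub_smul, smul_eq_zero, sub_eq_zero, zpow_eq_zpow_iff_modEq hη]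
  tauto

theorem isHomogeneous_iff {η : F} (hη : IsPrimitiveRoot η T) {r : ℤ} {α : ZMod 2}
    {a : ℤ → Module.End F W} :
    IsHomogeneous η 𝒲 r α a ↔ a ∈ fieldSpace F W ∧ (∀ n, ¬ n ≡ r [ZMOD T] → a n = 0) ∧
      ∀ n, a n ∈ endParity 𝒲 α := by
  rw [IsHomogeneous, twist_eq_smul_iff hη]

theorem mul_mem_endParity {α β : ZMod 2} {f g : Module.End F W} (hf : f ∈ endParity 𝒲 α)
    (hg : g ∈ endParity 𝒲 β) : f * g ∈ endParity 𝒲 (α + β) := fun γ w hw => by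
  rw [add_assoc]; exact hf _ _ (hg γ w hw)

theorem modeProd_mem_endParity {α β : ZMod 2} {a b : ℤ → Module.End F W}
    (hb : b ∈ fieldSpace F W) (hα : ∀ n, a n ∈ endParity 𝒲 α) (hβ : ∀ n, b n ∈ endParity 𝒲 β)
    (l m n : ℤ) : modeProd T l m n a b ∈ endParity 𝒲 (α + β) := by
  intro γ w hw
  obtain ⟨I, hI⟩ := exists_forall_mode_eq_zero (T := T) hb n w
  rw [modeProd_apply l m a hb hI]
  exact sum_mem fun i _ => Submodule.smul_mem _ _ (mul_mem_endParity (hα _) (hβ _) γ w hw)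

theorem bracket_mem_endParity {α β : ZMod 2} {a b : ℤ → Module.End F W}
    (ha : a ∈ fieldSpace F W) (hb : b ∈ fieldSpace F W) (hα : ∀ n, a n ∈ endParity 𝒲 α)
    (hβ : ∀ n, b n ∈ endParity 𝒲 β) (s : F) (l m n : ℤ) :
    bracket T s l m n a b ∈ endParity 𝒲 (α + β) := by
  rw [bracket_eq]
  refine sub_mem (modeProd_mem_endParity hb hα hβ l m n) (Submodule.smul_mem _ _ ?_)
  rw [add_comm]
  exact modeProd_mem_endParity ha hβ hα l n m

theorem bracket_eq_zero_of_not_modEq {r' : ℤ} {a b : ℤ → Module.End F W}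
    (ha : a ∈ fieldSpace F W) (hb : b ∈ fieldSpace F W)
    (hr' : ∀ n, ¬ n ≡ r' [ZMOD T] → b n = 0) (s : F) (l m : ℤ) {n : ℤ}
    (hn : ¬ n ≡ r' [ZMOD T]) : bracket T s l m n a b = 0 := by
  have h0 : ∀ j : ℤ, b (n + T * j) = 0 := fun j => hr' _ fun h =>
    hn ((Int.modEq_iff_dvd.mpr ⟨j, by ring⟩ : n ≡ n + T * j [ZMOD T]).trans h)
  ext w
  obtain ⟨I, hI⟩ := exists_forall_mode_eq_zero (T := T) hb n w
  obtain ⟨J, hJ⟩ := exists_forall_mode_eq_zero (T := T) ha m w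
  rw [bracket_eq, LinearMap.sub_apply, LinearMap.smul_apply, modeProd_apply l m a hb hI,
    modeProd_apply l n b ha hJ]
  simp [h0]

theorem isHomogeneous_nthProduct (hB : HasBinomials F T) {η : F} (hη : IsPrimitiveRoot η T)
    {r r' : ℤ} {α β : ZMod 2} {a b : ℤ → Module.End F W} (ha : IsHomogeneous η 𝒲 r α a)
    (hb : IsHomogeneous η 𝒲 r' β b) {s : F} (h : MutuallyLocal T s a b) (n : ℤ) :
    IsHomogeneous η 𝒲 (r + r') (α + β) (nthProduct T s r n a b) := by
  rw [isHomogeneous_iff hη] at ha hb ⊢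
  obtain ⟨k, hk⟩ := h.exists_bracket_eq_zero hB ha.1 hb.1
  obtain ⟨J, hJ⟩ : ∃ J : ℕ, (k : ℤ) ≤ n + J := ⟨(k - n).toNat, by omega⟩
  refine ⟨nthProduct_mem_fieldSpace hB ha.1 hb.1 h r n, fun q hq => ?_, fun q => ?_⟩
  · rw [nthProduct_eq_sum hk r n hJ, Finset.sum_apply]
    refine Finset.sum_eq_zero fun j _ => ?_
    rw [Pi.smul_apply, bracket_eq_zero_of_not_modEq ha.1 hb.1 hb.2.1, smul_zero]
    intro hq'
    exact hq (by simpa [add_comm] using hq'.add_right r)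
  · rw [nthProduct_eq_sum hk r n hJ, Finset.sum_apply]
    exact sum_mem fun j _ => Submodule.smul_mem _ _
      (bracket_mem_endParity ha.1 hb.1 ha.2.2 hb.2.2 s _ _ _)

theorem isHomogeneous_idField {η : F} (hη : IsPrimitiveRoot η T) :
    IsHomogeneous η 𝒲 0 0 (idField T : ℤ → Module.End F W) := by
  rw [isHomogeneous_iff hη]
  refine ⟨fun w => ⟨0, fun n hn => ?_⟩, fun n hn => ?_, fun n β w hw => ?_⟩
  · have : (0 : ℤ) < T := by exact_mod_cast Nat.pos_of_neZero T
    rw [idField, if_neg (by omega), LinearMap.zero_apply]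
  · rw [idField, if_neg]
    rintro rfl
    exact hn (Int.modEq_iff_dvd.mpr ⟨1, by ring⟩)
  · rw [idField]
    split_ifs
    · simpa using hw
    · simp

end Homogeneous

/-! ### Homogeneous components and the generated space -/

section Component

variable {F W : Type*} [Field F] [AddCommGroup W] [Module F W] {T : ℕ}
  {𝒲 : ZMod 2 → Submodule F W} {P : ZMod 2 → Module.End F W}

/-- `P 0` and `P 1` are the projections onto the two summands of the `ℤ/2`-graded space. -/
structure IsParityProjection (𝒲 : ZMod 2 → Submodule F W) (P : ZMod 2 → Module.End F W) :
    Prop where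
  apply_mem : ∀ β w, P β w ∈ 𝒲 β
  apply_of_mem : ∀ β γ, ∀ w ∈ 𝒲 β, P γ w = if γ = β then w else 0
  sum_eq_one : ∑ β, P β = 1

theorem exists_isParityProjection (h𝒲 : DirectSum.IsInternal 𝒲) :
    ∃ P : ZMod 2 → Module.End F W, IsParityProjection 𝒲 P := by
  classical
  let _ := h𝒲.chooseDecomposition
  refine ⟨fun β => (𝒲 β).subtype ∘ₗ DirectSum.component F (ZMod 2) (fun i => 𝒲 i) β ∘ₗ
    (DirectSum.decomposeLinearEquiv 𝒲).toLinearMap, fun β w => ?_, fun β γ w hw => ?_, ?_⟩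
  · exact SetLike.coe_mem _
  · change ((DirectSum.decompose 𝒲 w γ : 𝒲 γ) : W) = _
    split_ifs with h
    · subst h
      exact DirectSum.decompose_of_mem_same 𝒲 hw
    · exact DirectSum.decompose_of_mem_ne 𝒲 hw (Ne.symm h)
  · ext w
    rw [LinearMap.sum_apply]
    change ∑ β, ((DirectSum.decompose 𝒲 w β : 𝒲 β) : W) = w
    conv_rhs => rw [← DirectSum.sum_support_decompose 𝒲 w]
    refine (Finset.sum_subset (Finset.subset_univ _) fun β _ hβ => ?_).symm
    simpa using hβ

variable (T P) in
/-- The component of a series that is homogeneous of degrees `r` and `α`. -/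
def component (r : ℤ) (α : ZMod 2) : (ℤ → Module.End F W) →ₗ[F] (ℤ → Module.End F W) where
  toFun a := fun n => if n ≡ r [ZMOD T] then ∑ β, P (α + β) * a n * P β else 0
  map_add' a b := by
    funext n
    simp only [Pi.add_apply]
    split_ifs
    · simp [mul_add, add_mul, Finset.sum_add_distrib]
    · simp
  map_smul' c a := by
    funext n
    simp only [Pi.smul_apply, RingHom.id_apply]
    split_ifs
    · simp [Finset.smul_sum]
    · simp

theorem component_apply (r : ℤ) (α : ZMod 2) (a : ℤ → Module.End F W) (n : ℤ) :
    component T P r α a n = if n ≡ r [ZMOD T] then ∑ β, P (α + β) * a n * P β else 0 := rfl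

theorem IsParityProjection.sum_mul_mul (hP : IsParityProjection 𝒲 P) {α γ : ZMod 2}
    {f : Module.End F W} (hf : f ∈ endParity 𝒲 α) :
    ∑ β, P (γ + β) * f * P β = if γ = α then f else 0 := by
  have h : ∀ β, P (γ + β) * f * P β = if γ = α then f * P β else 0 := by
    intro β
    ext w
    have h1 := hP.apply_of_mem _ (γ + β) _ (hf β _ (hP.apply_mem β w))
    simp only [Module.End.mul_apply, h1, add_left_inj]
    split_ifs <;> simp
  simp only [h]
  split_ifs
  · rw [← Finset.mul_sum, hP.sum_eq_one, mul_one]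
  · simp

variable [NeZero T] {η : F}

theorem component_of_isHomogeneous (hP : IsParityProjection 𝒲 P) (hη : IsPrimitiveRoot η T)
    {r : ℤ} {α : ZMod 2} {a : ℤ → Module.End F W} (ha : IsHomogeneous η 𝒲 r α a) (r' : ℤ)
    (α' : ZMod 2) :
    component T P r' α' a = if r' ≡ r [ZMOD T] ∧ α' = α then a else 0 := by
  rw [isHomogeneous_iff hη] at ha
  funext n
  rw [component_apply, hP.sum_mul_mul (ha.2.2 n)]
  by_cases hn : n ≡ r [ZMOD T]
  · have : n ≡ r' [ZMOD T] ↔ r' ≡ r [ZMOD T] :=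
      ⟨fun h => h.symm.trans hn, fun h => hn.trans h.symm⟩
    by_cases h1 : r' ≡ r [ZMOD T] <;> by_cases h2 : α' = α <;> simp [this, h1, h2]
  · have h0 := ha.2.1 n hn
    split_ifs <;> simp [h0]

theorem isHomogeneous_component (hP : IsParityProjection 𝒲 P) (hη : IsPrimitiveRoot η T)
    {a : ℤ → Module.End F W} (ha : a ∈ fieldSpace F W) (r : ℤ) (α : ZMod 2) :
    IsHomogeneous η 𝒲 r α (component T P r α a) := by
  rw [isHomogeneous_iff hη]
  refine ⟨?_, fun n hn => by rw [component_apply, if_neg hn], fun n => ?_⟩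
  · rw [mem_fieldSpace_iff] at ha ⊢
    intro w
    have : ∀ᶠ n in atTop, ∀ β, a n (P β w) = 0 := eventually_all.mpr fun β => ha (P β w)
    filter_upwards [this] with n hn
    rw [component_apply]
    split_ifs
    · simp [LinearMap.sum_apply, hn]
    · rfl
  · rw [component_apply]
    split_ifs
    · refine sum_mem fun β _ γ w hw => ?_
      rw [Module.End.mul_apply, Module.End.mul_apply, hP.apply_of_mem _ _ _ hw]
      split_ifs with h
      · rw [h]; exact hP.apply_mem _ _
      · simp
    · exact zero_mem _

end Component

section Generated

variable {F W : Type*} [Field F] [AddCommGroup W] [Module F W] {T : ℕ} {η : F}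
  {𝒲 : ZMod 2 → Submodule F W} {S : Submodule F (ℤ → Module.End F W)}

theorem le_generated : S ≤ generated T η 𝒲 S := le_sInf fun _ hA => hA.1

theorem generated_le {A : Submodule F (ℤ → Module.End F W)} (hS : S ≤ A)
    (hA : IsClosedSubspace T η 𝒲 A) : generated T η 𝒲 S ≤ A := sInf_le ⟨hS, hA⟩

theorem isClosedSubspace_generated : IsClosedSubspace T η 𝒲 (generated T η 𝒲 S) where
  idField_mem := (Submodule.mem_sInf).mpr fun _ hA => hA.2.idField_mem
  nthProduct_mem a ha b hb r r' α β har hbr h n := (Submodule.mem_sInf).mpr fun A hA =>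
    hA.2.nthProduct_mem a (Submodule.mem_sInf.mp ha A hA) b (Submodule.mem_sInf.mp hb A hA)
      r r' α β har hbr h n

variable [NeZero T] {P : ZMod 2 → Module.End F W}

variable (T η 𝒲 P) in
/-- The fields all of whose homogeneous components are mutually local with all homogeneous elements
of `X`. -/
def commutant (X : Submodule F (ℤ → Module.End F W)) : Submodule F (ℤ → Module.End F W) where
  carrier := {a | a ∈ fieldSpace F W ∧ ∀ r α, ∀ b ∈ X, ∀ r' β, IsHomogeneous η 𝒲 r' β b →
    MutuallyLocal T (superSign F α β) (component T P r α a) b}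
  zero_mem' := ⟨zero_mem _, fun r α b _ r' β _ => by
    rw [map_zero]; exact mutuallyLocal_zero_left _ _⟩
  add_mem' := fun ha ha' => ⟨add_mem ha.1 ha'.1, fun r α b hb r' β hβ => by
    rw [map_add]; exact (ha.2 r α b hb r' β hβ).add_left (ha'.2 r α b hb r' β hβ)⟩
  smul_mem' := fun c a ha => ⟨Submodule.smul_mem _ c ha.1, fun r α b hb r' β hβ => by
    rw [map_smul]; exact (ha.2 r α b hb r' β hβ).smul_left c⟩

theorem mem_commutant_of_isHomogeneous (hP : IsParityProjection 𝒲 P) (hη : IsPrimitiveRoot η T)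
    {X : Submodule F (ℤ → Module.End F W)} {a : ℤ → Module.End F W} {r : ℤ} {α : ZMod 2}
    (ha : IsHomogeneous η 𝒲 r α a)
    (h : ∀ b ∈ X, ∀ r' β, IsHomogeneous η 𝒲 r' β b → MutuallyLocal T (superSign F α β) a b) :
    a ∈ commutant T η 𝒲 P X := by
  refine ⟨ha.1, fun r' α' b hb r'' β hβ => ?_⟩
  rw [component_of_isHomogeneous hP hη ha]
  split_ifs with h'
  · rw [h'.2]; exact h b hb r'' β hβ
  · exact mutuallyLocal_zero_left _ _

theorem mutuallyLocal_of_mem_commutant (hP : IsParityProjection 𝒲 P) (hη : IsPrimitiveRoot η T)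
    {X : Submodule F (ℤ → Module.End F W)} {a : ℤ → Module.End F W} {r : ℤ} {α : ZMod 2}
    (ha : IsHomogeneous η 𝒲 r α a) (h : a ∈ commutant T η 𝒲 P X) {b : ℤ → Module.End F W}
    (hb : b ∈ X) {r' : ℤ} {β : ZMod 2} (hβ : IsHomogeneous η 𝒲 r' β b) :
    MutuallyLocal T (superSign F α β) a b := by
  have := h.2 r α b hb r' β hβ
  rwa [component_of_isHomogeneous hP hη ha, if_pos ⟨rfl, rfl⟩] at this

/-- By Dong's lemma, the commutant of any space is closed. -/
theorem isClosedSubspace_commutant (hB : HasBinomials F T) (hP : IsParityProjection 𝒲 P)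
    (hη : IsPrimitiveRoot η T) (X : Submodule F (ℤ → Module.End F W)) :
    IsClosedSubspace T η 𝒲 (commutant T η 𝒲 P X) where
  idField_mem := mem_commutant_of_isHomogeneous hP hη (isHomogeneous_idField hη) fun b _ _ β _ => by
    rw [superSign_zero_left]; exact mutuallyLocal_idField b
  nthProduct_mem a ha b hb r r' α β har hbr h n :=
    mem_commutant_of_isHomogeneous hP hη (isHomogeneous_nthProduct hB hη har hbr h n)
      fun c hc r'' γ hγ => by
        rw [superSign_add_left]
        exact h.nthProduct_left hB har.1 hbr.1
          (mutuallyLocal_of_mem_commutant hP hη har ha hc hγ)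
          (mutuallyLocal_of_mem_commutant hP hη hbr hb hc hγ) r n

/-- The space generated by a local subspace is local: it lies in the commutant of `S`, so `S` lies
in the commutant of `⟨S⟩`, so `⟨S⟩` lies in its own commutant. -/
theorem isLocalSubspace_generated (hB : HasBinomials F T) (h𝒲 : DirectSum.IsInternal 𝒲)
    (hη : IsPrimitiveRoot η T) (hS : IsLocalSubspace T η 𝒲 S) :
    IsLocalSubspace T η 𝒲 (generated T η 𝒲 S) := by
  obtain ⟨P, hP⟩ := exists_isParityProjection h𝒲
  have h1 : S ≤ commutant T η 𝒲 P S := by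
    rw [← hS.span_homogeneous, Submodule.span_le]
    rintro a ⟨ha, r, α, har⟩
    rw [hS.span_homogeneous]
    exact mem_commutant_of_isHomogeneous hP hη har fun b hb r' β hβ =>
      hS.mutuallyLocal a ha b hb r r' α β har hβ
  have h2 := generated_le h1 (isClosedSubspace_commutant hB hP hη S)
  have h3 : S ≤ commutant T η 𝒲 P (generated T η 𝒲 S) := by
    conv_lhs => rw [← hS.span_homogeneous]
    rw [Submodule.span_le]
    rintro a ⟨ha, r, α, har⟩
    refine mem_commutant_of_isHomogeneous hP hη har fun b hb r' β hβ => ?_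
    have := mutuallyLocal_of_mem_commutant hP hη hβ (h2 hb) ha har
    rw [superSign_comm]
    exact this.symm hB (superSign_mul_self _ _) hβ.1 har.1
  have h4 := generated_le h3 (isClosedSubspace_commutant hB hP hη (generated T η 𝒲 S))
  refine ⟨fun a ha => (h4 ha).1, le_antisymm (Submodule.span_le.mpr fun a ha => ha.1) ?_,
    fun a ha b hb r r' α β har hβ => mutuallyLocal_of_mem_commutant hP hη har (h4 ha) hb hβ⟩
  -- the span of the homogeneous elements of `⟨S⟩` is closed
  set G := generated T η 𝒲 S with hG
  have hle : Submodule.span F {a | a ∈ G ∧ ∃ r α, IsHomogeneous η 𝒲 r α a} ≤ G :=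
    Submodule.span_le.mpr fun a ha => ha.1
  have hcl : IsClosedSubspace T η 𝒲 G := isClosedSubspace_generated
  refine generated_le ?_ ⟨?_, fun a ha b hb r r' α β har hbr h n => ?_⟩
  · conv_lhs => rw [← hS.span_homogeneous]
    exact Submodule.span_mono fun a ha => ⟨le_generated ha.1, ha.2⟩
  · exact Submodule.subset_span ⟨hcl.idField_mem, 0, 0, isHomogeneous_idField hη⟩
  · exact Submodule.subset_span ⟨hcl.nthProduct_mem a (hle ha) b (hle hb) r r' α β har hbr h n,
      _, _, isHomogeneous_nthProduct hB hη har hbr h n⟩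

end Generated

/-! ### Left and right multiplication and the locality of the products -/

section Commutator

variable {F V : Type*} [Field F] [AddCommGroup V] [Module F V]

/-- If left operators `L` commute with right operators `R`, then the mixed terms in a
supercommutator of operators of the form `L - s R` cancel. -/
theorem superCommutator_left_sub_right {t t' La Lb Ra Rb : Module.End F V} {p q s s₁ s₂ : F}
    (hs : s * s = 1) (htt : ∀ v, t' (t v) = t (t' v)) (hLat : ∀ v, La (t' v) = t' (La v))
    (hLbt : ∀ v, Lb (t v) = t (Lb v)) (hRat : ∀ v, Ra (t' v) = t' (Ra v))
    (hRbt : ∀ v, Rb (t v) = t (Rb v)) (hab : ∀ v, La (Rb v) = Rb (La v))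
    (hba : ∀ v, Lb (Ra v) = Ra (Lb v)) (v : V) :
    p • t (La (q • t' (Lb v - s₂ • Rb v)) - (s * s₁) • Ra (q • t' (Lb v - s₂ • Rb v))) -
      s • q • t' (Lb (p • t (La v - s₁ • Ra v)) - (s * s₂) • Rb (p • t (La v - s₁ • Ra v))) =
    (p * q) • t (t' (((1 : F) • La (Lb v) + (-s) • Lb (La v)) +
      ((s * s₁ * s₂) • Ra (Rb v) + (-(s₁ * s₂)) • Rb (Ra v)))) := by
  simp only [map_smul, map_sub, map_add, hLat, hLbt, hRat, hRbt, hab, hba, htt]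
  match_scalars
  · ring
  · linear_combination (p * q * s₂) * hs
  · ring
  · ring
  · ring
  · linear_combination (-(p * q * s₁ * s₂)) * hs

/-- If the supercommutators of two families of left operators and of two families of right operators
are annihilated by an operator `D`, so are the combinations that occur in a supercommutator. -/
theorem apply_add_smul_eq_zero {A : Type*} {D : Module.End F (A → V)} {f g : A → V} {s : F}
    (h : D (fun x => f x - s • g x) = 0) (c : F) :
    D (fun x => c • f x + (-(c * s)) • g x) = 0 := by
  have : (fun x => c • f x + (-(c * s)) • g x) = c • fun x => f x - s • g x := by
    funext x
    simp only [Pi.smul_apply]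
    module
  rw [this, map_smul, h, smul_zero]

end Commutator

section LeftRight

variable {F W : Type*} [Field F] [AddCommGroup W] [Module F W] {T : ℕ}

/-- Multiplication of a field by `x^{-d/T}`, which translates its modes. -/
def translate (d : ℤ) : Module.End F (fieldSpace F W) where
  toFun v := ⟨fun n => v.1 (n - d), comp_sub_mem_fieldSpace v.2 d⟩
  map_add' _ _ := rfl
  map_smul' _ _ := rfl

/-- Raising `l` by one in `op a l m` multiplies by `x₁ - x`, where multiplication by `x` commutes
with all operators. So the difference of the shifts of the two exponents `l` is the difference of
the shifts of the two modes, and locality in the modes becomes locality in the exponents. -/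
theorem shift_pow_sideOp (op : fieldSpace F W → ℤ → ℤ → Module.End F (fieldSpace F W))
    (hsucc : ∀ a l m, op a (l + 1) m = op a l (m + T) - translate (-T) * op a l m)
    (hcomm : ∀ d a l m, Commute (translate d) (op a l m)) (a b v : fieldSpace F W) {c d : F} {k : ℕ}
    (h : ∀ l l', ((shift ((T : ℤ), (0 : ℤ)) - shift (0, (T : ℤ)) :
        Module.End F (ℤ × ℤ → fieldSpace F W)) ^ k)
      (fun x => c • op a l x.1 (op b l' x.2 v) + d • op b l' x.2 (op a l x.1 v)) = 0)
    (l m l' m' : ℤ) :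
    ((shift ((1 : ℤ), (0 : ℤ)) - shift (0, (1 : ℤ)) :
        Module.End F (ℤ × ℤ → fieldSpace F W)) ^ k)
      (fun y => c • op a (y.1 + l) m (op b (y.2 + l') m' v) +
        d • op b (y.2 + l') m' (op a (y.1 + l) m v)) = 0 := by
  set f : ℤ × ℤ × ℤ × ℤ → fieldSpace F W := fun y =>
    c • op a y.1 y.2.2.1 (op b y.2.1 y.2.2.2 v) +
      d • op b y.2.1 y.2.2.2 (op a y.1 y.2.2.1 v) with hf
  have hstep : (shift ((1 : ℤ), (0 : ℤ), (0 : ℤ), (0 : ℤ)) - shift (0, (1 : ℤ), 0, 0) :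
        Module.End F (ℤ × ℤ × ℤ × ℤ → fieldSpace F W)) f =
      (shift ((0 : ℤ), (0 : ℤ), (T : ℤ), (0 : ℤ)) - shift (0, 0, 0, (T : ℤ)) :
        Module.End F (ℤ × ℤ × ℤ × ℤ → fieldSpace F W)) f := by
    funext y
    have h1 : ∀ a l m u, translate (-T) (op a l m u) = op a l m (translate (-T) u) :=
      fun a l m u => congrArg (· u) (hcomm (-T) a l m).eq
    simp only [LinearMap.sub_apply, Pi.sub_apply, shift_apply, hf, Prod.fst_add, Prod.snd_add,
      add_zero, hsucc, Module.End.mul_apply, map_sub, h1]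
    module
  have h4 := pow_apply_eq_of_commute (shift_sub_commute _ _ _ _) hstep k
  have h5 := shift_sub_pow_comp (F := F) (fun y : ℤ × ℤ => (y.1 + l, y.2 + l', m, m'))
    (v := ((1 : ℤ), (0 : ℤ))) (w := (0, (1 : ℤ))) (v' := ((1 : ℤ), (0 : ℤ), (0 : ℤ), (0 : ℤ)))
    (w' := (0, (1 : ℤ), 0, 0)) (by simp [add_right_comm]) (by simp [add_right_comm]) k f
  refine h5.trans (funext fun y => ?_)
  rw [h4]
  have h6 := shift_sub_pow_comp (F := F) (fun x : ℤ × ℤ => (y.1 + l, y.2 + l', x.1, x.2))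
    (v := ((T : ℤ), (0 : ℤ))) (w := (0, (T : ℤ))) (v' := ((0 : ℤ), (0 : ℤ), (T : ℤ), (0 : ℤ)))
    (w' := (0, 0, 0, (T : ℤ))) (by simp) (by simp) k f
  exact (congrFun h6 (m, m')).symm.trans (congrFun (h (y.1 + l) (y.2 + l')) (m, m'))

theorem translate_translate (d e : ℤ) (v : fieldSpace F W) :
    translate d (translate e v) = translate (d + e) v :=
  Subtype.ext <| funext fun n => congrArg v.1 (sub_sub n d e)

variable [NeZero T]

variable (T) in
/-- The operator `v(x) ↦ Res_{x₁} x₁^{m/T} (x₁-x)^l a(x₁) v(x)`. -/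
def leftOp (a : fieldSpace F W) (l m : ℤ) : Module.End F (fieldSpace F W) where
  toFun v := ⟨fun n => modeProd T l m n a.1 v.1, modeProd_mem_fieldSpace_right l m a.1 v.2⟩
  map_add' v v' := Subtype.ext <| funext fun n => (modeProdHom T l m n a).map_add v v'
  map_smul' c v := Subtype.ext <| funext fun n => (modeProdHom T l m n a).map_smul c v

variable (T) in
/-- The operator `v(x) ↦ Res_{x₁} x₁^{m/T} (-x+x₁)^l v(x) a(x₁)`. -/
def rightOp (a : fieldSpace F W) (l m : ℤ) : Module.End F (fieldSpace F W) where
  toFun v := ⟨fun n => (-1 : F) ^ l • modeProd T l n m v.1 a.1,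
    Submodule.smul_mem _ ((-1 : F) ^ l) (modeProd_mem_fieldSpace_left l m v.2 a.2)⟩
  map_add' v v' := Subtype.ext <| funext fun n => by
    have := congrArg (· a) ((modeProdHom T l n m).map_add v v')
    simp only [modeProdHom_apply, LinearMap.add_apply] at this
    simp only [this, smul_add]
    rfl
  map_smul' c v := Subtype.ext <| funext fun n => by
    have := congrArg (· a) ((modeProdHom T l n m).map_smul c v)
    simp only [modeProdHom_apply, LinearMap.smul_apply] at this
    simp only [this, RingHom.id_apply, smul_comm _ c]
    rfl

theorem rightOp_apply (a v : fieldSpace F W) (l m n : ℤ) :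
    (rightOp T a l m v).1 n = (-1 : F) ^ l • modeProd T l n m v.1 a.1 := rfl

theorem leftOp_apply_apply (a v : fieldSpace F W) (l m : ℤ) {n : ℤ} {w : W} {I : ℕ}
    (hI : ∀ i, I ≤ i → v.1 (n + T * i) w = 0) :
    (leftOp T a l m v).1 n w = ∑ i ∈ Finset.range I,
      ((-1) ^ i * fbinom F 1 l i) • a.1 (m + T * (l - i)) (v.1 (n + T * i) w) :=
  modeProd_apply l m a.1 v.2 hI

theorem rightOp_apply_apply (a v : fieldSpace F W) (l n : ℤ) {m : ℤ} {w : W} {I : ℕ}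
    (hI : ∀ i, I ≤ i → a.1 (m + T * i) w = 0) :
    (rightOp T a l m v).1 n w = ∑ i ∈ Finset.range I,
      ((-1) ^ l * ((-1) ^ i * fbinom F 1 l i)) • v.1 (n + T * (l - i)) (a.1 (m + T * i) w) := by
  rw [rightOp_apply, LinearMap.smul_apply, modeProd_apply l n v.1 a.2 hI, Finset.smul_sum]
  simp only [smul_smul]

theorem leftOp_succ (hB : HasBinomials F T) (a : fieldSpace F W) (l m : ℤ) :
    leftOp T a (l + 1) m = leftOp T a l (m + T) - translate (-T) * leftOp T a l m := by
  refine LinearMap.ext fun v => Subtype.ext <| funext fun n => ?_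
  change modeProd T (l + 1) m n a.1 v.1 =
    modeProd T l (m + T) n a.1 v.1 - modeProd T l m (n - -T) a.1 v.1
  rw [modeProd_succ hB l m n a.1 v.2, sub_neg_eq_add]

theorem rightOp_succ (hB : HasBinomials F T) (a : fieldSpace F W) (l m : ℤ) :
    rightOp T a (l + 1) m = rightOp T a l (m + T) - translate (-T) * rightOp T a l m := by
  refine LinearMap.ext fun v => Subtype.ext <| funext fun n => ?_
  change (-1 : F) ^ (l + 1) • modeProd T (l + 1) n m v.1 a.1 =
    (-1 : F) ^ l • modeProd T l n (m + T) v.1 a.1 - (-1 : F) ^ l • modeProd T l (n - -T) m v.1 a.1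
  rw [modeProd_succ hB l n m v.1 a.2, sub_neg_eq_add,
    zpow_add_one₀ (neg_ne_zero.mpr one_ne_zero)]
  module

theorem translate_commute_leftOp (d : ℤ) (a : fieldSpace F W) (l m : ℤ) :
    Commute (translate d) (leftOp T a l m) := by
  refine LinearMap.ext fun v => Subtype.ext <| funext fun n => LinearMap.ext fun w => ?_
  obtain ⟨I, hI⟩ := exists_forall_mode_eq_zero (T := T) v.2 (n - d) w
  have h1 := leftOp_apply_apply a v l m hI
  have hI' : ∀ i, I ≤ i → (translate d v).1 (n + T * i) w = 0 := fun i hi => by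
    change v.1 (n + T * i - d) w = 0
    rw [add_sub_right_comm]; exact hI i hi
  have h2 := leftOp_apply_apply a (translate d v) l m hI'
  refine h1.trans (Eq.trans ?_ h2.symm)
  refine Finset.sum_congr rfl fun i _ => ?_
  change _ = _ • a.1 _ (v.1 (n + T * i - d) w)
  rw [add_sub_right_comm]

theorem translate_commute_rightOp (d : ℤ) (a : fieldSpace F W) (l m : ℤ) :
    Commute (translate d) (rightOp T a l m) := by
  refine LinearMap.ext fun v => Subtype.ext <| funext fun n => LinearMap.ext fun w => ?_
  obtain ⟨I, hI⟩ := exists_forall_mode_eq_zero (T := T) a.2 m w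
  refine (rightOp_apply_apply a v l (n - d) hI).trans
    (Eq.trans ?_ (rightOp_apply_apply a (translate d v) l n hI).symm)
  refine Finset.sum_congr rfl fun i _ => ?_
  change _ = _ • v.1 (n + T * (l - i) - d) _
  rw [add_sub_right_comm]

theorem leftOp_commute_rightOp (a b : fieldSpace F W) (l m l' m' : ℤ) :
    Commute (leftOp T a l m) (rightOp T b l' m') := by
  refine LinearMap.ext fun v => Subtype.ext <| funext fun n => LinearMap.ext fun w => ?_
  change (leftOp T a l m (rightOp T b l' m' v)).1 n w = (rightOp T b l' m' (leftOp T a l m v)).1 n w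
  obtain ⟨J, hJ⟩ := exists_forall_mode_eq_zero (T := T) b.2 m' w
  obtain ⟨I, hI⟩ : ∃ I : ℕ, ∀ i, I ≤ i → ∀ j ∈ Finset.range J,
      v.1 (n + T * i + T * (l' - j)) (b.1 (m' + T * j) w) = 0 := by
    have : ∀ᶠ i : ℕ in atTop, ∀ j ∈ Finset.range J,
        v.1 (n + T * i + T * (l' - j)) (b.1 (m' + T * j) w) = 0 := by
      rw [Filter.eventually_all_finset]
      intro j _
      obtain ⟨I, hI⟩ := exists_forall_mode_eq_zero (T := T) v.2 (n + T * (l' - j))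
        (b.1 (m' + T * j) w)
      refine eventually_atTop.mpr ⟨I, fun i hi => ?_⟩
      rw [add_right_comm]; exact hI i hi
    exact eventually_atTop.mp this
  rw [rightOp_apply_apply b _ l' n hJ, leftOp_apply_apply a _ l m (I := I) fun i hi => by
    rw [rightOp_apply_apply b v l' _ hJ]
    exact Finset.sum_eq_zero fun j hj => by rw [hI i hi j hj, smul_zero]]
  have h1 : ∀ j ∈ Finset.range J, (leftOp T a l m v).1 (n + T * (l' - j)) (b.1 (m' + T * j) w) =
      ∑ i ∈ Finset.range I, ((-1) ^ i * fbinom F 1 l i) • a.1 (m + T * (l - i))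
        (v.1 (n + T * i + T * (l' - j)) (b.1 (m' + T * j) w)) := by
    intro j hj
    rw [leftOp_apply_apply a v l m (I := I) fun i hi => by
      rw [add_right_comm]; exact hI i hi j hj]
    exact Finset.sum_congr rfl fun i _ => by rw [add_right_comm]
  simp only [rightOp_apply_apply b v l' _ hJ, map_sum, map_smul, Finset.smul_sum]
  rw [Finset.sum_comm]
  refine Finset.sum_congr rfl fun j hj => ?_
  rw [h1 j hj, Finset.smul_sum]
  exact Finset.sum_congr rfl fun i _ => smul_comm _ _ _

variable (F) in
/-- The value at `w` of the `n`-th mode of a field. -/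
def evalMode (n : ℤ) (w : W) : fieldSpace F W →ₗ[F] W :=
  LinearMap.applyₗ w ∘ₗ LinearMap.proj n ∘ₗ (fieldSpace F W).subtype

theorem fieldSpace_ext {v v' : fieldSpace F W} (h : ∀ n w, evalMode F n w v = evalMode F n w v') :
    v = v' := Subtype.ext <| funext fun n => LinearMap.ext fun w => h n w

/-- The left operators of mutually local fields satisfy the same locality relation. -/
theorem shift_pow_leftOp (a b v : fieldSpace F W) {s : F} {k : ℕ}
    (h : ((shift ((T : ℤ), (0 : ℤ)) - shift (0, (T : ℤ)) :
        Module.End F (ℤ × ℤ → Module.End F W)) ^ k)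
      (fun x => a.1 x.1 * b.1 x.2 - s • (b.1 x.2 * a.1 x.1)) = 0) (l l' : ℤ) :
    ((shift ((T : ℤ), (0 : ℤ)) - shift (0, (T : ℤ)) :
        Module.End F (ℤ × ℤ → fieldSpace F W)) ^ k)
      (fun x => leftOp T a l x.1 (leftOp T b l' x.2 v) -
        s • (leftOp T b l' x.2 (leftOp T a l x.1 v))) = 0 := by
  funext x
  refine fieldSpace_ext fun n w => ?_
  obtain ⟨I, hI⟩ := exists_forall_mode_eq_zero (T := T) v.2 n w
  have hI' : ∀ i j : ℕ, I ≤ i + j → v.1 (n + T * i + T * j) w = 0 := fun i j hj => by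
    have := hI (i + j) hj
    push_cast at this
    rwa [mul_add, ← add_assoc] at this
  have hdouble : ∀ (c d : fieldSpace F W) (l m l' m' : ℤ),
      evalMode F n w (leftOp T c l m (leftOp T d l' m' v)) =
      ∑ i ∈ Finset.range I, ∑ j ∈ Finset.range I,
        (((-1) ^ i * fbinom F 1 l i) * ((-1) ^ j * fbinom F 1 l' j)) •
          c.1 (m + T * (l - i)) (d.1 (m' + T * (l' - j)) (v.1 (n + T * i + T * j) w)) := by
    intro c d l m l' m'
    have hcut : ∀ i : ℕ, (leftOp T d l' m' v).1 (n + T * i) w =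
        ∑ j ∈ Finset.range I, ((-1) ^ j * fbinom F 1 l' j) • d.1 (m' + T * (l' - j))
          (v.1 (n + T * i + T * j) w) := fun i =>
      leftOp_apply_apply d v l' m' fun j hj => hI' i j (by omega)
    refine (leftOp_apply_apply c _ l m (I := I) fun i hi => ?_).trans ?_
    · rw [hcut]
      exact Finset.sum_eq_zero fun j _ => by rw [hI' i j (by omega), map_zero, smul_zero]
    · simp only [hcut, map_sum, map_smul, Finset.smul_sum, smul_smul]
  have hval : ∀ y : ℤ × ℤ, evalMode F n w (leftOp T a l y.1 (leftOp T b l' y.2 v) -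
        s • (leftOp T b l' y.2 (leftOp T a l y.1 v))) =
      ∑ i ∈ Finset.range I, ∑ j ∈ Finset.range I,
        (((-1) ^ i * fbinom F 1 l i) * ((-1) ^ j * fbinom F 1 l' j)) •
          ((fun x => a.1 x.1 * b.1 x.2 - s • (b.1 x.2 * a.1 x.1))
            (y + (T * (l - i), T * (l' - j)))) (v.1 (n + T * i + T * j) w) := by
    intro y
    rw [map_sub, map_smul, hdouble, hdouble, Finset.sum_comm (f := fun i j => _ • b.1 _ _),
      Finset.smul_sum, ← Finset.sum_sub_distrib]
    refine Finset.sum_congr rfl fun i _ => ?_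
    rw [Finset.smul_sum, ← Finset.sum_sub_distrib]
    refine Finset.sum_congr rfl fun j _ => ?_
    simp only [Prod.fst_add, Prod.snd_add, LinearMap.sub_apply, LinearMap.smul_apply,
      Module.End.mul_apply, smul_sub]
    rw [smul_comm s, mul_comm ((-1 : F) ^ j * _), add_right_comm n]
  rw [shift_sub_pow_apply, map_sum, Pi.zero_apply, map_zero]
  simp only [map_smul, hval, Finset.smul_sum]
  rw [Finset.sum_comm]
  refine Finset.sum_eq_zero fun i _ => ?_
  rw [Finset.sum_comm]
  refine Finset.sum_eq_zero fun j _ => ?_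
  have h1 := congrArg (fun f : Module.End F W => f (v.1 (n + T * i + T * j) w))
    (congrFun h (x + (T * (l - i), T * (l' - j))))
  rw [shift_sub_pow_apply] at h1
  simp only [LinearMap.sum_apply, LinearMap.smul_apply, Pi.zero_apply, LinearMap.zero_apply] at h1
  have h2 := congrArg ((((-1) ^ i * fbinom F 1 l i) * ((-1) ^ j * fbinom F 1 l' j)) • ·) h1
  rw [smul_zero, Finset.smul_sum] at h2
  rw [← h2]
  refine Finset.sum_congr rfl fun t _ => ?_
  rw [smul_comm, add_right_comm (x + _), add_right_comm x]

/-- The right operators of mutually local fields satisfy the same locality relation, up to the order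
of multiplication. -/
theorem shift_pow_rightOp (a b v : fieldSpace F W) {s : F} {k : ℕ}
    (h : ((shift ((T : ℤ), (0 : ℤ)) - shift (0, (T : ℤ)) :
        Module.End F (ℤ × ℤ → Module.End F W)) ^ k)
      (fun x => a.1 x.1 * b.1 x.2 - s • (b.1 x.2 * a.1 x.1)) = 0) (l l' : ℤ) :
    ((shift ((T : ℤ), (0 : ℤ)) - shift (0, (T : ℤ)) :
        Module.End F (ℤ × ℤ → fieldSpace F W)) ^ k)
      (fun x => rightOp T b l' x.2 (rightOp T a l x.1 v) -
        s • (rightOp T a l x.1 (rightOp T b l' x.2 v))) = 0 := by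
  funext x
  refine fieldSpace_ext fun n w => ?_
  -- beyond `K`, all products of the modes that occur vanish on `w`
  have hK : ∀ (c d : fieldSpace F W) (m m' : ℤ), ∃ K : ℕ, ∀ i j : ℕ, K ≤ i ∨ K ≤ j →
      c.1 (m + T * i) (d.1 (m' + T * j) w) = 0 := by
    intro c d m m'
    obtain ⟨J, hJ⟩ := exists_forall_mode_eq_zero (T := T) d.2 m' w
    have : ∀ᶠ i : ℕ in atTop, ∀ j ∈ Finset.range J, c.1 (m + T * i) (d.1 (m' + T * j) w) = 0 := by
      rw [Filter.eventually_all_finset]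
      exact fun j _ => eventually_atTop.mpr (exists_forall_mode_eq_zero (T := T) c.2 m _)
    obtain ⟨I, hI⟩ := eventually_atTop.mp this
    refine ⟨max I J, fun i j hij => ?_⟩
    by_cases hj : j < J
    · exact hI i (by omega) j (by simpa using hj)
    · rw [hJ j (by omega), map_zero]
  obtain ⟨K₁, hK₁⟩ := hK a b x.1 x.2
  obtain ⟨K₂, hK₂⟩ := hK b a x.2 x.1
  obtain ⟨K, hKK₁, hKK₂⟩ : ∃ K, K₁ ≤ K ∧ K₂ ≤ K := ⟨max K₁ K₂, le_max_left _ _, le_max_right _ _⟩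
  have hdouble : ∀ (c d : fieldSpace F W) (l m l' m' : ℤ),
      (∀ i j : ℕ, K ≤ i ∨ K ≤ j → c.1 (m + T * i) (d.1 (m' + T * j) w) = 0) →
      evalMode F n w (rightOp T d l' m' (rightOp T c l m v)) =
      ∑ j ∈ Finset.range K, ∑ i ∈ Finset.range K,
        (((-1) ^ l' * ((-1) ^ j * fbinom F 1 l' j)) * ((-1) ^ l * ((-1) ^ i * fbinom F 1 l i))) •
          v.1 (n + T * (l' - j) + T * (l - i)) (c.1 (m + T * i) (d.1 (m' + T * j) w)) := by
    intro c d l m l' m' hz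
    obtain ⟨J, hJ⟩ := exists_forall_mode_eq_zero (T := T) d.2 m' w
    have h0 : ∀ j : ℕ, (rightOp T c l m v).1 (n + T * (l' - j)) (d.1 (m' + T * j) w) =
        ∑ i ∈ Finset.range K, ((-1) ^ l * ((-1) ^ i * fbinom F 1 l i)) •
          v.1 (n + T * (l' - j) + T * (l - i)) (c.1 (m + T * i) (d.1 (m' + T * j) w)) := fun j =>
      rightOp_apply_apply c v l _ fun i hi => hz i j (Or.inl hi)
    refine (rightOp_apply_apply d _ l' n (I := max J K) fun j hj => hJ j (by omega)).trans ?_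
    simp only [h0, Finset.smul_sum, smul_smul]
    refine (Finset.sum_subset (Finset.range_mono (le_max_right J K)) fun j _ hj => ?_).symm
    exact Finset.sum_eq_zero fun i _ => by
      rw [hz i j (Or.inr (by simpa using hj)), map_zero, smul_zero]
  have hval : ∀ t t' : ℕ, evalMode F n w
        ((fun x : ℤ × ℤ => rightOp T b l' x.2 (rightOp T a l x.1 v) -
          s • (rightOp T a l x.1 (rightOp T b l' x.2 v)))
        (x + t • ((T : ℤ), (0 : ℤ)) + t' • ((0 : ℤ), (T : ℤ)))) =
      ∑ j ∈ Finset.range K, ∑ i ∈ Finset.range K,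
        (((-1) ^ l' * ((-1) ^ j * fbinom F 1 l' j)) * ((-1) ^ l * ((-1) ^ i * fbinom F 1 l i))) •
          v.1 (n + T * (l' - j) + T * (l - i)) (((fun x => a.1 x.1 * b.1 x.2 -
            s • (b.1 x.2 * a.1 x.1)) (x + (T * (i : ℤ), T * (j : ℤ)) + t • ((T : ℤ), (0 : ℤ)) +
              t' • ((0 : ℤ), (T : ℤ)))) w) := by
    intro t t'
    have e : ∀ (m : ℤ) (t i : ℕ), m + t * T + T * i = m + T * ((t + i : ℕ) : ℤ) := fun m t i => by
      push_cast; ring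
    simp only [Prod.fst_add, Prod.snd_add, Prod.smul_fst, Prod.smul_snd, smul_zero, add_zero]
    simp only [nsmul_eq_mul]
    rw [map_sub, map_smul, hdouble a b, hdouble b a, Finset.sum_comm (f := fun i j => _ • v.1 _
      (b.1 _ _)), Finset.smul_sum, ← Finset.sum_sub_distrib]
    · refine Finset.sum_congr rfl fun j _ => ?_
      rw [Finset.smul_sum, ← Finset.sum_sub_distrib]
      refine Finset.sum_congr rfl fun i _ => ?_
      simp only [LinearMap.sub_apply, LinearMap.smul_apply, Module.End.mul_apply, smul_sub, map_sub,
        map_smul]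
      rw [smul_comm s, mul_comm ((-1 : F) ^ l * _), add_right_comm n, add_right_comm x.1,
        add_right_comm x.2]
    · intro i j hij
      rw [e, e]
      exact hK₂ _ _ (by omega)
    · intro i j hij
      rw [e, e]
      exact hK₁ _ _ (by omega)
  rw [shift_sub_pow_apply, map_sum, Pi.zero_apply, map_zero]
  simp only [map_smul, hval, Finset.smul_sum]
  rw [Finset.sum_comm]
  refine Finset.sum_eq_zero fun j _ => ?_
  rw [Finset.sum_comm]
  refine Finset.sum_eq_zero fun i _ => ?_
  set c : F := ((-1) ^ l' * ((-1) ^ j * fbinom F 1 l' j)) * ((-1) ^ l * ((-1) ^ i * fbinom F 1 l i))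
  have h1 := congrArg (fun f : Module.End F W => c • v.1 (n + T * (l' - j) + T * (l - i)) (f w))
    (congrFun h (x + (T * (i : ℤ), T * (j : ℤ))))
  rw [shift_sub_pow_apply] at h1
  simp only [LinearMap.sum_apply, LinearMap.smul_apply, Pi.zero_apply, LinearMap.zero_apply,
    map_sum, map_smul, map_zero, smul_zero, Finset.smul_sum] at h1
  rw [← h1]
  exact Finset.sum_congr rfl fun t _ => smul_comm _ _ _

variable (T) in
/-- The operator `v(x) ↦ a(x)_n v(x)`, with the expansion of `(x₁-x₀)^{r/T}` cut off after `J`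
terms. Only after this truncation do the left and right multiplications by `a` make sense
separately. -/
def truncProduct (s : F) (r : ℤ) (J : ℕ) (n : ℤ) (a : fieldSpace F W) :
    Module.End F (fieldSpace F W) :=
  ∑ j ∈ Finset.range J, ((-1) ^ j * fbinom F T r j) •
    (translate r * (leftOp T a (n + j) (r - T * j) - s • rightOp T a (n + j) (r - T * j)))

theorem truncProduct_apply (s : F) (r : ℤ) (J : ℕ) (n : ℤ) (a v : fieldSpace F W) :
    truncProduct T s r J n a v = ∑ j ∈ Finset.range J, ((-1) ^ j * fbinom F T r j) •
      translate r (leftOp T a (n + j) (r - T * j) v - s • rightOp T a (n + j) (r - T * j) v) := by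
  rw [truncProduct, LinearMap.sum_apply]
  rfl

theorem eventually_nthProduct_eq (hB : HasBinomials F T) {s : F} {a v : fieldSpace F W}
    (h : MutuallyLocal T s a.1 v.1) (r n : ℤ) :
    ∀ᶠ J in atTop, nthProduct T s r n a.1 v.1 = (truncProduct T s r J n a v).1 := by
  obtain ⟨k, hk⟩ := h.exists_bracket_eq_zero hB a.2 v.2
  refine eventually_atTop.mpr ⟨(k - n).toNat, fun J hJ => ?_⟩
  rw [nthProduct_eq_sum hk r n (J := J) (by omega), truncProduct_apply, Submodule.coe_sum]
  refine Finset.sum_congr rfl fun j _ => ?_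
  rw [Submodule.coe_smul]
  congr 1
  funext q
  rw [bracket_eq, mul_smul]
  rfl

theorem leftOp_translate (d l m : ℤ) (a v : fieldSpace F W) :
    leftOp T a l m (translate d v) = translate d (leftOp T a l m v) := by
  have h := LinearMap.congr_fun (translate_commute_leftOp (T := T) d a l m).eq v
  rw [Module.End.mul_apply, Module.End.mul_apply] at h
  exact h.symm

theorem rightOp_translate (d l m : ℤ) (a v : fieldSpace F W) :
    rightOp T a l m (translate d v) = translate d (rightOp T a l m v) := by
  have h := LinearMap.congr_fun (translate_commute_rightOp (T := T) d a l m).eq v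
  rw [Module.End.mul_apply, Module.End.mul_apply] at h
  exact h.symm

theorem leftOp_rightOp (a b v : fieldSpace F W) (l m l' m' : ℤ) :
    leftOp T a l m (rightOp T b l' m' v) = rightOp T b l' m' (leftOp T a l m v) := by
  have h := LinearMap.congr_fun (leftOp_commute_rightOp (T := T) a b l m l' m').eq v
  rw [Module.End.mul_apply, Module.End.mul_apply] at h
  exact h

theorem truncProduct_truncProduct (σ σ' : F) (r r' : ℤ) (J : ℕ) (n n' : ℤ)
    (a b v : fieldSpace F W) :
    truncProduct T σ r J n a (truncProduct T σ' r' J n' b v) =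
      ∑ j ∈ Finset.range J, ∑ j' ∈ Finset.range J, ((-1) ^ j * fbinom F T r j) •
        translate r (leftOp T a (n + j) (r - T * j) (((-1) ^ j' * fbinom F T r' j') •
          translate r' (leftOp T b (n' + j') (r' - T * j') v -
            σ' • rightOp T b (n' + j') (r' - T * j') v)) -
          σ • rightOp T a (n + j) (r - T * j) (((-1) ^ j' * fbinom F T r' j') •
            translate r' (leftOp T b (n' + j') (r' - T * j') v -
              σ' • rightOp T b (n' + j') (r' - T * j') v))) := by
  rw [truncProduct_apply, truncProduct_apply]
  refine Finset.sum_congr rfl fun j _ => ?_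
  rw [map_sum, map_sum, Finset.smul_sum, ← Finset.sum_sub_distrib, map_sum, Finset.smul_sum]

/-- In the supercommutator of two truncated products, the terms with one left and one right
multiplication cancel. -/
theorem truncProduct_superCommutator (a b c : fieldSpace F W) {s s₁ s₂ : F} (hs : s * s = 1)
    (r r' : ℤ) (J : ℕ) (n n' : ℤ) :
    truncProduct T (s * s₁) r J n a (truncProduct T s₂ r' J n' b c) -
        s • truncProduct T (s * s₂) r' J n' b (truncProduct T s₁ r J n a c) =
      ∑ j ∈ Finset.range J, ∑ j' ∈ Finset.range J,
        (((-1) ^ j * fbinom F T r j) * ((-1) ^ j' * fbinom F T r' j')) • translate (r + r')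
          (((1 : F) • leftOp T a (n + j) (r - T * j) (leftOp T b (n' + j') (r' - T * j') c) +
            (-s) • leftOp T b (n' + j') (r' - T * j') (leftOp T a (n + j) (r - T * j) c)) +
          ((s * s₁ * s₂) • rightOp T a (n + j) (r - T * j)
              (rightOp T b (n' + j') (r' - T * j') c) +
            (-(s₁ * s₂)) • rightOp T b (n' + j') (r' - T * j')
              (rightOp T a (n + j) (r - T * j) c))) := by
  rw [truncProduct_truncProduct, truncProduct_truncProduct]
  rw [Finset.sum_comm (s := Finset.range J) (t := Finset.range J)
    (f := fun j j' => ((-1) ^ j * fbinom F T r' j) • translate r' _)]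
  rw [Finset.smul_sum, ← Finset.sum_sub_distrib]
  refine Finset.sum_congr rfl fun j _ => ?_
  rw [Finset.smul_sum, ← Finset.sum_sub_distrib]
  refine Finset.sum_congr rfl fun j' _ => ?_
  rw [← translate_translate]
  exact superCommutator_left_sub_right (t := translate r) (t' := translate r')
    (La := leftOp T a (n + j) (r - T * j)) (Lb := leftOp T b (n' + j') (r' - T * j'))
    (Ra := rightOp T a (n + j) (r - T * j)) (Rb := rightOp T b (n' + j') (r' - T * j'))
    (p := (-1) ^ j * fbinom F T r j) (q := (-1) ^ j' * fbinom F T r' j') (s := s) (s₁ := s₁)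
    (s₂ := s₂) hs
    (fun v => by rw [translate_translate, translate_translate, add_comm])
    (leftOp_translate _ _ _ a) (leftOp_translate _ _ _ b)
    (rightOp_translate _ _ _ a) (rightOp_translate _ _ _ b)
    (fun v => leftOp_rightOp a b v _ _ _ _) (fun v => leftOp_rightOp b a v _ _ _ _) c

/-- The commutator of two truncated vertex operators only involves the commutators of left with left
and of right with right multiplications, and so it satisfies the locality relation of the fields. -/
theorem shift_pow_truncProduct (hB : HasBinomials F T) (a b c : fieldSpace F W) {s s₁ s₂ : F}
    (hs : s * s = 1) {k : ℕ}
    (h : ((shift ((T : ℤ), (0 : ℤ)) - shift (0, (T : ℤ)) :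
        Module.End F (ℤ × ℤ → Module.End F W)) ^ k)
      (fun x => a.1 x.1 * b.1 x.2 - s • (b.1 x.2 * a.1 x.1)) = 0) (r r' : ℤ) (J : ℕ) :
    ((shift ((1 : ℤ), (0 : ℤ)) - shift (0, (1 : ℤ)) :
        Module.End F (ℤ × ℤ → fieldSpace F W)) ^ k)
      (fun y => truncProduct T (s * s₁) r J y.1 a (truncProduct T s₂ r' J y.2 b c) -
        s • truncProduct T (s * s₂) r' J y.2 b (truncProduct T s₁ r J y.1 a c)) = 0 := by
  have hL := shift_pow_sideOp (T := T) (leftOp T) (leftOp_succ hB) translate_commute_leftOp a b c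
    (c := 1) (d := -s) (k := k) fun l l' => by
      have h1 := apply_add_smul_eq_zero (shift_pow_leftOp a b c h l l') 1
      rwa [one_mul] at h1
  have hR := shift_pow_sideOp (T := T) (rightOp T) (rightOp_succ hB) translate_commute_rightOp a b c
    (c := s * s₁ * s₂) (d := -(s₁ * s₂)) (k := k) fun l l' => by
      have h1 := apply_add_smul_eq_zero (shift_pow_rightOp a b c h l l') (-(s₁ * s₂))
      rw [neg_mul, neg_neg, mul_comm (s₁ * s₂), ← mul_assoc] at h1
      refine (congrArg _ (funext fun x => ?_)).trans h1
      exact add_comm _ _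
  have hexp : (fun y : ℤ × ℤ => truncProduct T (s * s₁) r J y.1 a (truncProduct T s₂ r' J y.2 b c) -
        s • truncProduct T (s * s₂) r' J y.2 b (truncProduct T s₁ r J y.1 a c)) =
      ∑ j ∈ Finset.range J, ∑ j' ∈ Finset.range J,
        (fun y => (((-1) ^ j * fbinom F T r j) * ((-1) ^ j' * fbinom F T r' j')) •
          (translate (r + r') :  Module.End F (fieldSpace F W))
          (((1 : F) • leftOp T a (y.1 + j) (r - T * j) (leftOp T b (y.2 + j') (r' - T * j') c) +
            (-s) • leftOp T b (y.2 + j') (r' - T * j') (leftOp T a (y.1 + j) (r - T * j) c)) +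
          ((s * s₁ * s₂) • rightOp T a (y.1 + j) (r - T * j)
              (rightOp T b (y.2 + j') (r' - T * j') c) +
            (-(s₁ * s₂)) • rightOp T b (y.2 + j') (r' - T * j')
              (rightOp T a (y.1 + j) (r - T * j) c)))) := by
    funext y
    simp only [Finset.sum_apply]
    exact truncProduct_superCommutator a b c hs r r' J y.1 y.2
  rw [hexp]
  simp only [map_sum]
  refine Finset.sum_eq_zero fun j _ => Finset.sum_eq_zero fun j' _ => ?_
  have h1 := shift_sub_pow_map (F := F) (A := ℤ × ℤ) (v := ((1 : ℤ), (0 : ℤ))) (w := (0, (1 : ℤ)))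
    (fun _ => (((-1) ^ j * fbinom F T r j) * ((-1) ^ j' * fbinom F T r' j')) •
          (translate (r + r') :  Module.End F (fieldSpace F W))) (by simp) (by simp) k
  refine (h1 _).trans ?_
  have h2 := congrArg₂ (· + ·) (hL j (r - T * j) j' (r' - T * j'))
    (hR j (r - T * j) j' (r' - T * j'))
  simp only [← map_add, add_zero] at h2
  funext y
  have h3 := congrFun h2 y
  rw [Pi.zero_apply] at h3 ⊢
  rw [← map_zero ((((-1) ^ j * fbinom F T r j) * ((-1) ^ j' * fbinom F T r' j')) •
          (translate (r + r') :  Module.End F (fieldSpace F W))), ← h3]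
  rfl

end LeftRight

/-! ### Derivatives and the vacuum -/

section Derivative

variable {F M : Type*} [Field F] [AddCommGroup M] [Module F M] {T : ℕ}

variable (F T) in
/-- The divided power `∂^N/N!` of the derivative of the series with modes `c`. -/
def hasseDeriv (N : ℕ) (c : ℤ → M) : ℤ → M :=
  fun q => ((-1) ^ N * fbinom F T q N) • c (q - T * N)

theorem hasseDeriv_apply (N : ℕ) (c : ℤ → M) (q : ℤ) :
    hasseDeriv F T N c q = ((-1) ^ N * fbinom F T q N) • c (q - T * N) := rfl

theorem hasseDeriv_zero (c : ℤ → M) : hasseDeriv F T 0 c = c := by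
  funext q
  simp [hasseDeriv_apply]

theorem sum_antidiagonal_fbinom_left (hB : HasBinomials F T) (m : ℤ) (N : ℕ) (g : ℕ → ℕ → M) :
    ∑ x ∈ antidiagonal (N + 1), fbinom F T (m + T) x.1 • g x.1 x.2 =
      ∑ x ∈ antidiagonal (N + 1), fbinom F T m x.1 • g x.1 x.2 +
        ∑ x ∈ antidiagonal N, fbinom F T m x.1 • g (x.1 + 1) x.2 := by
  rw [Finset.Nat.sum_antidiagonal_succ, Finset.Nat.sum_antidiagonal_succ, add_assoc,
    ← Finset.sum_add_distrib, fbinom_zero_right, fbinom_zero_right]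
  congr 1
  refine Finset.sum_congr rfl fun x _ => ?_
  rw [hB.fbinom_succ, add_smul]

theorem sum_antidiagonal_fbinom_right (hB : HasBinomials F T) (m : ℤ) (N : ℕ) (g : ℕ → ℕ → M) :
    ∑ x ∈ antidiagonal (N + 1), fbinom F T (m + T) x.2 • g x.1 x.2 =
      ∑ x ∈ antidiagonal (N + 1), fbinom F T m x.2 • g x.1 x.2 +
        ∑ x ∈ antidiagonal N, fbinom F T m x.2 • g x.1 (x.2 + 1) := by
  rw [Finset.Nat.sum_antidiagonal_succ', Finset.Nat.sum_antidiagonal_succ', add_assoc,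
    ← Finset.sum_add_distrib, fbinom_zero_right, fbinom_zero_right]
  congr 1
  refine Finset.sum_congr rfl fun x _ => ?_
  rw [hB.fbinom_succ, add_smul]

variable (F T) in
/-- The result of applying `∑_{i+j=N} ∂₁^i ∂₂^j/(i! j!)` to an array, up to the sign `(-1)^N`. -/
def totalDeriv (N : ℕ) (X : ℤ → ℤ → ℤ → M) (l m n : ℤ) : M :=
  ∑ x ∈ antidiagonal N, fbinom F T m x.1 • fbinom F T n x.2 • X l (m - T * x.1) (n - T * x.2)

variable (F T) in
/-- The array that belongs to the derivative `∂^N/N!` of the first series, up to the sign `(-1)^N`;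
it is given by the Leibniz rule. -/
def leftDeriv (N : ℕ) (X : ℤ → ℤ → ℤ → M) (l m n : ℤ) : M :=
  ∑ x ∈ antidiagonal N, fbinom F 1 l x.1 • fbinom F T m x.2 • X (l - x.1) (m - T * x.2) n

variable {X : ℤ → ℤ → ℤ → M}

theorem totalDeriv_succ (hB : HasBinomials F T)
    (hX : ∀ l m n, X (l + 1) m n = X l (m + T) n - X l m (n + T)) (N : ℕ) (l m n : ℤ) :
    totalDeriv F T N X (l + 1) m n =
      totalDeriv F T N X l (m + T) n - totalDeriv F T N X l m (n + T) := by
  cases N with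
  | zero => simp [totalDeriv, hX]
  | succ N =>
    have h1 : totalDeriv F T (N + 1) X l (m + T) n = _ := sum_antidiagonal_fbinom_left hB m N
      fun i j => fbinom F T n j • X l (m + T - T * i) (n - T * j)
    have h2 : totalDeriv F T (N + 1) X l m (n + T) =
        ∑ x ∈ antidiagonal (N + 1), fbinom F T (n + T) x.2 • fbinom F T m x.1 •
          X l (m - T * x.1) (n + T - T * x.2) :=
      Finset.sum_congr rfl fun x _ => smul_comm _ _ _
    rw [h1, h2, sum_antidiagonal_fbinom_right hB n N
      fun i j => fbinom F T m i • X l (m - T * i) (n + T - T * j)]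
    have h3 : ∀ (m : ℤ) (i : ℕ), m + T - T * ((i + 1 : ℕ) : ℤ) = m - T * i := fun m i => by
      push_cast; ring
    simp only [h3, smul_comm (fbinom F T n _) (fbinom F T m _)]
    rw [add_sub_add_right_eq_sub, ← Finset.sum_sub_distrib]
    refine Finset.sum_congr rfl fun x _ => ?_
    rw [hX, ← smul_sub, ← smul_sub, sub_add_eq_add_sub, sub_add_eq_add_sub]

theorem leftDeriv_succ (hB : HasBinomials F T)
    (hX : ∀ l m n, X (l + 1) m n = X l (m + T) n - X l m (n + T)) (N : ℕ) (l m n : ℤ) :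
    leftDeriv F T N X (l + 1) m n =
      leftDeriv F T N X l (m + T) n - leftDeriv F T N X l m (n + T) := by
  cases N with
  | zero => simp [leftDeriv, hX]
  | succ N =>
    have h1 : leftDeriv F T (N + 1) X (l + 1) m n = _ := sum_antidiagonal_fbinom_left hB.one l N
      fun i j => fbinom F T m j • X (l + 1 - i) (m - T * j) n
    have h2 : leftDeriv F T (N + 1) X l (m + T) n =
        ∑ x ∈ antidiagonal (N + 1), fbinom F T (m + T) x.2 • fbinom F 1 l x.1 •
          X (l - x.1) (m + T - T * x.2) n :=
      Finset.sum_congr rfl fun x _ => smul_comm _ _ _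
    rw [h1, h2, sum_antidiagonal_fbinom_right hB m N
      fun i j => fbinom F 1 l i • X (l - i) (m + T - T * j) n]
    have h3 : ∀ (m : ℤ) (i : ℕ), m + T - T * ((i + 1 : ℕ) : ℤ) = m - T * i := fun m i => by
      push_cast; ring
    have h4 : ∀ i : ℕ, l + 1 - ((i + 1 : ℕ) : ℤ) = l - i := fun i => by push_cast; ring
    simp only [h3, h4, smul_comm (fbinom F T m _) (fbinom F 1 l _)]
    rw [add_sub_right_comm, leftDeriv, ← Finset.sum_sub_distrib]
    congr 1
    refine Finset.sum_congr rfl fun x _ => ?_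
    rw [← sub_add_eq_add_sub, hX, ← smul_sub, ← smul_sub, sub_add_eq_add_sub]

/-- The residues of the total derivative of a Jacobi array are the derivatives of its residues. -/
theorem residue_totalDeriv (hB : HasBinomials F T) {k : ℤ} {D D' : ℤ → ℤ → ℤ → M}
    (hD : IsJacobiArray T k D) (hD' : IsJacobiArray T k D') (N : ℕ)
    (h : ∀ l m n, D' l m n = (-1 : F) ^ N • totalDeriv F T N D l m n) (r : ℤ) :
    residue F T r D' = fun l => hasseDeriv F T N (residue F T r D l) := by
  have hc := residue_eq_zero (F := F) (T := T) hD.eq_zero r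
  have hc' : ∀ l, k ≤ l → hasseDeriv F T N (residue F T r D l) = 0 := fun l hl => by
    funext q
    rw [hasseDeriv_apply, hc l hl, Pi.zero_apply, smul_zero, Pi.zero_apply]
  refine residue_eq_of_eq_expansion hB hD' r hc' fun l m n hm => ?_
  obtain ⟨J, hJ⟩ : ∃ J : ℕ, k ≤ l + J := ⟨(k - l).toNat, by omega⟩
  have h1 : ∀ x ∈ antidiagonal N,
      fbinom F T m x.1 • fbinom F T n x.2 • D l (m - T * x.1) (n - T * x.2) =
      ∑ i ∈ Finset.range J, (fbinom F T m i * (fbinom F T (m - T * i) x.1 * fbinom F T n x.2)) •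
        residue F T r D (l + i) (m + n - T * i - T * N) := by
    intro x hx
    have hx' : x.1 + x.2 = N := by simpa using hx
    rw [hD.eq_expansion hB r
      ((Int.modEq_iff_dvd.mpr ⟨x.1, by ring⟩ : m - T * x.1 ≡ m [ZMOD T]).trans hm),
      expansion_eq_sum hc _ _ _ hJ, Finset.smul_sum, Finset.smul_sum]
    refine Finset.sum_congr rfl fun i _ => ?_
    rw [smul_smul, smul_smul]
    congr 1
    · have e1 := hB.fbinom_mul_fbinom m x.1 i
      have e2 := hB.fbinom_mul_fbinom m i x.1
      rw [add_comm i, ← Nat.choose_symm_add] at e2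
      linear_combination fbinom F T n x.2 * (e1 - e2)
    · congr 1
      rw [← hx']
      push_cast
      ring
  rw [h, totalDeriv, Finset.sum_congr rfl h1, Finset.sum_comm, expansion_eq_sum hc' _ _ _ hJ,
    Finset.smul_sum]
  refine Finset.sum_congr rfl fun i _ => ?_
  rw [← Finset.sum_smul, ← Finset.mul_sum, ← hB.fbinom_add, hasseDeriv_apply, smul_smul, smul_smul]
  congr 1
  rw [show m - T * i + n = m + n - T * i by ring]
  ring

theorem sum_range_choose_smul (s K : ℕ) (h : ℕ → M) :
    ∑ j ∈ Finset.range (K - s), ((s + j).choose s : F) • h (s + j) =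
      ∑ t ∈ Finset.range K, (t.choose s : F) • h t := by
  rw [← Finset.sum_Ico_eq_sum_range (fun t => (t.choose s : F) • h t) s K]
  refine Finset.sum_subset (fun t ht => by simp at ht ⊢; omega) fun t ht ht' => ?_
  have : t < s := by simp at ht ht'; omega
  rw [Nat.choose_eq_zero_of_lt this, Nat.cast_zero, zero_smul]

/-- Differentiating the first series differentiates the generating function of the residues in `x₀`.
-/
theorem residue_leftDeriv (hB : HasBinomials F T) {k : ℤ} {D D' : ℤ → ℤ → ℤ → M}
    (hD : IsJacobiArray T k D) {N : ℕ} (hD' : IsJacobiArray T (k + N) D')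
    (h : ∀ l m n, D' l m n = (-1 : F) ^ N • leftDeriv F T N D l m n) (r : ℤ) :
    residue F T r D' = fun l => ((-1) ^ N * fbinom F 1 l N) • residue F T r D (l - N) := by
  have hc := residue_eq_zero (F := F) (T := T) hD.eq_zero r
  have hc' : ∀ l, k + N ≤ l → ((-1) ^ N * fbinom F 1 l N) • residue F T r D (l - N) = 0 :=
    fun l hl => by rw [hc _ (by omega), smul_zero]
  refine residue_eq_of_eq_expansion hB hD' r hc' fun l m n hm => ?_
  obtain ⟨K, hK⟩ : ∃ K : ℕ, k + N ≤ l + K := ⟨(k + N - l).toNat, by omega⟩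
  have h1 : ∀ x ∈ antidiagonal N,
      fbinom F 1 l x.1 • fbinom F T m x.2 • D (l - x.1) (m - T * x.2) n =
      ∑ t ∈ Finset.range K, (fbinom F 1 l x.1 * fbinom F 1 t x.2) •
        fbinom F T m t • residue F T r D (l + t - N) (m + n - T * t) := by
    intro x hx
    have hx' : x.1 + x.2 = N := by simpa using hx
    have h2 := sum_range_choose_smul (F := F) x.2 K
      fun t => fbinom F T m t • residue F T r D (l + t - N) (m + n - T * t)
    rw [hD.eq_expansion hB r
      ((Int.modEq_iff_dvd.mpr ⟨x.2, by ring⟩ : m - T * x.2 ≡ m [ZMOD T]).trans hm),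
      expansion_eq_sum hc _ _ _ (J := K - x.2) (by omega)]
    simp only [fbinom_natCast, mul_smul]
    rw [← Finset.smul_sum, ← h2]
    congr 1
    rw [Finset.smul_sum]
    refine Finset.sum_congr rfl fun i _ => ?_
    rw [smul_smul, smul_smul, hB.fbinom_mul_fbinom]
    congr 2
    · push_cast; omega
    · push_cast; ring
  rw [h, leftDeriv, Finset.sum_congr rfl h1, Finset.sum_comm, expansion_eq_sum hc' _ _ _ hK,
    Finset.smul_sum]
  refine Finset.sum_congr rfl fun i _ => ?_
  rw [← Finset.sum_smul, ← hB.one.fbinom_add, Pi.smul_apply, smul_smul, smul_smul, smul_smul]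
  congr 1
  ring

end Derivative

section FieldDerivative

variable {F W : Type*} [Field F] [AddCommGroup W] [Module F W] {T : ℕ}

theorem hasseDeriv_mem_fieldSpace {a : ℤ → Module.End F W} (ha : a ∈ fieldSpace F W) (N : ℕ) :
    hasseDeriv F T N a ∈ fieldSpace F W := by
  intro w
  obtain ⟨K, hK⟩ := ha w
  exact ⟨K + T * N, fun n hn => by
    rw [hasseDeriv_apply, LinearMap.smul_apply, hK _ (by linarith), smul_zero]⟩

theorem leftDeriv_apply_eq_zero {X : ℤ → ℤ → ℤ → Module.End F W} {N : ℕ} {l m n : ℤ} {w : W}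
    (h : ∀ x ∈ antidiagonal N, X (l - x.1) (m - T * x.2) n w = 0) :
    leftDeriv F T N X l m n w = 0 := by
  rw [leftDeriv, LinearMap.sum_apply]
  exact Finset.sum_eq_zero fun x hx => by
    rw [LinearMap.smul_apply, LinearMap.smul_apply, h x hx, smul_zero, smul_zero]

theorem leftDeriv_zero_left (N : ℕ) {M : Type*} [AddCommGroup M] [Module F M]
    (X : ℤ → ℤ → ℤ → M) (m n : ℤ) :
    leftDeriv F T N X 0 m n = fbinom F T m N • X 0 (m - T * N) n := by
  rw [leftDeriv, Finset.sum_eq_single (0, N)]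
  · simp
  · intro x hx hne
    have : x.1 ≠ 0 := by
      rintro h0
      have hx' : x.1 + x.2 = N := by simpa using hx
      exact hne (Prod.ext h0 (by simpa [h0] using hx'))
    rw [fbinom_zero_left, if_neg this, zero_smul]
  · intro h
    simp at h

variable [NeZero T]

/-- The variant of `eq_zero_of_succ_of_truncated` for expansions in the other direction. -/
theorem eq_zero_of_succ_of_truncated_left {M : Type*} [AddCommGroup M] [Module F M]
    {Λ : ℤ → ℤ → ℤ → M}
    (hs : ∀ l m n, Λ (l + 1) m n = Λ l (m + T) n - Λ l m (n + T)) (h0 : ∀ m n, Λ 0 m n = 0)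
    {N : ℤ} (hN : ∀ l m n, N ≤ m → Λ l m n = 0) (l m n : ℤ) : Λ l m n = 0 := by
  have h := eq_zero_of_succ_of_truncated (T := T) (Λ := fun l m n => (-1 : F) ^ l • Λ l n m)
    (fun l m n => by
      rw [hs, zpow_add_one₀ (neg_ne_zero.mpr one_ne_zero)]
      module)
    (fun m n => by rw [h0, smul_zero]) (fun l m n hn => by rw [hN _ _ _ hn, smul_zero]) l n m
  exact (smul_eq_zero.mp h).resolve_left (zpow_ne_zero _ (neg_ne_zero.mpr one_ne_zero))

/-- The second half of the bracket satisfies the same recurrence as the bracket. -/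
theorem modeProd_swap_succ (hB : HasBinomials F T) {a : ℤ → Module.End F W}
    (ha : a ∈ fieldSpace F W) (b : ℤ → Module.End F W) (l m n : ℤ) :
    (-1 : F) ^ (l + 1) • modeProd T (l + 1) n m b a =
      (-1 : F) ^ l • modeProd T l n (m + T) b a - (-1 : F) ^ l • modeProd T l (n + T) m b a := by
  rw [modeProd_succ hB l n m b ha, zpow_add_one₀ (neg_ne_zero.mpr one_ne_zero)]
  module

theorem modeProd_hasseDeriv_left (hB : HasBinomials F T) (a : ℤ → Module.End F W)
    {b : ℤ → Module.End F W} (hb : b ∈ fieldSpace F W) (N : ℕ) (l m n : ℤ) :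
    modeProd T l m n (hasseDeriv F T N a) b =
      (-1 : F) ^ N • leftDeriv F T N (fun l m n => modeProd T l m n a b) l m n := by
  ext w
  obtain ⟨K, hK⟩ := hb w
  refine sub_eq_zero.mp (eq_zero_of_succ_of_truncated (T := T) (Λ := fun l m n =>
    modeProd T l m n (hasseDeriv F T N a) b w -
      ((-1 : F) ^ N • leftDeriv F T N (fun l m n => modeProd T l m n a b) l m n) w)
    (fun l m n => ?_) (fun m n => ?_) (N := K) (fun l m n hn => ?_) l m n)
  · rw [modeProd_succ hB l m n _ hb,
      leftDeriv_succ hB (fun l m n => modeProd_succ hB l m n a hb) N l m n]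
    simp only [LinearMap.sub_apply, LinearMap.smul_apply, smul_sub]
    abel
  · rw [modeProd_zero m n _ hb, leftDeriv_zero_left, modeProd_zero _ n _ hb, hasseDeriv_apply,
      smul_mul_assoc, smul_smul, sub_self]
  · rw [modeProd_apply_eq_zero l m _ hb hK hn, LinearMap.smul_apply,
      leftDeriv_apply_eq_zero fun x _ => modeProd_apply_eq_zero _ _ a hb hK hn, smul_zero, sub_zero]

theorem modeProd_hasseDeriv_right (hB : HasBinomials F T) {a : ℤ → Module.End F W}
    (ha : a ∈ fieldSpace F W) (b : ℤ → Module.End F W) (N : ℕ) (l m n : ℤ) :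
    (-1 : F) ^ l • modeProd T l n m b (hasseDeriv F T N a) =
      (-1 : F) ^ N •
        leftDeriv F T N (fun l m n => (-1 : F) ^ l • modeProd T l n m b a) l m n := by
  ext w
  obtain ⟨K, hK⟩ := ha w
  have ha' := hasseDeriv_mem_fieldSpace (T := T) ha N
  have hK' : ∀ n, K + T * N ≤ n → hasseDeriv F T N a n w = 0 := fun n hn => by
    rw [hasseDeriv_apply, LinearMap.smul_apply, hK _ (by linarith), smul_zero]
  refine sub_eq_zero.mp (eq_zero_of_succ_of_truncated_left (F := F) (T := T) (Λ := fun l m n =>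
    ((-1 : F) ^ l • modeProd T l n m b (hasseDeriv F T N a)) w - ((-1 : F) ^ N •
      leftDeriv F T N (fun l m n => (-1 : F) ^ l • modeProd T l n m b a) l m n) w)
    (fun l m n => ?_) (fun m n => ?_) (N := K + T * N) (fun l m n hm => ?_) l m n)
  · rw [modeProd_swap_succ hB ha', leftDeriv_succ hB (modeProd_swap_succ hB ha b) N l m n]
    simp only [LinearMap.sub_apply, LinearMap.smul_apply, smul_sub]
    abel
  · rw [modeProd_zero n m _ ha', leftDeriv_zero_left, modeProd_zero n _ _ ha, hasseDeriv_apply,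
      mul_smul_comm, zpow_zero, one_smul, one_smul, smul_smul, sub_self]
  · rw [LinearMap.smul_apply, modeProd_apply_eq_zero l n _ ha' hK' hm, LinearMap.smul_apply,
      leftDeriv_apply_eq_zero fun x hx => ?_, smul_zero, smul_zero, sub_zero]
    have hx' : x.1 + x.2 = N := by simpa using hx
    have h1 : (T : ℤ) * x.2 ≤ T * N := by gcongr; omega
    rw [LinearMap.smul_apply, modeProd_apply_eq_zero _ _ b ha hK (by linarith), smul_zero]

theorem bracket_hasseDeriv_left (hB : HasBinomials F T) {a b : ℤ → Module.End F W}
    (ha : a ∈ fieldSpace F W) (hb : b ∈ fieldSpace F W) (s : F) (N : ℕ) (l m n : ℤ) :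
    bracket T s l m n (hasseDeriv F T N a) b =
      (-1 : F) ^ N • leftDeriv F T N (fun l m n => bracket T s l m n a b) l m n := by
  rw [bracket_eq, modeProd_hasseDeriv_left hB a hb, mul_smul, modeProd_hasseDeriv_right hB ha,
    smul_comm s, ← smul_sub]
  congr 1
  simp only [leftDeriv, Finset.smul_sum]
  rw [← Finset.sum_sub_distrib]
  refine Finset.sum_congr rfl fun x _ => ?_
  rw [bracket_eq]
  module

theorem sum_modeProd_hasseDeriv (hB : HasBinomials F T) (a : ℤ → Module.End F W)
    {b : ℤ → Module.End F W} (hb : b ∈ fieldSpace F W) (N : ℕ) (l m n : ℤ) :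
    ∑ x ∈ antidiagonal N, modeProd T l m n (hasseDeriv F T x.1 a) (hasseDeriv F T x.2 b) =
      (-1 : F) ^ N • totalDeriv F T N (fun l m n => modeProd T l m n a b) l m n := by
  ext w
  obtain ⟨K, hK⟩ := hb w
  have hb' := fun i => hasseDeriv_mem_fieldSpace (T := T) hb i
  have hle : ∀ x ∈ antidiagonal N, (T : ℤ) * x.2 ≤ T * N := fun x hx => by
    have hx' : x.1 + x.2 = N := by simpa using hx
    gcongr
    omega
  have hK' : ∀ x ∈ antidiagonal N, ∀ n, K + T * N ≤ n → hasseDeriv F T x.2 b n w = 0 :=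
    fun x hx n hn => by
      rw [hasseDeriv_apply, LinearMap.smul_apply, hK _ (by linarith [hle x hx]), smul_zero]
  refine sub_eq_zero.mp (eq_zero_of_succ_of_truncated (T := T) (Λ := fun l m n =>
    (∑ x ∈ antidiagonal N,
      modeProd T l m n (hasseDeriv F T x.1 a) (hasseDeriv F T x.2 b)) w -
      ((-1 : F) ^ N • totalDeriv F T N (fun l m n => modeProd T l m n a b) l m n) w)
    (fun l m n => ?_) (fun m n => ?_) (N := K + T * N) (fun l m n hn => ?_) l m n)
  · rw [Finset.sum_congr rfl fun x _ => modeProd_succ hB l m n _ (hb' x.2),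
      Finset.sum_sub_distrib,
      totalDeriv_succ hB (fun l m n => modeProd_succ hB l m n a hb) N l m n]
    simp only [LinearMap.sub_apply, LinearMap.smul_apply, smul_sub]
    abel
  · rw [← LinearMap.sub_apply, totalDeriv, Finset.smul_sum, ← Finset.sum_sub_distrib,
      Finset.sum_eq_zero, LinearMap.zero_apply]
    intro x hx
    have hx' : x.1 + x.2 = N := by simpa using hx
    rw [modeProd_zero m n _ (hb' x.2), modeProd_zero _ _ _ hb, hasseDeriv_apply, hasseDeriv_apply,
      smul_mul_smul_comm, smul_smul, smul_smul, ← hx', pow_add, sub_eq_zero]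
    congr 1
    ring
  · rw [LinearMap.sum_apply, Finset.sum_eq_zero fun x hx =>
        modeProd_apply_eq_zero l m _ (hb' x.2) (hK' x hx) hn, LinearMap.smul_apply, totalDeriv,
      LinearMap.sum_apply, Finset.sum_eq_zero, smul_zero, sub_zero]
    intro x hx
    rw [LinearMap.smul_apply, LinearMap.smul_apply, modeProd_apply_eq_zero _ _ a hb hK
      (by linarith [hle x hx]), smul_zero, smul_zero]

/-- Leibniz rule for the brackets of derivatives. -/
theorem sum_bracket_hasseDeriv (hB : HasBinomials F T) {a b : ℤ → Module.End F W}
    (ha : a ∈ fieldSpace F W) (hb : b ∈ fieldSpace F W) (s : F) (N : ℕ) (l m n : ℤ) :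
    ∑ x ∈ antidiagonal N, bracket T s l m n (hasseDeriv F T x.1 a) (hasseDeriv F T x.2 b) =
      (-1 : F) ^ N • totalDeriv F T N (fun l m n => bracket T s l m n a b) l m n := by
  have h1 := sum_modeProd_hasseDeriv hB b ha N l n m
  rw [← Finset.Nat.sum_antidiagonal_swap] at h1
  simp only [bracket_eq]
  rw [Finset.sum_sub_distrib, sum_modeProd_hasseDeriv hB a hb, ← Finset.smul_sum]
  simp only [Prod.fst_swap, Prod.snd_swap] at h1
  rw [h1, smul_comm, ← smul_sub]
  congr 1
  simp only [totalDeriv]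
  rw [← Finset.Nat.sum_antidiagonal_swap (f := fun x => fbinom F T n x.1 • fbinom F T m x.2 •
    modeProd T l (n - T * x.1) (m - T * x.2) b a), Finset.smul_sum, ← Finset.sum_sub_distrib]
  refine Finset.sum_congr rfl fun x _ => ?_
  simp only [Prod.fst_swap, Prod.snd_swap]
  module

/-- `(∂^N a/N!)_l b = (-1)^N C(l, N) a_{l-N} b`. -/
theorem nthProduct_hasseDeriv_left (hB : HasBinomials F T) {a b : ℤ → Module.End F W}
    (ha : a ∈ fieldSpace F W) (hb : b ∈ fieldSpace F W) {s : F} (h : MutuallyLocal T s a b)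
    (N : ℕ) (h' : MutuallyLocal T s (hasseDeriv F T N a) b) (r l : ℤ) :
    nthProduct T s r l (hasseDeriv F T N a) b =
      ((-1) ^ N * fbinom F 1 l N) • nthProduct T s r (l - N) a b := by
  obtain ⟨k, hk⟩ := isJacobiArray_bracket hB ha hb h
  obtain ⟨k', hk'⟩ := isJacobiArray_bracket hB (hasseDeriv_mem_fieldSpace ha N) hb h'
  exact congrFun (residue_leftDeriv hB (hk.mono (k' := max k k') (le_max_left _ _))
    (hk'.mono ((le_max_right (k : ℤ) k').trans (by omega)))
    (bracket_hasseDeriv_left hB ha hb s N) r) l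

/-- `∂^N/N!` applied to `a_l b` satisfies the Leibniz rule. -/
theorem hasseDeriv_nthProduct (hB : HasBinomials F T) {a b : ℤ → Module.End F W}
    (ha : a ∈ fieldSpace F W) (hb : b ∈ fieldSpace F W) {s : F}
    (h : ∀ i j, MutuallyLocal T s (hasseDeriv F T i a) (hasseDeriv F T j b)) (N : ℕ) (r l : ℤ) :
    hasseDeriv F T N (nthProduct T s r l a b) =
      ∑ x ∈ antidiagonal N, nthProduct T s r l (hasseDeriv F T x.1 a) (hasseDeriv F T x.2 b) := by
  have h' : ∀ x : ℕ × ℕ, ∃ k : ℕ, ∀ l : ℤ, k ≤ l → ∀ m n,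
      bracket T s l m n (hasseDeriv F T x.1 a) (hasseDeriv F T x.2 b) = 0 := fun x =>
    (h x.1 x.2).exists_bracket_eq_zero hB (hasseDeriv_mem_fieldSpace ha _)
      (hasseDeriv_mem_fieldSpace hb _)
  choose K hK using h'
  obtain ⟨k, hk⟩ : ∃ k, ∀ x ∈ insert (0, 0) (antidiagonal N), K x ≤ k :=
    ⟨_, fun x hx => Finset.le_sup hx⟩
  have hJ : ∀ x ∈ insert (0, 0) (antidiagonal N), IsJacobiArray T k
      (fun l m n => bracket T s l m n (hasseDeriv F T x.1 a) (hasseDeriv F T x.2 b)) :=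
    fun x hx => ⟨fun l m n => bracket_succ hB s l m n (hasseDeriv_mem_fieldSpace ha _)
      (hasseDeriv_mem_fieldSpace hb _), fun l hl m n =>
        hK x l (le_trans (by exact_mod_cast hk x hx) hl) m n⟩
  have h0 := hJ (0, 0) (Finset.mem_insert_self _ _)
  simp only [hasseDeriv_zero] at h0
  have h1 := residue_totalDeriv hB h0
    (IsJacobiArray.sum fun x hx => hJ x (Finset.mem_insert_of_mem hx)) N
    (sum_bracket_hasseDeriv hB ha hb s N) r
  refine (congrFun h1 l).symm.trans ?_
  obtain ⟨J, hJ'⟩ : ∃ J : ℕ, (k : ℤ) ≤ l + J := ⟨(k - l).toNat, by omega⟩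
  funext q
  rw [residue_eq_sum (IsJacobiArray.sum fun x hx => hJ x (Finset.mem_insert_of_mem hx)).eq_zero
    r l q hJ', Finset.sum_apply]
  simp only [Finset.smul_sum]
  rw [Finset.sum_comm]
  refine Finset.sum_congr rfl fun x hx => ?_
  rw [nthProduct_eq_sum (hJ x (Finset.mem_insert_of_mem hx)).eq_zero r l hJ', Finset.sum_apply]
  rfl

end FieldDerivative

section Vacuum

variable {F W : Type*} [Field F] [AddCommGroup W] [Module F W] {T : ℕ}

theorem idField_mem_fieldSpace : (idField T : ℤ → Module.End F W) ∈ fieldSpace F W :=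
  fun w => ⟨1, fun n hn => by rw [idField, if_neg (by omega), LinearMap.zero_apply]⟩

variable [NeZero T]

theorem idField_mul (j : ℤ) :
    (idField T (T * j) : Module.End F W) = if j = -1 then 1 else 0 := by
  have hT : (T : ℤ) ≠ 0 := by exact_mod_cast NeZero.ne T
  rw [idField]
  congr 1
  refine propext ⟨fun h => mul_left_cancel₀ hT (by rw [h]; ring), fun h => by rw [h]; ring⟩

theorem modeProd_idField_right (a : ℤ → Module.End F W) (l m : ℤ) :
    modeProd T l m 0 a (idField T) = 0 := by
  ext w
  rw [modeProd_apply l m a idField_mem_fieldSpace (I := 0) fun i _ => by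
    rw [zero_add, idField_mul, if_neg (by omega), LinearMap.zero_apply]]
  simp

theorem modeProd_idField_left {b : ℤ → Module.End F W} (hb : b ∈ fieldSpace F W) (l n : ℤ) :
    modeProd T l 0 n (idField T) b = if l = -1 then b n else 0 := by
  ext w
  obtain ⟨I, hI⟩ := exists_forall_mode_eq_zero (T := T) hb n w
  rw [modeProd_apply l 0 _ hb (I := I + 1) fun i hi => hI i (by omega), Finset.sum_range_succ']
  simp only [zero_add, idField_mul, Nat.cast_zero, sub_zero, mul_zero, add_zero, pow_zero,
    fbinom_zero_right, one_mul, one_smul]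
  rw [Finset.sum_eq_zero]
  · split_ifs <;> simp
  · intro i _
    split_ifs with h
    · obtain rfl : l = (i : ℕ) := by push_cast at h; omega
      rw [fbinom_natCast, Nat.choose_succ_self]
      simp
    · simp

/-- `(1_W)_n b = δ_{n,-1} b`. -/
theorem nthProduct_idField_left {b : ℤ → Module.End F W} (hb : b ∈ fieldSpace F W) (n : ℤ) :
    nthProduct T (1 : F) 0 n (idField T) b = if n = -1 then b else 0 := by
  funext q
  rw [nthProduct, finsum_eq_single _ 0]
  · rw [bracket_eq]
    simp only [Nat.cast_zero, mul_zero, sub_zero, add_zero]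
    rw [modeProd_idField_left hb, modeProd_idField_right]
    split_ifs <;> simp [binom]
  · intro j hj
    have h0 : binom F (((0 : ℤ) : ℚ) / T) j = fbinom F T 0 j := rfl
    rw [h0, fbinom_zero_left, if_neg hj, mul_zero, zero_smul]

/-- `a_n 1_W = 0` for `n ≥ 0`, and `a_{-1-N} 1_W = ∂^N a / N!`. -/
theorem nthProduct_idField_right (hB : HasBinomials F T) {a : ℤ → Module.End F W}
    (ha : a ∈ fieldSpace F W) {r : ℤ} (hr : ∀ n, ¬ n ≡ r [ZMOD T] → a n = 0) (n : ℤ) :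
    nthProduct T (1 : F) r n a (idField T) =
      if n < 0 then hasseDeriv F T (-1 - n).toNat a else 0 := by
  set c : ℤ → ℤ → Module.End F W :=
    fun n => if n < 0 then hasseDeriv F T (-1 - n).toNat a else 0 with hc
  have hid : (idField T : ℤ → Module.End F W) ∈ fieldSpace F W := idField_mem_fieldSpace
  have hc0 : ∀ l : ℤ, 0 ≤ l → c l = 0 := fun l hl => by simp only [hc]; rw [if_neg (by omega)]
  have hcr : ∀ l q, ¬ q ≡ r [ZMOD T] → c l q = 0 := by
    intro l q hq
    simp only [hc]
    split_ifs
    · rw [hasseDeriv_apply, hr, smul_zero]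
      exact fun h => hq ((Int.modEq_iff_dvd.mpr ⟨-((-1 - l).toNat : ℤ), by ring⟩ :
        q ≡ q - T * ((-1 - l).toNat : ℤ) [ZMOD T]).trans h)
    · rfl
  have hloc : MutuallyLocal T (1 : F) a (idField T) :=
    (mutuallyLocal_idField a).symm hB (one_mul 1) hid ha
  obtain ⟨k, hk⟩ := isJacobiArray_bracket hB ha hid hloc
  refine congrFun (residue_eq_of_eq_expansion hB hk r
    (fun l hl => hc0 l ((Int.natCast_nonneg k).trans hl)) ?_) n
  intro l m n hm
  have hΔ := hk.sub ((isJacobiArray_expansion hB hc0).mono (Int.natCast_nonneg k))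
  refine sub_eq_zero.mp (hΔ.eq_zero_of_diagonal r (fun l _ q => ?_) l m n hm)
  by_cases hq : q ≡ r [ZMOD T]
  -- at `(m, n) = (q, 0)` one half of the bracket vanishes, and the other has at most one term
  · refine ⟨q, hq, ?_⟩
    rw [Pi.sub_apply, Pi.sub_apply, Pi.sub_apply, sub_self, bracket_eq, modeProd_idField_right,
      modeProd_idField_left ha, sub_eq_zero]
    rcases lt_or_ge l 0 with hl | hl
    · obtain ⟨N, rfl⟩ : ∃ N : ℕ, l = -1 - N := ⟨(-1 - l).toNat, by omega⟩
      rw [expansion_eq_sum hc0 _ _ _ (J := N + 1) (by push_cast; omega)]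
      have h1 : ∀ i ∈ Finset.range (N + 1), fbinom F T q i • c (-1 - N + i) (q + 0 - T * i) =
          ((-1 : F) ^ N * fbinom F T q N) •
            (((-1 : F) ^ i * (N.choose i : F)) • a (q - T * N)) := by
        intro i hi
        obtain ⟨j, rfl⟩ : ∃ j, N = i + j := ⟨N - i, by simp at hi; omega⟩
        have e1 : (-1 - (-1 - ((i + j : ℕ) : ℤ) + i)).toNat = j := by push_cast; omega
        simp only [hc]
        rw [if_pos (by push_cast; omega), e1, hasseDeriv_apply, add_zero, smul_smul, smul_smul]
        have e2 : q - T * (i : ℤ) - T * j = q - T * ((i + j : ℕ) : ℤ) := by push_cast; ring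
        rw [e2]
        congr 1
        have e3 : ((-1 : F) ^ i) * (-1) ^ i = 1 := by rw [← mul_pow]; simp
        rw [pow_add]
        linear_combination (-1) ^ j * hB.fbinom_mul_fbinom q i j -
          (-1) ^ j * fbinom F T q (i + j) * ((i + j).choose i : F) * e3
      rw [Finset.sum_congr rfl h1, ← Finset.smul_sum, ← Finset.sum_smul]
      have h2 := congrArg (Int.cast : ℤ → F) (Int.alternating_sum_range_choose (n := N))
      push_cast at h2
      rw [h2]
      rcases Nat.eq_zero_or_pos N with rfl | hN
      · simp
      · rw [if_neg (by omega), if_neg (by omega)]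
        simp
    · rw [expansion_eq_sum hc0 _ _ _ (J := 0) (by simpa using hl), if_neg (by omega)]
      simp
  -- off the support of `a` both sides vanish
  · refine ⟨r, rfl, ?_⟩
    have hq' : ¬ q - r ≡ 0 [ZMOD T] := fun h => hq (by simpa using h.add_right r)
    rw [Pi.sub_apply, Pi.sub_apply, Pi.sub_apply, bracket_eq_zero_of_not_modEq ha hid
      (fun n hn => ?_) _ _ _ hq', zero_sub, neg_eq_zero]
    · obtain ⟨J, hJ⟩ : ∃ J : ℕ, 0 ≤ l + J := ⟨(-l).toNat, by omega⟩
      rw [expansion_eq_sum hc0 _ _ _ hJ]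
      refine Finset.sum_eq_zero fun i _ => ?_
      rw [hcr, smul_zero]
      exact fun h => hq ((Int.modEq_iff_dvd.mpr ⟨-(i : ℤ), by ring⟩ :
        q ≡ r + (q - r) - T * i [ZMOD T]).trans h)
    · rw [idField, if_neg]
      rintro rfl
      exact hn (Int.modEq_iff_dvd.mpr ⟨1, by ring⟩)

end Vacuum

/-! ### Reconstruction from locality -/

section Reconstruction

variable {F V : Type*} [Field F] [AddCommGroup V] [Module F V]

/-- **Goddard's uniqueness theorem**: a field that is local with a family of fields that create a
spanning set from the vacuum is determined by its action on the vacuum. -/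
theorem eq_zero_of_mutuallyLocal {X : Set V} (hX : Submodule.span F X = ⊤) {vac : V}
    (Y : V → ℤ → Module.End F V) (hreg : ∀ v n, 0 ≤ n → Y v n vac = 0)
    (hcre : ∀ v, Y v (-1) vac = v) {Θ : ℤ → Module.End F V} (hvac : ∀ q, Θ q vac = 0)
    (hloc : ∀ v ∈ X, ∃ s : F, MutuallyLocal 1 s Θ (Y v)) : Θ = 0 := by
  funext q
  refine LinearMap.ext_on hX fun v hv => ?_
  obtain ⟨s, k, hk⟩ := hloc v hv
  have h := congrArg (fun f : Module.End F V => f vac) (hk (q - k) (-1))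
  simp only [LinearMap.sum_apply, LinearMap.smul_apply, Module.End.mul_apply, hvac, map_zero,
    smul_zero, Finset.sum_const_zero] at h
  rw [Finset.sum_range_succ', Finset.sum_eq_zero fun i _ => by
    rw [hreg v _ (by push_cast; omega), map_zero, smul_zero], zero_add] at h
  simpa [hcre] using h

/-- **Reconstruction theorem.** Pairwise local fields that create their labels from the vacuum
satisfy the Jacobi identity as soon as the field of `u_l v` has the same effect on the vacuum as the
`l`-th product of the fields of `u` and `v`. -/
theorem bracket_eq_expansion_of_mutuallyLocal (hB : HasBinomials F 1)
    {parity : ZMod 2 → Submodule F V} (hsup : ⨆ α, parity α = ⊤) {vac : V}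
    (Y : V →ₗ[F] ℤ → Module.End F V) (hY : ∀ u, Y u ∈ fieldSpace F V)
    (hpar : ∀ α β, ∀ u ∈ parity α, ∀ v ∈ parity β, ∀ n, Y u n v ∈ parity (α + β))
    (hreg : ∀ v n, 0 ≤ n → Y v n vac = 0) (hcre : ∀ v, Y v (-1) vac = v)
    (hloc : ∀ α β, ∀ u ∈ parity α, ∀ v ∈ parity β,
      MutuallyLocal 1 (superSign F α β) (Y u) (Y v))
    (hder : ∀ u v l, ∀ N : ℕ, ∑ i ∈ Finset.range (N + 1),
      ((-1) ^ i * fbinom F 1 l i) • Y u (l - i) (Y v (-1 - N + i) vac) = Y (Y u l v) (-1 - N) vac)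
    {α β : ZMod 2} {u v : V} (hu : u ∈ parity α) (hv : v ∈ parity β) (l m n : ℤ) :
    bracket 1 (superSign F α β) l m n (Y u) (Y v) =
      ∑ᶠ i : ℕ, binom F (m : ℚ) i • Y (Y u (l + i) v) (m + n - i) := by
  have hX : Submodule.span F (⋃ α, (parity α : Set V)) = ⊤ := by
    rw [Submodule.span_iUnion]
    simpa using hsup
  -- both sides are local with all fields of the family, so they may be compared on the vacuum
  have hit : ∀ l q, bracket 1 (superSign F α β) l 0 q (Y u) (Y v) = Y (Y u l v) q := by
    intro l q
    refine sub_eq_zero.mp (congrFun (eq_zero_of_mutuallyLocal hX Y hreg hcre (Θ := fun q =>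
      bracket 1 (superSign F α β) l 0 q (Y u) (Y v) - Y (Y u l v) q) (fun q => ?_) ?_) q)
    · have h1 : modeProd 1 l q 0 (Y v) (Y u) vac = 0 := by
        rw [modeProd_apply l q (Y v) (hY u) (I := 0) fun i _ => hreg u _ (by omega)]
        simp
      rw [LinearMap.sub_apply, bracket_eq, LinearMap.sub_apply, LinearMap.smul_apply, h1,
        smul_zero, sub_zero, sub_eq_zero]
      rcases lt_or_ge q 0 with hq | hq
      · obtain ⟨N, rfl⟩ : ∃ N : ℕ, q = -1 - N := ⟨(-1 - q).toNat, by omega⟩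
        rw [← hder, modeProd_apply l 0 (Y u) (hY v) (I := N + 1) fun i hi =>
          hreg v _ (by push_cast; omega)]
        simp
      · rw [hreg _ _ hq, modeProd_apply l 0 (Y u) (hY v) (I := 0) fun i _ =>
          hreg v _ (by push_cast; omega)]
        simp
    · intro w hw
      obtain ⟨γ, hw⟩ := Set.mem_iUnion.mp hw
      refine ⟨superSign F α γ * superSign F β γ, ?_⟩
      have h1 := (hloc α β u hu v hv).bracket_left hB (hY u) (hY v) (hloc α γ u hu w hw)
        (hloc β γ v hv w hw) l 0
      have h2 := hloc (α + β) γ _ (hpar α β u hu v hv l) w hw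
      rw [superSign_add_left] at h2
      have h3 := h1.add_left (h2.smul_left (-1))
      convert h3 using 1
      funext q
      simp [sub_eq_add_neg]
  obtain ⟨k, hk⟩ := isJacobiArray_bracket hB (hY u) (hY v) (hloc α β u hu v hv)
  rw [show bracket 1 (superSign F α β) l m n (Y u) (Y v) = _ from
    hk.eq_expansion hB 0 (Int.modEq_one), expansion]
  refine finsum_congr fun i => ?_
  rw [binom_intCast, ← hit]
  congr 1
  -- for `r = 0` only the term `j = 0` of the residue is nonzero
  rw [residue, finsum_eq_single _ 0]
  · simp
  · intro j hj
    rw [fbinom_zero_left, if_neg hj, mul_zero, zero_smul]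

end Reconstruction

/-! ### Vertex operators on a closed local subspace -/

section ComponentSum

variable {F W : Type*} [Field F] [AddCommGroup W] [Module F W] {T : ℕ} [NeZero T] {η : F}
  {𝒲 : ZMod 2 → Submodule F W} {P : ZMod 2 → Module.End F W}

theorem natCast_modEq_iff (r : ℤ) {i : ℕ} (hi : i < T) :
    (i : ℤ) ≡ r [ZMOD T] ↔ i = (r % T).toNat := by
  have hT : (T : ℤ) ≠ 0 := by exact_mod_cast NeZero.ne T
  have h0 := Int.emod_nonneg r hT
  rw [Int.ModEq, Int.emod_eq_of_lt (by omega) (by exact_mod_cast hi)]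
  omega

theorem toNat_emod_lt (r : ℤ) : (r % T).toNat < T := by
  have hT : (T : ℤ) ≠ 0 := by exact_mod_cast NeZero.ne T
  have h0 := Int.emod_nonneg r hT
  have h1 := Int.emod_lt_of_pos r (show (0 : ℤ) < T by omega)
  omega

/-- Only one component of a homogeneous series contributes to a sum over all components. -/
theorem sum_component_of_isHomogeneous (hP : IsParityProjection 𝒲 P) (hη : IsPrimitiveRoot η T)
    {M : Type*} [AddCommMonoid M] (Φ : ℕ → ZMod 2 → (ℤ → Module.End F W) → M)
    (hΦ : ∀ i α, Φ i α 0 = 0) {r : ℤ} {α : ZMod 2} {a : ℤ → Module.End F W}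
    (ha : IsHomogeneous η 𝒲 r α a) :
    ∑ i ∈ Finset.range T, ∑ α', Φ i α' (component T P i α' a) = Φ (r % T).toNat α a := by
  rw [Finset.sum_eq_single_of_mem _ (Finset.mem_range.mpr (toNat_emod_lt r)),
    Finset.sum_eq_single_of_mem α (Finset.mem_univ _)]
  · rw [component_of_isHomogeneous hP hη ha,
      if_pos ⟨(natCast_modEq_iff r (toNat_emod_lt r)).mpr rfl, rfl⟩]
  · intro α' _ hα'
    rw [component_of_isHomogeneous hP hη ha, if_neg fun h => hα' h.2, hΦ]
  · intro i hi hne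
    refine Finset.sum_eq_zero fun α' _ => ?_
    rw [component_of_isHomogeneous hP hη ha, if_neg, hΦ]
    exact fun h => hne ((natCast_modEq_iff r (Finset.mem_range.mp hi)).mp h.1)

theorem sum_range_ite_modEq {M : Type*} [AddCommMonoid M] (n : ℤ) (x : M) :
    ∑ i ∈ Finset.range T, (if n ≡ i [ZMOD T] then x else 0) = x := by
  rw [Finset.sum_eq_single_of_mem _ (Finset.mem_range.mpr (toNat_emod_lt n)),
    if_pos ((natCast_modEq_iff n (toNat_emod_lt n)).mpr rfl).symm]
  intro i hi hne
  rw [if_neg]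
  exact fun h => hne ((natCast_modEq_iff n (Finset.mem_range.mp hi)).mp h.symm)

theorem sum_component (hP : IsParityProjection 𝒲 P) (a : ℤ → Module.End F W) :
    ∑ i ∈ Finset.range T, ∑ α, component T P i α a = a := by
  rw [Finset.sum_comm]
  funext n
  simp only [Finset.sum_apply, component_apply, sum_range_ite_modEq]
  rw [Finset.sum_comm]
  have h : ∀ β, ∑ α, P (α + β) * a n * P β = a n * P β := fun β => by
    rw [← Finset.sum_mul, ← Finset.sum_mul,
      Fintype.sum_equiv (Equiv.addRight β) (fun α => P (α + β)) P fun _ => rfl, hP.sum_eq_one,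
      one_mul]
  simp only [h]
  rw [← Finset.mul_sum, hP.sum_eq_one, mul_one]

theorem sum_component_of_forall_mem_endParity (hP : IsParityProjection 𝒲 P) {α : ZMod 2}
    {a : ℤ → Module.End F W} (ha : ∀ n, a n ∈ endParity 𝒲 α) :
    ∑ i ∈ Finset.range T, component T P i α a = a := by
  funext n
  simp only [Finset.sum_apply, component_apply, sum_range_ite_modEq]
  rw [hP.sum_mul_mul (ha n), if_pos rfl]

end ComponentSum

section VertexSpace

variable {F W : Type*} [Field F] [AddCommGroup W] [Module F W]

/-- The standing hypotheses on a local subspace that is closed under all products. -/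
structure IsVertexSpace (T : ℕ) (η : F) (𝒲 : ZMod 2 → Submodule F W) (P : ZMod 2 → Module.End F W)
    (G : Submodule F (ℤ → Module.End F W)) : Prop where
  hasBinomials : HasBinomials F T
  isPrimitiveRoot : IsPrimitiveRoot η T
  isParityProjection : IsParityProjection 𝒲 P
  isLocal : IsLocalSubspace T η 𝒲 G
  isClosed : IsClosedSubspace T η 𝒲 G

variable {T : ℕ} {η : F} {𝒲 : ZMod 2 → Submodule F W} {P : ZMod 2 → Module.End F W}
  {G : Submodule F (ℤ → Module.End F W)}

namespace IsVertexSpace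

theorem mem_fieldSpace (hG : IsVertexSpace T η 𝒲 P G) (a : G) : a.1 ∈ fieldSpace F W :=
  hG.isLocal.le_fieldSpace a.2

theorem mutuallyLocal (hG : IsVertexSpace T η 𝒲 P G) {a b : G} {r r' : ℤ} {α β : ZMod 2}
    (ha : IsHomogeneous η 𝒲 r α a.1) (hb : IsHomogeneous η 𝒲 r' β b.1) :
    MutuallyLocal T (superSign F α β) a.1 b.1 :=
  hG.isLocal.mutuallyLocal a.1 a.2 b.1 b.2 r r' α β ha hb

end IsVertexSpace


variable (𝒲 G) in
/-- The elements of `G` of parity `α`. -/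
def parityPart (α : ZMod 2) : Submodule F G where
  carrier := {a | ∀ n, a.1 n ∈ endParity 𝒲 α}
  zero_mem' := fun n => by simp
  add_mem' := fun ha hb n => add_mem (ha n) (hb n)
  smul_mem' := fun c a ha n => Submodule.smul_mem _ c (ha n)

variable [NeZero T]

theorem zero_nthProduct {b : ℤ → Module.End F W} (hb : b ∈ fieldSpace F W) (s : F) (r n : ℤ) :
    nthProduct T s r n 0 b = 0 := by
  simpa using nthProduct_smul_left (T := T) (s := s) (zero_mem _) hb 0 r n

theorem nthProduct_zero {a : ℤ → Module.End F W} (ha : a ∈ fieldSpace F W) (s : F) (r n : ℤ) :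
    nthProduct T s r n a 0 = 0 := by
  simpa using nthProduct_smul_right (T := T) (s := s) ha (zero_mem _) 0 r n

namespace IsVertexSpace

theorem component_mem (hG : IsVertexSpace T η 𝒲 P G) {a : ℤ → Module.End F W} (ha : a ∈ G)
    (r : ℤ) (α : ZMod 2) : component T P r α a ∈ G := by
  have h : G ≤ G.comap (component T P r α) := by
    conv_lhs => rw [← hG.isLocal.span_homogeneous]
    rw [Submodule.span_le]
    rintro b ⟨hb, r', α', hb'⟩
    rw [SetLike.mem_coe, Submodule.mem_comap,
      component_of_isHomogeneous hG.isParityProjection hG.isPrimitiveRoot hb']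
    split_ifs
    · exact hb
    · exact zero_mem _
  exact h ha

theorem isHomogeneous_component (hG : IsVertexSpace T η 𝒲 P G) (a : G) (r : ℤ) (α : ZMod 2) :
    IsHomogeneous η 𝒲 r α (component T P r α a.1) :=
  TwistedVertex.isHomogeneous_component hG.isParityProjection hG.isPrimitiveRoot
    (hG.mem_fieldSpace a) r α

/-- An additive property holds on `G` if it holds for the homogeneous elements. -/
theorem induction (hG : IsVertexSpace T η 𝒲 P G) {p : G → Prop} (h0 : p 0)
    (hadd : ∀ a b, p a → p b → p (a + b))
    (hom : ∀ r α (a : G), IsHomogeneous η 𝒲 r α a.1 → p a) (a : G) : p a := by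
  have h : a = ∑ i ∈ Finset.range T, ∑ α,
      (⟨component T P i α a.1, hG.component_mem a.2 i α⟩ : G) := by
    apply Subtype.ext
    simp only [Submodule.coe_sum]
    exact (sum_component hG.isParityProjection a.1).symm
  rw [h]
  exact Finset.sum_induction _ p hadd h0 fun i _ => Finset.sum_induction _ p hadd h0 fun α _ =>
    hom i α _ (hG.isHomogeneous_component a i α)

/-- An additive property holds on the part of parity `α` if it holds for the homogeneous elements of
parity `α`. -/
theorem parity_induction (hG : IsVertexSpace T η 𝒲 P G) {α : ZMod 2} {p : G → Prop} (h0 : p 0)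
    (hadd : ∀ a b, p a → p b → p (a + b))
    (hom : ∀ r (a : G), IsHomogeneous η 𝒲 r α a.1 → p a) {a : G} (ha : a ∈ parityPart 𝒲 G α) :
    p a := by
  have h : a = ∑ i ∈ Finset.range T,
      (⟨component T P i α a.1, hG.component_mem a.2 i α⟩ : G) := by
    apply Subtype.ext
    rw [Submodule.coe_sum]
    exact (sum_component_of_forall_mem_endParity hG.isParityProjection ha).symm
  rw [h]
  exact Finset.sum_induction _ p hadd h0 fun i _ => hom i _ (hG.isHomogeneous_component a i α)

theorem parityPart_isInternal (hG : IsVertexSpace T η 𝒲 P G) :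
    DirectSum.IsInternal (parityPart 𝒲 G) := by
  rw [DirectSum.isInternal_submodule_iff_isCompl _ (i := 0) (j := 1) (by decide)
    (by ext x; revert x; simp; decide)]
  refine ⟨Submodule.disjoint_def.mpr fun a h0 h1 => Subtype.ext <| funext fun n => ?_,
    codisjoint_iff_le_sup.mpr fun a _ => ?_⟩
  · have e0 := hG.isParityProjection.sum_mul_mul (γ := 0) (h0 n)
    have e1 := hG.isParityProjection.sum_mul_mul (γ := 0) (h1 n)
    rw [if_pos rfl] at e0
    rw [if_neg (by decide)] at e1
    exact e0.symm.trans e1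
  · refine hG.induction (p := fun a => a ∈ parityPart 𝒲 G 0 ⊔ parityPart 𝒲 G 1) (zero_mem _)
      (fun a b => add_mem) (fun r α a ha => ?_) a
    fin_cases α
    · exact Submodule.mem_sup_left ha.2.2
    · exact Submodule.mem_sup_right ha.2.2

theorem mutuallyLocal_component (hG : IsVertexSpace T η 𝒲 P G) (a b : G) (r r' : ℤ)
    (α β : ZMod 2) :
    MutuallyLocal T (superSign F α β) (component T P r α a.1) (component T P r' β b.1) :=
  hG.isLocal.mutuallyLocal _ (hG.component_mem a.2 r α) _ (hG.component_mem b.2 r' β) r r' α β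
    (hG.isHomogeneous_component a r α) (hG.isHomogeneous_component b r' β)

/-- The product `a_n b` of arbitrary elements of `G`, defined on homogeneous components. -/
def product (hG : IsVertexSpace T η 𝒲 P G) (n : ℤ) : G →ₗ[F] G →ₗ[F] G :=
  LinearMap.mk₂ F (fun a b => ∑ i ∈ Finset.range T, ∑ α, ∑ j ∈ Finset.range T, ∑ β,
      (⟨nthProduct T (superSign F α β) i n (component T P i α a.1) (component T P j β b.1),
        hG.isClosed.nthProduct_mem _ (hG.component_mem a.2 i α) _ (hG.component_mem b.2 j β) i j α β
          (hG.isHomogeneous_component a i α) (hG.isHomogeneous_component b j β)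
          (hG.mutuallyLocal_component a b i j α β) n⟩ : G))
    (fun a a' b => by
      simp only [← Finset.sum_add_distrib]
      refine Finset.sum_congr rfl fun i _ => Finset.sum_congr rfl fun α _ =>
        Finset.sum_congr rfl fun j _ => Finset.sum_congr rfl fun β _ => Subtype.ext ?_
      simp only [Submodule.coe_add, map_add]
      exact nthProduct_add_left hG.hasBinomials (hG.isHomogeneous_component a i α).1
        (hG.isHomogeneous_component a' i α).1 (hG.isHomogeneous_component b j β).1
        (hG.mutuallyLocal_component a b i j α β) (hG.mutuallyLocal_component a' b i j α β) i n)
    (fun c a b => by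
      simp only [Finset.smul_sum]
      refine Finset.sum_congr rfl fun i _ => Finset.sum_congr rfl fun α _ =>
        Finset.sum_congr rfl fun j _ => Finset.sum_congr rfl fun β _ => Subtype.ext ?_
      simp only [Submodule.coe_smul, map_smul]
      exact nthProduct_smul_left (hG.isHomogeneous_component a i α).1
        (hG.isHomogeneous_component b j β).1 c i n)
    (fun a b b' => by
      simp only [← Finset.sum_add_distrib]
      refine Finset.sum_congr rfl fun i _ => Finset.sum_congr rfl fun α _ =>
        Finset.sum_congr rfl fun j _ => Finset.sum_congr rfl fun β _ => Subtype.ext ?_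
      simp only [Submodule.coe_add, map_add]
      exact nthProduct_add_right hG.hasBinomials (hG.isHomogeneous_component a i α).1
        (hG.isHomogeneous_component b j β).1 (hG.isHomogeneous_component b' j β).1
        (hG.mutuallyLocal_component a b i j α β) (hG.mutuallyLocal_component a b' i j α β) i n)
    (fun c a b => by
      simp only [Finset.smul_sum]
      refine Finset.sum_congr rfl fun i _ => Finset.sum_congr rfl fun α _ =>
        Finset.sum_congr rfl fun j _ => Finset.sum_congr rfl fun β _ => Subtype.ext ?_
      simp only [Submodule.coe_smul, map_smul]
      exact nthProduct_smul_right (hG.isHomogeneous_component a i α).1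
        (hG.isHomogeneous_component b j β).1 c i n)

/-- The vertex operators `Y(a, x)` of elements of `G`, with modes `b ↦ a_n b`. -/
def vertexOp (hG : IsVertexSpace T η 𝒲 P G) : G →ₗ[F] ℤ → Module.End F G :=
  LinearMap.pi hG.product

theorem vertexOp_apply (hG : IsVertexSpace T η 𝒲 P G) {a b : G} {r r' : ℤ} {α β : ZMod 2}
    (ha : IsHomogeneous η 𝒲 r α a.1) (hb : IsHomogeneous η 𝒲 r' β b.1) (n : ℤ) :
    (hG.vertexOp a n b).1 = nthProduct T (superSign F α β) r n a.1 b.1 := by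
  rw [vertexOp, LinearMap.pi_apply, product, LinearMap.mk₂_apply]
  simp only [Submodule.coe_sum]
  have h1 : ∀ i : ℕ, ∀ α', ∑ j ∈ Finset.range T, ∑ β',
      nthProduct T (superSign F α' β') i n (component T P i α' a.1) (component T P j β' b.1) =
      nthProduct T (superSign F α' β) i n (component T P i α' a.1) b.1 := fun i α' =>
    sum_component_of_isHomogeneous hG.isParityProjection hG.isPrimitiveRoot
      (fun _ β' x => nthProduct T (superSign F α' β') i n (component T P i α' a.1) x)
      (fun _ β' => nthProduct_zero (hG.isHomogeneous_component a i α').1 _ _ _) hb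
  simp only [h1]
  rw [sum_component_of_isHomogeneous hG.isParityProjection hG.isPrimitiveRoot
    (fun i α' x => nthProduct T (superSign F α' β) i n x b.1)
    (fun _ α' => zero_nthProduct hb.1 _ _ _) ha]
  exact nthProduct_congr hG.hasBinomials ha.1 hb.1 (hG.mutuallyLocal ha hb)
    ((natCast_modEq_iff r (toNat_emod_lt r)).mpr rfl) n

theorem isHomogeneous_vertexOp (hG : IsVertexSpace T η 𝒲 P G) {a b : G} {r r' : ℤ}
    {α β : ZMod 2} (ha : IsHomogeneous η 𝒲 r α a.1) (hb : IsHomogeneous η 𝒲 r' β b.1) (n : ℤ) :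
    IsHomogeneous η 𝒲 (r + r') (α + β) (hG.vertexOp a n b).1 := by
  rw [hG.vertexOp_apply ha hb]
  exact isHomogeneous_nthProduct hG.hasBinomials hG.isPrimitiveRoot ha hb (hG.mutuallyLocal ha hb) n

theorem vertexOp_mem_parityPart (hG : IsVertexSpace T η 𝒲 P G) {α β : ZMod 2} {a b : G}
    (ha : a ∈ parityPart 𝒲 G α) (hb : b ∈ parityPart 𝒲 G β) (n : ℤ) :
    hG.vertexOp a n b ∈ parityPart 𝒲 G (α + β) := by
  refine hG.parity_induction (p := fun a => hG.vertexOp a n b ∈ parityPart 𝒲 G (α + β)) ?_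
    (fun a a' h h' => ?_) (fun r a ha => ?_) ha
  · simp
  · simpa using add_mem h h'
  · refine hG.parity_induction (p := fun b => hG.vertexOp a n b ∈ parityPart 𝒲 G (α + β)) ?_
      (fun b b' h h' => ?_) (fun r' b hb => ?_) hb
    · simp
    · simpa using add_mem h h'
    · exact (hG.isHomogeneous_vertexOp ha hb n).2.2

theorem vertexOp_mem_fieldSpace (hG : IsVertexSpace T η 𝒲 P G) (a : G) :
    hG.vertexOp a ∈ fieldSpace F G := by
  refine hG.induction (p := fun a => hG.vertexOp a ∈ fieldSpace F G) (by simp)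
    (fun a a' h h' => by simpa using add_mem h h') (fun r α a ha => ?_) a
  rw [mem_fieldSpace_iff]
  intro b
  refine hG.induction (p := fun b => ∀ᶠ n in atTop, hG.vertexOp a n b = 0) (by simp)
    (fun b b' h h' => ?_) (fun r' β b hb => ?_) b
  · filter_upwards [h, h'] with n hn hn'
    rw [map_add, hn, hn', add_zero]
  · obtain ⟨N, hN⟩ := exists_nthProduct_eq_zero hG.hasBinomials ha.1 hb.1 (hG.mutuallyLocal ha hb) r
    refine eventually_atTop.mpr ⟨N, fun n hn => Subtype.ext ?_⟩
    rw [hG.vertexOp_apply ha hb, hN n hn]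
    rfl

/-- The vacuum vector `1_W`. -/
def vacuum (hG : IsVertexSpace T η 𝒲 P G) : G := ⟨idField T, hG.isClosed.idField_mem⟩

theorem isHomogeneous_vacuum (hG : IsVertexSpace T η 𝒲 P G) :
    IsHomogeneous η 𝒲 0 0 hG.vacuum.1 := isHomogeneous_idField hG.isPrimitiveRoot

theorem vertexOp_vacuum (hG : IsVertexSpace T η 𝒲 P G) (n : ℤ) :
    hG.vertexOp hG.vacuum n = if n = -1 then 1 else 0 := by
  refine LinearMap.ext fun b => ?_
  refine hG.induction (p := fun b => hG.vertexOp hG.vacuum n b =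
    (if n = -1 then 1 else 0 : Module.End F G) b) (by simp) (fun b b' h h' => ?_)
    (fun r' β b hb => Subtype.ext ?_) b
  · rw [map_add, map_add, h, h']
  · rw [hG.vertexOp_apply hG.isHomogeneous_vacuum hb, superSign_zero_left]
    refine (nthProduct_idField_left hb.1 n).trans ?_
    split_ifs <;> rfl

theorem vertexOp_apply_vacuum (hG : IsVertexSpace T η 𝒲 P G) {a : G} {r : ℤ} {α : ZMod 2}
    (ha : IsHomogeneous η 𝒲 r α a.1) (n : ℤ) : (hG.vertexOp a n hG.vacuum).1 =
      if n < 0 then hasseDeriv F T (-1 - n).toNat a.1 else 0 := by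
  rw [hG.vertexOp_apply ha hG.isHomogeneous_vacuum, superSign_zero_right]
  exact nthProduct_idField_right hG.hasBinomials ha.1
    ((isHomogeneous_iff hG.isPrimitiveRoot).mp ha).2.1 n

theorem vertexOp_apply_vacuum_of_nonneg (hG : IsVertexSpace T η 𝒲 P G) (a : G) (n : ℤ)
    (hn : 0 ≤ n) : hG.vertexOp a n hG.vacuum = 0 := by
  refine hG.induction (p := fun a => hG.vertexOp a n hG.vacuum = 0) (by simp)
    (fun a a' h h' => ?_) (fun r α a ha => Subtype.ext ?_) a
  · rw [map_add, Pi.add_apply, LinearMap.add_apply, h, h', add_zero]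
  · rw [hG.vertexOp_apply_vacuum ha, if_neg (by omega)]
    rfl

theorem vertexOp_neg_one_vacuum (hG : IsVertexSpace T η 𝒲 P G) (a : G) :
    hG.vertexOp a (-1) hG.vacuum = a := by
  refine hG.induction (p := fun a => hG.vertexOp a (-1) hG.vacuum = a) (by simp)
    (fun a a' h h' => ?_) (fun r α a ha => Subtype.ext ?_) a
  · rw [map_add, Pi.add_apply, LinearMap.add_apply, h, h']
  · rw [hG.vertexOp_apply_vacuum ha, if_pos (by omega)]
    simp [hasseDeriv_zero]

/-- The derivatives of a homogeneous element of `G` are its products with the vacuum, and so they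
are homogeneous elements of `G` as well. -/
theorem vertexOp_vacuum_eq_hasseDeriv (hG : IsVertexSpace T η 𝒲 P G) {a : G} {r : ℤ}
    {α : ZMod 2} (ha : IsHomogeneous η 𝒲 r α a.1) (N : ℕ) :
    (hG.vertexOp a (-1 - N) hG.vacuum).1 = hasseDeriv F T N a.1 ∧
      IsHomogeneous η 𝒲 r α (hasseDeriv F T N a.1) := by
  have h := hG.vertexOp_apply_vacuum ha (-1 - N)
  rw [if_pos (by omega), show (-1 - (-1 - (N : ℤ))).toNat = N by omega] at h
  refine ⟨h, ?_⟩
  have h' := hG.isHomogeneous_vertexOp ha hG.isHomogeneous_vacuum (-1 - N)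
  rwa [h, add_zero, add_zero] at h'

/-- `∑ᵢ (-1)^i C(l, i) a_{l-i} ∂^{N-i} b = ∂^N (a_l b)` for divided powers of `∂`. -/
theorem sum_vertexOp_vacuum (hG : IsVertexSpace T η 𝒲 P G) (a b : G) (l : ℤ) (N : ℕ) :
    ∑ i ∈ Finset.range (N + 1), ((-1) ^ i * fbinom F 1 l i) •
      hG.vertexOp a (l - i) (hG.vertexOp b (-1 - N + i) hG.vacuum) =
      hG.vertexOp (hG.vertexOp a l b) (-1 - N) hG.vacuum := by
  refine hG.induction (p := fun a => ∑ i ∈ Finset.range (N + 1), ((-1) ^ i * fbinom F 1 l i) •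
      hG.vertexOp a (l - i) (hG.vertexOp b (-1 - N + i) hG.vacuum) =
      hG.vertexOp (hG.vertexOp a l b) (-1 - N) hG.vacuum) (by simp) (fun a a' h h' => ?_)
      (fun r α a ha => ?_) a
  · simp only [map_add, Pi.add_apply, LinearMap.add_apply, smul_add, Finset.sum_add_distrib, h, h']
  refine hG.induction (p := fun b => ∑ i ∈ Finset.range (N + 1), ((-1) ^ i * fbinom F 1 l i) •
      hG.vertexOp a (l - i) (hG.vertexOp b (-1 - N + i) hG.vacuum) =
      hG.vertexOp (hG.vertexOp a l b) (-1 - N) hG.vacuum) (by simp) (fun b b' h h' => ?_)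
      (fun r' β b hb => ?_) b
  · simp only [map_add, Pi.add_apply, LinearMap.add_apply, smul_add, Finset.sum_add_distrib, h, h']
  have hda : ∀ i, IsHomogeneous η 𝒲 r α (hasseDeriv F T i a.1) := fun i =>
    (hG.vertexOp_vacuum_eq_hasseDeriv ha i).2
  have hdb := fun i => hG.vertexOp_vacuum_eq_hasseDeriv hb i
  have hdab := fun i => (hG.vertexOp_vacuum_eq_hasseDeriv ha i).1
  have hloc : ∀ i j, MutuallyLocal T (superSign F α β) (hasseDeriv F T i a.1)
      (hasseDeriv F T j b.1) := fun i j => by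
    have h1 := hda i
    have h2 := (hdb j).2
    rw [← hdab i] at h1 ⊢
    rw [← (hdb j).1] at h2 ⊢
    exact hG.mutuallyLocal h1 h2
  apply Subtype.ext
  rw [(hG.vertexOp_vacuum_eq_hasseDeriv (hG.isHomogeneous_vertexOp ha hb l) N).1,
    hG.vertexOp_apply ha hb, hasseDeriv_nthProduct hG.hasBinomials ha.1 hb.1 hloc,
    Finset.Nat.sum_antidiagonal_eq_sum_range_succ_mk, Submodule.coe_sum]
  refine Finset.sum_congr rfl fun i hi => ?_
  have hi' : i ≤ N := by simp at hi; omega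
  have e : -1 - (N : ℤ) + i = -1 - ((N - i : ℕ) : ℤ) := by push_cast [hi']; ring
  have h0 := hloc 0 (N - i)
  rw [hasseDeriv_zero] at h0
  have hb' := (hdb (N - i)).2
  rw [nthProduct_hasseDeriv_left hG.hasBinomials ha.1 (hdb (N - i)).2.1 h0 i (hloc _ _),
    Submodule.coe_smul, e]
  rw [← (hdb (N - i)).1] at hb' ⊢
  rw [hG.vertexOp_apply ha hb']

end IsVertexSpace
end VertexSpace

/-! ### The vertex superalgebra, its automorphism and the twisted module -/

section Locality

variable {F W : Type*} [Field F] [AddCommGroup W] [Module F W]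
  {T : ℕ} {η : F} {𝒲 : ZMod 2 → Submodule F W} {P : ZMod 2 → Module.End F W}
  {G : Submodule F (ℤ → Module.End F W)}

namespace IsVertexSpace

/-- The elements of `G` as elements of the space of all fields. -/
def toField (hG : IsVertexSpace T η 𝒲 P G) : G →ₗ[F] fieldSpace F W :=
  Submodule.inclusion hG.isLocal.le_fieldSpace

variable [NeZero T]

theorem eventually_vertexOp_eq (hG : IsVertexSpace T η 𝒲 P G) {a b : G} {r r' : ℤ} {α β : ZMod 2}
    (ha : IsHomogeneous η 𝒲 r α a.1) (hb : IsHomogeneous η 𝒲 r' β b.1) (n : ℤ) :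
    ∀ᶠ J in atTop, truncProduct T (superSign F α β) r J n (hG.toField a) (hG.toField b) =
      hG.toField (hG.vertexOp a n b) := by
  filter_upwards [eventually_nthProduct_eq hG.hasBinomials (a := hG.toField a) (v := hG.toField b)
    (hG.mutuallyLocal ha hb) r n] with J hJ
  exact Subtype.ext (hJ.symm.trans (hG.vertexOp_apply ha hb n).symm)

theorem eventually_vertexOp_vertexOp_eq (hG : IsVertexSpace T η 𝒲 P G) {a b c : G}
    {r r' r'' : ℤ} {α β γ : ZMod 2} (ha : IsHomogeneous η 𝒲 r α a.1)
    (hb : IsHomogeneous η 𝒲 r' β b.1) (hc : IsHomogeneous η 𝒲 r'' γ c.1) (n n' : ℤ) :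
    ∀ᶠ J in atTop, truncProduct T (superSign F α β * superSign F α γ) r J n (hG.toField a)
      (truncProduct T (superSign F β γ) r' J n' (hG.toField b) (hG.toField c)) =
      hG.toField (hG.vertexOp a n (hG.vertexOp b n' c)) := by
  filter_upwards [hG.eventually_vertexOp_eq hb hc n',
    hG.eventually_vertexOp_eq ha (hG.isHomogeneous_vertexOp hb hc n') n] with J h h'
  rw [h, ← superSign_add_right, h']

/-- The vertex operators of mutually local fields are mutually local. -/
theorem mutuallyLocal_vertexOp_of_isHomogeneous (hG : IsVertexSpace T η 𝒲 P G) {a b : G}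
    {r r' : ℤ} {α β : ZMod 2} (ha : IsHomogeneous η 𝒲 r α a.1)
    (hb : IsHomogeneous η 𝒲 r' β b.1) :
    MutuallyLocal 1 (superSign F α β) (hG.vertexOp a) (hG.vertexOp b) := by
  obtain ⟨k, hk⟩ := mutuallyLocal_iff_shift.mp (hG.mutuallyLocal ha hb)
  refine mutuallyLocal_iff_shift.mpr ⟨k, ?_⟩
  rw [Nat.cast_one]
  funext x
  refine LinearMap.ext fun c => ?_
  rw [shift_sub_pow_apply]
  refine hG.induction (p := fun c => (∑ i ∈ Finset.range (k + 1), ((-1) ^ i * (k.choose i : F)) •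
    (fun x : ℤ × ℤ => hG.vertexOp a x.1 * hG.vertexOp b x.2 -
      superSign F α β • (hG.vertexOp b x.2 * hG.vertexOp a x.1))
      (x + (k - i) • ((1 : ℤ), (0 : ℤ)) + i • ((0 : ℤ), (1 : ℤ)))) c = 0) (map_zero _)
    (fun c c' h h' => by rw [map_add, h, h', add_zero]) (fun r'' γ c hc => ?_) c
  -- finitely many modes occur, so one order of truncation `J` serves for all of them
  have hJ : ∀ᶠ J in atTop, ∀ i ∈ Finset.range (k + 1), ∀ y : ℤ × ℤ,
      y = x + (k - i) • ((1 : ℤ), (0 : ℤ)) + i • ((0 : ℤ), (1 : ℤ)) →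
      truncProduct T (superSign F α β * superSign F α γ) r J y.1 (hG.toField a)
        (truncProduct T (superSign F β γ) r' J y.2 (hG.toField b) (hG.toField c)) =
        hG.toField (hG.vertexOp a y.1 (hG.vertexOp b y.2 c)) ∧
      truncProduct T (superSign F α β * superSign F β γ) r' J y.2 (hG.toField b)
        (truncProduct T (superSign F α γ) r J y.1 (hG.toField a) (hG.toField c)) =
        hG.toField (hG.vertexOp b y.2 (hG.vertexOp a y.1 c)) := by
    rw [eventually_all_finset]
    intro i _
    simp only [forall_eq]
    refine (hG.eventually_vertexOp_vertexOp_eq ha hb hc _ _).and ?_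
    rw [superSign_comm α β]
    exact hG.eventually_vertexOp_vertexOp_eq hb ha hc _ _
  obtain ⟨J, hJ⟩ := hJ.exists
  have h := congrFun (shift_pow_truncProduct hG.hasBinomials (hG.toField a) (hG.toField b)
    (hG.toField c) (s₁ := superSign F α γ) (s₂ := superSign F β γ) (superSign_mul_self α β) hk
    r r' J) x
  rw [shift_sub_pow_apply, Pi.zero_apply] at h
  have hinj : Function.Injective hG.toField := Submodule.inclusion_injective _
  refine hinj ?_
  rw [map_zero, ← h, LinearMap.sum_apply, map_sum]
  refine Finset.sum_congr rfl fun i hi => ?_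
  obtain ⟨e1, e2⟩ := hJ i hi _ rfl
  rw [e1, e2, LinearMap.smul_apply, map_smul, LinearMap.sub_apply, LinearMap.smul_apply, map_sub,
    map_smul]
  rfl

theorem mutuallyLocal_vertexOp (hG : IsVertexSpace T η 𝒲 P G) {a b : G} {α β : ZMod 2}
    (ha : a ∈ parityPart 𝒲 G α) (hb : b ∈ parityPart 𝒲 G β) :
    MutuallyLocal 1 (superSign F α β) (hG.vertexOp a) (hG.vertexOp b) := by
  have hB := hG.hasBinomials.one
  refine hG.parity_induction (p := fun a => MutuallyLocal 1 (superSign F α β) (hG.vertexOp a)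
    (hG.vertexOp b)) ?_ (fun a a' h h' => ?_) (fun r a ha => ?_) ha
  · rw [map_zero]; exact mutuallyLocal_zero_left _ _
  · rw [map_add]; exact h.add_left h'
  refine MutuallyLocal.symm hB (superSign_mul_self α β) (hG.vertexOp_mem_fieldSpace b)
    (hG.vertexOp_mem_fieldSpace a) ?_
  refine hG.parity_induction (p := fun b => MutuallyLocal 1 (superSign F α β) (hG.vertexOp b)
    (hG.vertexOp a)) ?_ (fun b b' h h' => ?_) (fun r' b hb => ?_) hb
  · rw [map_zero]; exact mutuallyLocal_zero_left _ _
  · rw [map_add]; exact h.add_left h'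
  rw [superSign_comm]
  exact hG.mutuallyLocal_vertexOp_of_isHomogeneous hb ha

/-- The vertex superalgebra structure on a local subspace that is closed under all products. -/
def vertexSuperalgebra (hG : IsVertexSpace T η 𝒲 P G) : VertexSuperalgebra F G where
  parity := parityPart 𝒲 G
  parity_isInternal := hG.parityPart_isInternal
  vacuum := hG.vacuum
  vacuum_mem := hG.isHomogeneous_vacuum.2.2
  Y := hG.vertexOp
  parity_mode _ _ _ hu _ hv n := hG.vertexOp_mem_parityPart hu hv n
  truncation u v := hG.vertexOp_mem_fieldSpace u v
  vacuum_mode := hG.vertexOp_vacuum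
  creation_regular := hG.vertexOp_apply_vacuum_of_nonneg
  creation := hG.vertexOp_neg_one_vacuum
  jacobi _ _ _ hu _ hv l m n := bracket_eq_expansion_of_mutuallyLocal hG.hasBinomials.one
    hG.parityPart_isInternal.submodule_iSup_eq_top hG.vertexOp hG.vertexOp_mem_fieldSpace
    (fun _ _ _ hu _ hv n => hG.vertexOp_mem_parityPart hu hv n)
    hG.vertexOp_apply_vacuum_of_nonneg hG.vertexOp_neg_one_vacuum
    (fun _ _ _ hu _ hv => hG.mutuallyLocal_vertexOp hu hv) hG.sum_vertexOp_vacuum hu hv l m n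

end IsVertexSpace
end Locality

section Twist

variable {F W : Type*} [Field F] [AddCommGroup W] [Module F W]
  {T : ℕ} {η : F} {𝒲 : ZMod 2 → Submodule F W} {P : ZMod 2 → Module.End F W}
  {G : Submodule F (ℤ → Module.End F W)}

theorem twist_pow_apply (η : F) (m : ℕ) (a : ℤ → Module.End F W) (n : ℤ) :
    (twist η ^ m) a n = (η ^ n) ^ m • a n := by
  induction m generalizing a with
  | zero => simp
  | succ m ih =>
    rw [pow_succ, Module.End.mul_apply, ih, pow_succ, mul_smul]
    rfl

theorem twist_pow_eq_one (hη : IsPrimitiveRoot η T) :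
    (twist η : Module.End F (ℤ → Module.End F W)) ^ T = 1 := by
  refine LinearMap.ext fun a => funext fun n => ?_
  rw [twist_pow_apply, ← zpow_natCast, zpow_comm, zpow_natCast, hη.pow_eq_one, one_zpow, one_smul]
  rfl

theorem twist_pow_apply_eq_smul {r : ℤ} {α : ZMod 2} {a : ℤ → Module.End F W}
    (ha : IsHomogeneous η 𝒲 r α a) (m : ℕ) : (twist η ^ m) a = (η ^ r) ^ m • a := by
  induction m with
  | zero => simp
  | succ m ih => rw [pow_succ', Module.End.mul_apply, ih, map_smul, ha.2.1, pow_succ, mul_smul]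

variable [NeZero T]

/-- The fixed points of `g^m` form a closed subspace. -/
theorem isClosedSubspace_fixedPoints (hB : HasBinomials F T) (hη : IsPrimitiveRoot η T) (m : ℕ) :
    IsClosedSubspace T η 𝒲
      (LinearMap.ker ((twist η : Module.End F (ℤ → Module.End F W)) ^ m - 1) ⊓ fieldSpace F W) where
  idField_mem := by
    refine ⟨?_, idField_mem_fieldSpace⟩
    rw [SetLike.mem_coe, LinearMap.mem_ker, LinearMap.sub_apply,
      twist_pow_apply_eq_smul (isHomogeneous_idField (𝒲 := 𝒲) hη)]
    simp
  nthProduct_mem a ha b hb r r' α β har hbr h n := by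
    have hab := isHomogeneous_nthProduct hB hη har hbr h n
    refine ⟨?_, hab.1⟩
    have h1 := ha.1
    have h2 := hb.1
    rw [SetLike.mem_coe, LinearMap.mem_ker, LinearMap.sub_apply, twist_pow_apply_eq_smul har,
      Module.End.one_apply, sub_eq_zero] at h1
    rw [SetLike.mem_coe, LinearMap.mem_ker, LinearMap.sub_apply, twist_pow_apply_eq_smul hbr,
      Module.End.one_apply, sub_eq_zero] at h2
    have h0 : η ≠ 0 := hη.ne_zero (NeZero.ne T)
    rw [SetLike.mem_coe, LinearMap.mem_ker, LinearMap.sub_apply, twist_pow_apply_eq_smul hab,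
      Module.End.one_apply, sub_eq_zero, zpow_add₀ h0, mul_pow, mul_smul,
      ← nthProduct_smul_right har.1 hbr.1, h2, ← nthProduct_smul_left har.1 hbr.1, h1]

namespace IsVertexSpace

theorem twist_mem (hG : IsVertexSpace T η 𝒲 P G) {a : ℤ → Module.End F W} (ha : a ∈ G) :
    twist η a ∈ G := by
  refine hG.induction (p := fun a => twist η a.1 ∈ G) (by simp)
    (fun a b h h' => by simpa using add_mem h h') (fun r α a ha => ?_) ⟨a, ha⟩
  rw [ha.2.1]
  exact Submodule.smul_mem _ _ a.2

theorem restrict_twist_pow (hG : IsVertexSpace T η 𝒲 P G) :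
    ((twist η).restrict fun _ => hG.twist_mem : Module.End F G) ^ T = 1 := by
  rw [Module.End.pow_restrict]
  refine LinearMap.ext fun a => Subtype.ext ?_
  rw [LinearMap.coe_restrict_apply, twist_pow_eq_one hG.isPrimitiveRoot]
  rfl

/-- The automorphism `g` of `G`, with inverse `g^{T-1}`. -/
def automorphism (hG : IsVertexSpace T η 𝒲 P G) : G ≃ₗ[F] G :=
  LinearEquiv.ofLinearMap ((twist η).restrict fun _ => hG.twist_mem : Module.End F G)
    (((twist η).restrict fun _ => hG.twist_mem : Module.End F G) ^ (T - 1))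
    ((mul_pow_sub_one (NeZero.ne T) _).trans hG.restrict_twist_pow)
    ((pow_sub_one_mul (NeZero.ne T) _).trans hG.restrict_twist_pow)

theorem automorphism_apply (hG : IsVertexSpace T η 𝒲 P G) (a : G) :
    (hG.automorphism a).1 = twist η a.1 := rfl

theorem automorphism_pow_apply (hG : IsVertexSpace T η 𝒲 P G) (m : ℕ) (a : G) :
    ((hG.automorphism ^ m) a).1 = (twist η ^ m) a.1 := by
  induction m with
  | zero => rfl
  | succ m ih =>
    rw [pow_succ', pow_succ', Module.End.mul_apply, ← ih]
    rfl

theorem isAutomorphism_automorphism (hG : IsVertexSpace T η 𝒲 P G) :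
    hG.vertexSuperalgebra.IsAutomorphism hG.automorphism where
  map_vacuum := Subtype.ext <| by
    rw [automorphism_apply]
    exact (hG.isHomogeneous_vacuum.2.1).trans (by rw [zpow_zero, one_smul]; rfl)
  map_parity α u hu n := Submodule.smul_mem _ _ (hu n)
  map_Y u n v := by
    have h0 : η ≠ 0 := hG.isPrimitiveRoot.ne_zero (NeZero.ne T)
    change hG.automorphism (hG.vertexOp u n v) =
      hG.vertexOp (hG.automorphism u) n (hG.automorphism v)
    have hsmul : ∀ {r α} {a : G}, IsHomogeneous η 𝒲 r α a.1 → hG.automorphism a = η ^ r • a :=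
      fun ha => Subtype.ext ha.2.1
    refine hG.induction (p := fun u => hG.automorphism (hG.vertexOp u n v) =
      hG.vertexOp (hG.automorphism u) n (hG.automorphism v)) (by simp) (fun u u' h h' => ?_)
      (fun r α u hu => ?_) u
    · simp only [map_add, Pi.add_apply, LinearMap.add_apply, h, h']
    refine hG.induction (p := fun v => hG.automorphism (hG.vertexOp u n v) =
      hG.vertexOp (hG.automorphism u) n (hG.automorphism v)) (by simp) (fun v v' h h' => ?_)
      (fun r' β v hv => ?_) v
    · simp only [map_add, h, h']
    rw [hsmul hu, hsmul hv, hsmul (hG.isHomogeneous_vertexOp hu hv n), zpow_add₀ h0]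
    simp only [map_smul, Pi.smul_apply, LinearMap.smul_apply, smul_smul]
    rw [mul_comm]

/-- `W` is a twisted module for `G`: since the fields are local, the twisted Jacobi identity holds
for the residues of the brackets, and these are the products in `G`. -/
theorem isTwistedSuperModule_subtype (hG : IsVertexSpace T η 𝒲 P G) :
    hG.vertexSuperalgebra.IsTwistedSuperModule hG.automorphism T η 𝒲 G.subtype where
  support r _ u hu n hn := by
    refine (twist_eq_smul_iff hG.isPrimitiveRoot r u.1).mp ?_ n hn
    rw [zpow_natCast]
    exact congrArg Subtype.val hu
  truncation u w := hG.mem_fieldSpace u w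
  vacuum_mode := rfl
  parity_mode _ _ hu n := hu n
  jacobi r _ α β u hu hur v hv l m n hm := by
    have hu' : IsHomogeneous η 𝒲 r α u.1 :=
      ⟨hG.mem_fieldSpace u, by rw [zpow_natCast]; exact congrArg Subtype.val hur, hu⟩
    change bracket T (superSign F α β) l m n u.1 v.1 =
      ∑ᶠ i : ℕ, fbinom F T m i • (hG.vertexOp u (l + i) v).1 (m + n - T * i)
    have hfin : ∀ v : G, (Function.support fun i : ℕ =>
        fbinom F T m i • (hG.vertexOp u (l + i) v).1 (m + n - T * i)).Finite := fun v => by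
      obtain ⟨N, hN⟩ := hG.vertexOp_mem_fieldSpace u v
      refine (Finset.range (N - l).toNat).finite_toSet.subset fun i hi => ?_
      by_contra hi'
      refine hi ?_
      rw [Finset.coe_range, Set.mem_Iio, not_lt] at hi'
      simp only [hN (l + i) (by omega)]
      exact smul_zero _
    refine hG.parity_induction (p := fun v => bracket T (superSign F α β) l m n u.1 v.1 =
      ∑ᶠ i : ℕ, fbinom F T m i • (hG.vertexOp u (l + i) v).1 (m + n - T * i)) ?_
      (fun v v' h h' => ?_) (fun r' v hv => ?_) hv
    · have h1 := (bracketHom T (superSign F α β) l m n (hG.toField u)).map_zero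
      rw [bracketHom_apply] at h1
      refine h1.trans ?_
      simp
    · have h1 := (bracketHom T (superSign F α β) l m n (hG.toField u)).map_add (hG.toField v)
        (hG.toField v')
      simp only [bracketHom_apply] at h1
      refine h1.trans ((congrArg₂ (· + ·) h h').trans ?_)
      rw [← finsum_add_distrib (hfin v) (hfin v')]
      refine finsum_congr fun i => ?_
      rw [map_add, Submodule.coe_add, Pi.add_apply, smul_add]
    · obtain ⟨k, hk⟩ := isJacobiArray_bracket hG.hasBinomials hu'.1 hv.1
        (hG.mutuallyLocal hu' hv)
      refine (hk.eq_expansion hG.hasBinomials r hm).trans (finsum_congr fun i => ?_)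
      rw [hG.vertexOp_apply hu' hv]
      rfl

end IsVertexSpace
end Twist

end

end TwistedVertex

theorem mainTheorem3 {F W : Type*} [Field F] [IsAlgClosed F] (p : ℕ) [Fact p.Prime] [CharP F p]
    (T : ℕ) (hT : T.Coprime p) (η : F) (hη : IsPrimitiveRoot η T)
    [AddCommGroup W] [Module F W] (𝒲 : ZMod 2 → Submodule F W) (h𝒲 : DirectSum.IsInternal 𝒲)
    (S : Submodule F (ℤ → Module.End F W)) (hS : IsLocalSubspace T η 𝒲 S) :
    S ≤ generated T η 𝒲 S ∧ IsLocalSubspace T η 𝒲 (generated T η 𝒲 S) ∧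
    ∃ (𝒱 : VertexSuperalgebra F (generated T η 𝒲 S))
      (g : generated T η 𝒲 S ≃ₗ[F] generated T η 𝒲 S)
      (YW : generated T η 𝒲 S →ₗ[F] ℤ → Module.End F W),
      -- the vertex superalgebra structure on `⟨S⟩`
      (∀ α (a : generated T η 𝒲 S), a ∈ 𝒱.parity α ↔ ∀ n, a.1 n ∈ endParity 𝒲 α) ∧
      (𝒱.vacuum : ℤ → Module.End F W) = idField T ∧
      (∀ r r' α β (a b : generated T η 𝒲 S), IsHomogeneous η 𝒲 r α a.1 →
        IsHomogeneous η 𝒲 r' β b.1 →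
        ∀ n, (𝒱.Y a n b : ℤ → Module.End F W) = nthProduct T (superSign F α β) r n a.1 b.1) ∧
      -- the automorphism
      𝒱.IsAutomorphism g ∧ (∀ a, (g a : ℤ → Module.End F W) = twist η a.1) ∧ g ^ T = 1 ∧
      (∀ m : ℕ, g ^ m = 1 ↔ ∀ a ∈ S, (twist η ^ m) a = a) ∧
      -- the faithful twisted super module
      𝒱.IsTwistedSuperModule g T η 𝒲 YW ∧ Function.Injective YW ∧ ∀ a, YW a = a.1 := by
  have hB : HasBinomials F T := hasBinomials_of_coprime p hT
  have : NeZero T := ⟨hB.ne_zero⟩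
  obtain ⟨P, hP⟩ := exists_isParityProjection h𝒲
  have hG : IsVertexSpace T η 𝒲 P (generated T η 𝒲 S) :=
    ⟨hB, hη, hP, isLocalSubspace_generated hB h𝒲 hη hS, isClosedSubspace_generated⟩
  refine ⟨le_generated, hG.isLocal, hG.vertexSuperalgebra, hG.automorphism,
    (generated T η 𝒲 S).subtype, fun α a => Iff.rfl, rfl,
    fun r r' α β a b ha hb n => hG.vertexOp_apply ha hb n, hG.isAutomorphism_automorphism,
    hG.automorphism_apply, ?_, fun m => ⟨fun h a ha => ?_, fun h => ?_⟩,
    hG.isTwistedSuperModule_subtype, Subtype.val_injective, fun a => rfl⟩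
  · refine LinearEquiv.ext fun a => Subtype.ext ?_
    rw [hG.automorphism_pow_apply, twist_pow_eq_one hη]
    rfl
  · rw [← hG.automorphism_pow_apply m ⟨a, le_generated ha⟩, h]
    rfl
  · have hle := generated_le (le_inf (fun a ha => LinearMap.mem_ker.mpr (sub_eq_zero.mpr (h a ha)))
      hS.le_fieldSpace) (isClosedSubspace_fixedPoints (𝒲 := 𝒲) hB hη m)
    refine LinearEquiv.ext fun a => Subtype.ext ?_
    rw [hG.automorphism_pow_apply]
    exact sub_eq_zero.mp (LinearMap.mem_ker.mp (hle a.2).1)
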